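/- Let $K,L$ be positive integers with $L\ge 10$ and $\frac{3L}{2}\le K\le 3L-2$. Let $m_0$ be a trigonometric polynomial (a finite sum $\sum_n h_n e^{2\pi i n\xi}$) with real coefficients, $m_0(0)=1$ and $$|m_0(\xi)|^2=(\cos \pi\xi)^{2K}\sum_{n=0}^{L-1}\binom{K-1+n}{n}(\sin\pi\xi)^{2n},\qquad \xi\in\mathbb R,$$ and let $m_1$ be a trigonometric polynomial with $|m_1(\xi)|^2=|m_0(\xi+\frac12)|^2$ for all $\xi\in\mathbb R$. With $\hat f(\xi)=\int f(x)e^{-2\pi i\langle x,\xi\rangle}\,dx$, extended to $L^2$, the product $\prod_{j\ge0}m_0(2^{-j}\xi)$ converges (unconditionally) for every $\xi\in\mathbb R$, and there are $\phi\in L^2(\mathbb R)$ and $\psi\in L^2(\mathbb R^2)$ (necessarily unique) with $$\hat\phi(\xi)=\prod_{j=0}^\infty m_0(2^{-j}\xi),\qquad \hat\psi(\xi_1,\xi_2)=m_1(4\xi_1)\,\hat\phi(\xi_1)\,\hat\phi(2\xi_2)\qquad\text{almost everywhere}.$$ Put $\phi(x_1,x_2)=\phi(x_1)\phi(x_2)$,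 $\tilde\psi(x_1,x_2)=\psi(x_2,x_1)$, and $$A_a=\begin{pmatrix}a&0\\0&\sqrt a\end{pmatrix},\quad \tilde A_a=\begin{pmatrix}\sqrt a&0\\0&a\end{pmatrix},\quad S_s=\begin{pmatrix}1&s\\0&1\end{pmatrix},\quad M_c=\begin{pmatrix}c_1&0\\0&c_2\end{pmatrix},\quad \tilde M_c=\begin{pmatrix}c_2&0\\0&c_1\end{pmatrix}.$$ For $c=(c_1,c_2)$ with $c_1,c_2>0$, the cone-adapted system $\mathcal{SH}(c;\phi,\psi,\tilde\psi)$ is the family consisting of the functions $$\phi(\cdot-c_1m),\qquad \psi_{j,k,m}=2^{3j/4}\psi(S_{-k}A_{2^j}\cdot-M_cm),\qquad \tilde\psi_{j,k,m}=2^{3j/4}\tilde\psi(S_{-k}^T\tilde A_{2^j}\cdot-\tilde M_cm),$$ where $m\in\mathbb Z^2$, $j\ge0$ and $k\in\mathbb Z$ with $|k|\le\lceil 2^{j/2}\rceil$. A family $(g_i)_i$ in $L^2(\mathbb R^2)$ is called a frame for a subspace $V\subseteq L^2(\mathbb R^2)$ if there are $0<A\le B<\infty$ with $A\|f\|^2\le\sum_i|\langle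 f,g_i\rangle|^2\le B\|f\|^2$ for all $f\in V$ (the $g_i$ need not lie in $V$). Let $\mathcal C=\{\xi\in\mathbb R^2:|\xi_1|\ge1,\ |\xi_2/\xi_1|\le1\}$ and $L^2(\mathcal C)=\{f\in L^2(\mathbb R^2):\hat f=0\text{ a.e. outside }\mathcal C\}$. Then there is a constant $\hat c_1>0$ such that for all $c=(c_1,c_2)$ with $0<c_2\le c_1\le\hat c_1$: 1. $\{\psi_{j,k,m}\}$ is a frame for $L^2(\mathcal C)$; 2. $\mathcal{SH}(c;\phi,\psi,\tilde\psi)$ is a frame for $L^2(\mathbb R^2)$; 3. every member of $\mathcal{SH}(c;\phi,\psi,\tilde\psi)$ is compactly supported (vanishes a.e. outside a compact set). -/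

import Mathlib

open MeasureTheory FourierTransform

namespace Shearlet

noncomputable section

/-- The plane `ℝ²` with its Euclidean structure. -/
abbrev Plane : Type := EuclideanSpace ℝ (Fin 2)

/-- `L²(ℝ)`, complex valued. -/
abbrev L2Line : Type := Lp (α := ℝ) ℂ 2

/-- `L²(ℝ²)`, complex valued. -/
abbrev L2Plane : Type := Lp (α := Plane) ℂ 2

/-! ### Filters and the scaling function -/

/-- `m` is a (1-periodic) trigonometric polynomial with complex coefficients. -/
def IsTrigPoly (m : ℝ → ℂ) : Prop :=
  ∃ h : ℤ →₀ ℂ, ∀ ξ : ℝ,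
    m ξ = ∑ n ∈ h.support, h n * Complex.exp (2 * Real.pi * Complex.I * n * ξ)

/-- `m` is a (1-periodic) trigonometric polynomial with real coefficients. -/
def IsRealTrigPoly (m : ℝ → ℂ) : Prop :=
  ∃ h : ℤ →₀ ℝ, ∀ ξ : ℝ,
    m ξ = ∑ n ∈ h.support, (h n : ℂ) * Complex.exp (2 * Real.pi * Complex.I * n * ξ)

/-- `m₀` is a maximally flat low pass filter with parameters `K`, `L`. -/
structure IsLowPass (K L : ℕ) (m₀ : ℝ → ℂ) : Prop where
  trig : IsRealTrigPoly m₀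
  zero : m₀ 0 = 1
  normSq : ∀ ξ : ℝ, ‖m₀ ξ‖ ^ 2 = Real.cos (Real.pi * ξ) ^ (2 * K) *
    ∑ n ∈ Finset.range L, (Nat.choose (K - 1 + n) n : ℝ) * Real.sin (Real.pi * ξ) ^ (2 * n)

/-- `m₁` is a bandpass filter associated with the low pass filter `m₀`. -/
structure IsBandPass (m₀ m₁ : ℝ → ℂ) : Prop where
  trig : IsTrigPoly m₁
  normSq : ∀ ξ : ℝ, ‖m₁ ξ‖ ^ 2 = ‖m₀ (ξ + 1 / 2)‖ ^ 2

/-- The `j`-th factor `m₀ (2⁻ʲ ξ)` of the infinite product for the scaling function. -/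
def scalingFactor (m₀ : ℝ → ℂ) (ξ : ℝ) (j : ℕ) : ℂ := m₀ (((2 : ℝ) ^ j)⁻¹ * ξ)

/-- The function `ξ ↦ ∏_{j ≥ 0} m₀ (2⁻ʲ ξ)`. -/
def scalingHat (m₀ : ℝ → ℂ) (ξ : ℝ) : ℂ := ∏' j : ℕ, scalingFactor m₀ ξ j

/-- The function `ξ ↦ m₁ (4 ξ₁) φ̂ (ξ₁) φ̂ (2 ξ₂)`. -/
def shearletHat (m₀ m₁ : ℝ → ℂ) (ξ : Plane) : ℂ :=
  m₁ (4 * ξ 0) * scalingHat m₀ (ξ 0) * scalingHat m₀ (2 * ξ 1)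

/-! ### Shearlet systems -/

/-- Action of a real `2 × 2` matrix on the plane. -/
def act (M : Matrix (Fin 2) (Fin 2) ℝ) (x : Plane) : Plane := Matrix.toEuclideanLin M x

/-- The integer vector `m ∈ ℤ²`, seen in the plane. -/
def intVec (m : ℤ × ℤ) : Plane := !₂[(m.1 : ℝ), (m.2 : ℝ)]

/-- Parabolic scaling matrix `A_a`. -/
def scaleMat (a : ℝ) : Matrix (Fin 2) (Fin 2) ℝ := !![a, 0; 0, Real.sqrt a]

/-- Parabolic scaling matrix `Ã_a`. -/
def scaleMat' (a : ℝ) : Matrix (Fin 2) (Fin 2) ℝ := !![Real.sqrt a, 0; 0, a]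

/-- Shear matrix `S_s`. -/
def shearMat (s : ℝ) : Matrix (Fin 2) (Fin 2) ℝ := !![1, s; 0, 1]

/-- Sampling matrix `M_c`, `c = (c₁, c₂)`. -/
def sampMat (c₁ c₂ : ℝ) : Matrix (Fin 2) (Fin 2) ℝ := !![c₁, 0; 0, c₂]

/-- Sampling matrix `M̃_c`, `c = (c₁, c₂)`. -/
def sampMat' (c₁ c₂ : ℝ) : Matrix (Fin 2) (Fin 2) ℝ := !![c₂, 0; 0, c₁]

/-- The index set of triples `(j, k, m)` with `j ≥ 0`, `|k| ≤ ⌈2^{j/2}⌉` and `m ∈ ℤ²`. -/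
abbrev ConeIndex : Type :=
  {p : ℕ × ℤ × (ℤ × ℤ) // |p.2.1| ≤ ⌈(2 : ℝ) ^ ((p.1 : ℝ) / 2)⌉}

/-- The translates `φ(· - c₁ m)`. -/
def lowPart (c₁ : ℝ) (φ : Plane → ℂ) (m : ℤ × ℤ) (x : Plane) : ℂ :=
  φ (x - c₁ • intVec m)

/-- The horizontal shearlets `2^{3j/4} ψ(S_{-k} A_{2^j} · - M_c m)`. -/
def horizPart (c₁ c₂ : ℝ) (ψ : Plane → ℂ) (i : ConeIndex) (x : Plane) : ℂ :=
  let j : ℕ := i.1.1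
  let k : ℤ := i.1.2.1
  let m : ℤ × ℤ := i.1.2.2
  (((2 : ℝ) ^ (3 * (j : ℝ) / 4) : ℝ) : ℂ) *
    ψ (act (shearMat (-(k : ℝ)) * scaleMat ((2 : ℝ) ^ j)) x - act (sampMat c₁ c₂) (intVec m))

/-- The vertical shearlets `2^{3j/4} ψ̃(S_{-k}ᵀ Ã_{2^j} · - M̃_c m)`. -/
def vertPart (c₁ c₂ : ℝ) (ψt : Plane → ℂ) (i : ConeIndex) (x : Plane) : ℂ :=
  let j : ℕ := i.1.1
  let k : ℤ := i.1.2.1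
  let m : ℤ × ℤ := i.1.2.2
  (((2 : ℝ) ^ (3 * (j : ℝ) / 4) : ℝ) : ℂ) *
    ψt (act ((shearMat (-(k : ℝ))).transpose * scaleMat' ((2 : ℝ) ^ j)) x
      - act (sampMat' c₁ c₂) (intVec m))

/-- The cone-adapted regular discrete shearlet system `SH(c; φ, ψ, ψ̃)`, as a family of functions
indexed by the parameters of its three parts. -/
def system (c₁ c₂ : ℝ) (φ ψ ψt : Plane → ℂ) :
    (ℤ × ℤ) ⊕ ConeIndex ⊕ ConeIndex → Plane → ℂ
  | Sum.inl m => lowPart c₁ φ m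
  | Sum.inr (Sum.inl i) => horizPart c₁ c₂ ψ i
  | Sum.inr (Sum.inr i) => vertPart c₁ c₂ ψt i

/-! ### Frames -/

/-- The members of `g` lie in `L²(ℝ²)` and satisfy the frame inequalities
`A ‖f‖² ≤ ∑ᵢ |⟨f, gᵢ⟩|² ≤ B ‖f‖²`, with `0 < A ≤ B < ∞`, for all `f ∈ V`. -/
def IsFrameFor {ι : Type} (V : Set L2Plane) (g : ι → Plane → ℂ) : Prop :=
  ∃ hg : ∀ i, MemLp (g i) 2 (volume : Measure Plane),
    ∃ A B : ℝ, 0 < A ∧ A ≤ B ∧ ∀ f ∈ V,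
      Summable (fun i => ‖inner ℂ ((hg i).toLp (g i)) f‖ ^ 2) ∧
      A * ‖f‖ ^ 2 ≤ ∑' i, ‖inner ℂ ((hg i).toLp (g i)) f‖ ^ 2 ∧
      ∑' i, ‖inner ℂ ((hg i).toLp (g i)) f‖ ^ 2 ≤ B * ‖f‖ ^ 2

/-- The horizontal frequency cone `{|ξ₁| ≥ 1, |ξ₂ / ξ₁| ≤ 1}`. -/
def horizCone : Set Plane := {ξ | 1 ≤ |ξ 0| ∧ |ξ 1 / ξ 0| ≤ 1}

/-- `L²` functions whose Fourier transform is supported in the horizontal cone. -/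
def L2Cone : Set L2Plane :=
  {f | ∀ᵐ ξ ∂(volume : Measure Plane), ξ ∉ horizCone → (𝓕 f : L2Plane) ξ = 0}

/-- `g` vanishes almost everywhere outside a compact set. -/
def HasCompactSupp (g : Plane → ℂ) : Prop :=
  ∃ Q : Set Plane, IsCompact Q ∧ ∀ᵐ x ∂(volume : Measure Plane), x ∉ Q → g x = 0

/-- `(x₁, x₂) ↦ φ(x₁) φ(x₂)`. -/
def tensor (φ : ℝ → ℂ) (x : Plane) : ℂ := φ (x 0) * φ (x 1)

/-- `(x₁, x₂) ↦ ψ(x₂, x₁)`. -/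
def swap (ψ : Plane → ℂ) (x : Plane) : ℂ := ψ !₂[x 1, x 0]

end

end Shearlet

/-! Everything happens on the Fourier side. The coefficients of `f` against the translates of one
dilated and sheared generator are, up to normalisation, the Fourier coefficients over a unit cube of
the periodization of `conj p · F`. Here `p` is the transform of the generator and `F` that of `f`,
both in coordinates rescaled by the sampling constants. By Parseval
(`tsum_sq_integral_eq_periodize`) the sum of squares over all translations is the squared `L²` norm
of the periodization. Its `l = 0` term is the useful part. The aliases `l ≠ 0` are controlled by a
weighted Cauchy–Schwarz inequality and carry a factor `O(c₁)`, because a cubically decaying `p`,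
sampled on a grid of step `1/c`, is small away from the origin.

Summing over scales and shears (`affineCoeff_estimates`) needs two facts about `p`. For the upper
bound and for the error, `∑ₜ |p(Rₜ ξ)|` must be bounded uniformly in `ξ`
(`tsum_enorm_shearletHat_le`); the sum over shears costs `|t|⁻²` at small `t = 2⁻ʲ ξ₁`, which the
third order zero of `m₁(4·)` at the origin pays for, leaving a geometric series in `j`. For the
lower bound, every `ξ` in the cone must be moved by some `Rₜ` into a fixed small region where `|p|`
is bounded below (`exists_scaleIndex`). The result is an inequality `κ a E(f) ≤ 2 S(f) + κ e c₁
‖f‖²`, with `S` the frame sum and `E` the energy in the region; small `c₁` absorbs the last term.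

The filter estimates come from `|cos πξ|^K ≤ |m₀(ξ)|` and `|m₀(ξ)|² ≤ |cos πξ|^(2K) 2^(K+L-1)`
together with Viète's product for the cosines. Since the parameters force `K ≥ L + 5`, the cosines
beat the factors `2^(K+L-1)` by enough to leave cubic decay (`IsLowPass.norm_scalingHat_decay`),
while near the origin the product stays above `2^(-K)`.

The two cones and a low frequency square cover the plane, so the three parts add up to a frame for
`L²(ℝ²)`. Compact support holds because the infinite product is a bounded limit of exponential sums
with frequencies in one fixed ball. -/

namespace Shearlet

/-! ### The `L²` Fourier transform, and a criterion for compact support. -/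

section Fourier

open scoped ContDiff

theorem continuous_neg_inner {V : Type*} [NormedAddCommGroup V] [InnerProductSpace ℝ V] :
    Continuous fun p : V × V => (-innerₗ V) p.1 p.2 :=
  (continuous_inner (𝕜 := ℝ) (E := V)).neg

variable {V : Type*} [NormedAddCommGroup V] [InnerProductSpace ℝ V] [FiniteDimensional ℝ V]
  [MeasurableSpace V] [BorelSpace V]

theorem integral_schwartz_mul_fourierInv (g : SchwartzMap V ℂ) (f : Lp (α := V) ℂ 2 volume) :
    ∫ x, g x * (𝓕⁻ f : Lp (α := V) ℂ 2 volume) x = ∫ ξ, (𝓕⁻ g : SchwartzMap V ℂ) ξ * f ξ := by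
  have h := congrArg (fun T => T g) (Lp.fourierInv_toTemperedDistribution_eq f)
  simpa [Lp.toTemperedDistribution_apply] using h.symm

/-- Pairing with the negated inner product lets the general self-adjointness formula for Fourier
integrals apply to the inverse transform. -/
theorem fourierIntegral_neg_inner (h : V → ℂ) :
    VectorFourier.fourierIntegral Real.fourierChar volume (-innerₗ V) h = 𝓕⁻ h := by
  ext w
  simp [VectorFourier.fourierIntegral, Real.fourierInv_eq]

theorem integral_schwartz_mul_fourierInv_fun (g : SchwartzMap V ℂ) {h : V → ℂ}
    (hh : Integrable h) :
    ∫ x, g x * 𝓕⁻ h x = ∫ ξ, (𝓕⁻ g : SchwartzMap V ℂ) ξ * h ξ := by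
  have := VectorFourier.integral_fourierIntegral_smul_eq_flip (μ := (volume : Measure V))
    (ν := (volume : Measure V)) (L := -innerₗ V)
    (e := Real.fourierChar) Real.continuous_fourierChar continuous_neg_inner g.integrable hh
  have hflip : (-innerₗ V).flip = -innerₗ V := by
    ext v w
    simp [real_inner_comm]
  rw [hflip, fourierIntegral_neg_inner, fourierIntegral_neg_inner] at this
  simpa [SchwartzMap.fourierInv_coe] using this.symm

/-- On `L¹ ∩ L²`, the inverse Fourier transform of `L²` is given by the Fourier integral. -/
theorem fourierInv_toLp_ae_eq {h : V → ℂ} (h1 : Integrable h) (h2 : MemLp h 2) :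
    (𝓕⁻ (h2.toLp h) : Lp (α := V) ℂ 2 volume) =ᵐ[volume] 𝓕⁻ h := by
  have hc : Continuous (𝓕⁻ h) := by
    have := VectorFourier.fourierIntegral_continuous (μ := (volume : Measure V))
      (e := Real.fourierChar) (L := -innerₗ V) Real.continuous_fourierChar continuous_neg_inner h1
    rwa [fourierIntegral_neg_inner] at this
  refine ae_eq_of_integral_contDiff_smul_eq ((Lp.memLp _).locallyIntegrable (by norm_num))
    hc.locallyIntegrable ?_
  intro g hg hgc
  have hg₁ : HasCompactSupport (Complex.ofRealCLM ∘ g) := hgc.comp_left rfl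
  have hg₂ : ContDiff ℝ ∞ (Complex.ofRealCLM ∘ g) := by fun_prop
  have e1 := integral_schwartz_mul_fourierInv (hg₁.toSchwartzMap hg₂) (h2.toLp h)
  have e2 := integral_schwartz_mul_fourierInv_fun (hg₁.toSchwartzMap hg₂) h1
  have e3 : ∫ ξ, (𝓕⁻ (hg₁.toSchwartzMap hg₂) : SchwartzMap V ℂ) ξ * h2.toLp h ξ
      = ∫ ξ, (𝓕⁻ (hg₁.toSchwartzMap hg₂) : SchwartzMap V ℂ) ξ * h ξ :=
    integral_congr_ae (by filter_upwards [h2.coeFn_toLp] with x hx; rw [hx])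
  simpa using e1.trans (e3.trans e2.symm)

/-- The exponential sums with frequencies in the ball of radius `r`. -/
def expSums (V : Type*) [NormedAddCommGroup V] [InnerProductSpace ℝ V] (r : ℝ) :
    Submodule ℂ (V → ℂ) :=
  Submodule.span ℂ ((fun (a : V) (ξ : V) => (Real.fourierChar (-inner ℝ ξ a) : ℂ)) ''
    Metric.closedBall 0 r)

/-- By Fourier inversion, integrating `𝓕⁻ g` against the exponential of frequency `a` returns `g a`,
which is zero on the ball; linearity does the rest. -/
theorem integral_fourierInv_mul_expSum {r : ℝ} (g : SchwartzMap V ℂ)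
    (hg : ∀ x ∈ Metric.closedBall (0 : V) r, g x = 0) {p : V → ℂ} (hp : p ∈ expSums V r) :
    Integrable (fun ξ => (𝓕⁻ g : SchwartzMap V ℂ) ξ * p ξ) ∧
      ∫ ξ, (𝓕⁻ g : SchwartzMap V ℂ) ξ * p ξ = 0 := by
  induction hp using Submodule.span_induction with
  | mem p hp =>
    obtain ⟨a, ha, rfl⟩ := hp
    have e : ∀ ξ, (𝓕⁻ g : SchwartzMap V ℂ) ξ * (Real.fourierChar (-inner ℝ ξ a) : ℂ)
      = Real.fourierChar (-inner ℝ ξ a) • (𝓕⁻ g : SchwartzMap V ℂ) ξ := fun ξ => by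
        rw [mul_comm]; rfl
    constructor
    · simp only [e]
      exact (Real.fourierIntegral_convergent_iff a).2 (𝓕⁻ g : SchwartzMap V ℂ).integrable
    · simp only [e]
      rw [← Real.fourier_eq (fun ξ => (𝓕⁻ g : SchwartzMap V ℂ) ξ) a, ← SchwartzMap.fourier_coe,
        fourier_fourierInv_eq]
      exact hg a ha
  | zero => simp
  | add p q _ _ hp hq =>
    simp only [Pi.add_apply, mul_add]
    exact ⟨hp.1.add hq.1, by rw [integral_add hp.1 hq.1, hp.2, hq.2, add_zero]⟩
  | smul c p _ hp =>
    simp only [Pi.smul_apply, smul_eq_mul, mul_left_comm _ c]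
    exact ⟨hp.1.const_mul c, by rw [integral_const_mul, hp.2, mul_zero]⟩

/-- If `F` is a bounded limit of exponential sums with frequencies in a
fixed ball, then its inverse Fourier transform vanishes outside of this ball. -/
theorem ae_eq_zero_of_tendsto_expSums {r C : ℝ} {p : ℕ → V → ℂ} {h : V → ℂ}
    (hp : ∀ n, p n ∈ expSums V r) (hC : ∀ n ξ, ‖p n ξ‖ ≤ C)
    (hlim : ∀ ξ, Filter.Tendsto (fun n => p n ξ) Filter.atTop (nhds (h ξ)))
    {F : Lp (α := V) ℂ 2 volume} (hf : F =ᵐ[volume] h) :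
    ∀ᵐ x ∂(volume : Measure V), x ∉ Metric.closedBall (0 : V) r →
      (𝓕⁻ F : Lp (α := V) ℂ 2 volume) x = 0 := by
  refine Metric.isClosed_closedBall.isOpen_compl.ae_eq_zero_of_integral_contDiff_smul_eq_zero
    (((Lp.memLp _).locallyIntegrable (by norm_num)).locallyIntegrableOn _) ?_
  intro g hg hgc hgs
  have hg₁ : HasCompactSupport (Complex.ofRealCLM ∘ g) := hgc.comp_left rfl
  have hg₂ : ContDiff ℝ ∞ (Complex.ofRealCLM ∘ g) := by fun_prop
  have e1 := integral_schwartz_mul_fourierInv (hg₁.toSchwartzMap hg₂) F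
  have e3 : ∫ ξ, (𝓕⁻ (hg₁.toSchwartzMap hg₂) : SchwartzMap V ℂ) ξ * F ξ
      = ∫ ξ, (𝓕⁻ (hg₁.toSchwartzMap hg₂) : SchwartzMap V ℂ) ξ * h ξ := by
    refine integral_congr_ae ?_
    filter_upwards [hf] with x hx
    rw [hx]
  have hz : ∀ x ∈ Metric.closedBall (0 : V) r, (hg₁.toSchwartzMap hg₂) x = 0 := by
    intro x hx
    have : g x = 0 := by
      by_contra hne
      exact hgs (subset_tsupport g hne) hx
    simp [this]
  -- Dominated convergence, with `C` times the integrable `‖𝓕⁻ g‖` as majorant; each approximating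
  -- integral is zero.
  have e4 : ∫ ξ, (𝓕⁻ (hg₁.toSchwartzMap hg₂) : SchwartzMap V ℂ) ξ * h ξ = 0 := by
    refine tendsto_nhds_unique (tendsto_integral_of_dominated_convergence
      (F := fun n ξ => (𝓕⁻ (hg₁.toSchwartzMap hg₂) : SchwartzMap V ℂ) ξ * p n ξ)
      (fun ξ => ‖(𝓕⁻ (hg₁.toSchwartzMap hg₂) : SchwartzMap V ℂ) ξ‖ * C)
      (fun n => (integral_fourierInv_mul_expSum _ hz (hp n)).1.aestronglyMeasurable)
      (((𝓕⁻ (hg₁.toSchwartzMap hg₂) : SchwartzMap V ℂ).integrable (μ := volume)).norm.mul_const C) ?_ ?_) ?_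
    · intro n
      filter_upwards with ξ
      rw [norm_mul]
      exact mul_le_mul_of_nonneg_left (hC n ξ) (norm_nonneg _)
    · filter_upwards with ξ
      exact (hlim ξ).const_mul _
    · simp only [(integral_fourierInv_mul_expSum _ hz (hp _)).2, tendsto_const_nhds]
  simpa using e1.trans (e3.trans e4)

end Fourier

/-! ### Fourier transforms of affine images of a function. -/

section Affine

open scoped ContDiff

variable {V : Type*} [NormedAddCommGroup V] [InnerProductSpace ℝ V] [FiniteDimensional ℝ V]
  [MeasurableSpace V] [BorelSpace V]

theorem integral_comp_of_map_eq {R : V ≃L[ℝ] V} {D : ℝ} (hD : 0 < D)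
    (hR : Measure.map R (volume : Measure V) = ENNReal.ofReal D • volume) (u : V → ℂ) :
    ∫ ξ, u (R ξ) = D * ∫ η, u η := by
  have := (R.toHomeomorph.toMeasurableEquiv.measurableEmbedding.integral_map (μ := volume) u)
  have h2 : Measure.map R.toHomeomorph.toMeasurableEquiv (volume : Measure V)
    = ENNReal.ofReal D • volume := hR
  rw [h2, integral_smul_measure, ENNReal.toReal_ofReal hD.le] at this
  rw [← Complex.real_smul, this]
  rfl

/-- The Fourier representation of the affine images `s ψ(B · - b)`. -/
theorem inner_affine_eq {p ψ : V → ℂ} (h1 : Integrable p) (h2 : MemLp p 2)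
    (hψ : ψ =ᵐ[volume] 𝓕⁻ p) {B R : V ≃L[ℝ] V} (hBR : ∀ ξ x, inner ℝ (R ξ) (B x) = inner ℝ ξ x)
    {D : ℝ} (hD : 0 < D)
    (hR : Measure.map R (volume : Measure V) = ENNReal.ofReal D • volume) (b : V) (s : ℂ) :
    ∃ hg : MemLp (fun x => s * ψ (B x - b)) 2 (volume : Measure V),
      ∀ f : Lp (α := V) ℂ 2 volume, inner ℂ (hg.toLp _) f =
        ∫ ξ, (starRingEnd ℂ) (s * (D : ℂ)⁻¹ * (Real.fourierChar (-inner ℝ (R ξ) b) * p (R ξ))) *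
          (𝓕 f : Lp (α := V) ℂ 2 volume) ξ := by
  set q : V → ℂ := fun ξ => s * (D : ℂ)⁻¹ * (Real.fourierChar (-inner ℝ (R ξ) b) * p (R ξ)) with hq
  have hRe : MeasurableEmbedding R := R.toHomeomorph.toMeasurableEquiv.measurableEmbedding
  have hpR1 : Integrable (fun ξ => p (R ξ)) := by
    have : Integrable p (Measure.map R volume) := by
      rw [hR]; exact h1.smul_measure ENNReal.ofReal_ne_top
    exact (hRe.integrable_map_iff).1 this
  have hpR2 : MemLp (fun ξ => p (R ξ)) 2 := by
    have : MemLp p 2 (Measure.map R volume) := by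
      rw [hR]; exact h2.smul_measure ENNReal.ofReal_ne_top
    exact (hRe.memLp_map_measure_iff).1 this
  have hchar : Continuous fun ξ => (Real.fourierChar (-inner ℝ (R ξ) b) : ℂ) := by
    have : Continuous fun ξ : V => -inner ℝ (R ξ) b := by fun_prop
    exact continuous_subtype_val.comp (Real.continuous_fourierChar.comp this)
  have hm : AEStronglyMeasurable (fun ξ => (Real.fourierChar (-inner ℝ (R ξ) b) : ℂ) * p (R ξ)) :=
    hchar.aestronglyMeasurable.mul hpR1.aestronglyMeasurable
  have hnorm : ∀ ξ, ‖(Real.fourierChar (-inner ℝ (R ξ) b) : ℂ) * p (R ξ)‖ = ‖p (R ξ)‖ := by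
    intro ξ; rw [norm_mul, Circle.norm_coe, one_mul]
  have hq1 : Integrable q := (hpR1.congr' hm
    (Filter.Eventually.of_forall fun ξ => (hnorm ξ).symm)).const_mul _
  have hq2 : MemLp q 2 := (hpR2.congr_norm hm
    (Filter.Eventually.of_forall fun ξ => (hnorm ξ).symm)).const_mul _
  have hD' : (D : ℂ) ≠ 0 := by exact_mod_cast hD.ne'
  -- Substitute `η = R ξ`. As `R` is the inverse transpose of `B`, the phase `⟨ξ, x⟩` becomes `⟨η, B
  -- x⟩`, the translation becomes a character, and the Jacobian `D` cancels `D⁻¹`.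
  have hfun : 𝓕⁻ q = fun x => s * 𝓕⁻ p (B x - b) := by
    ext x
    rw [Real.fourierInv_eq, Real.fourierInv_eq]
    have e := integral_comp_of_map_eq hD hR
      (fun η => Real.fourierChar (inner ℝ η (B x - b)) • p η)
    have e' : ∀ ξ, Real.fourierChar (inner ℝ ξ x) • q ξ = (s * (D : ℂ)⁻¹) *
        Real.fourierChar (inner ℝ (R ξ) (B x - b)) • p (R ξ) := by
      intro ξ
      rw [inner_sub_right, hBR, sub_eq_add_neg, AddChar.map_add_eq_mul]
      simp only [hq, Circle.smul_def, smul_eq_mul, Circle.coe_mul]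
      ring
    simp only [e']
    rw [integral_const_mul, e]
    field_simp
  have hBq : Measure.QuasiMeasurePreserving (fun x : V => B x - b) volume volume := by
    have hB : Measure.QuasiMeasurePreserving B (volume : Measure V) volume := by
      refine ⟨B.continuous.measurable, ?_⟩
      have hdet : LinearMap.det (B.toLinearEquiv : V →ₗ[ℝ] V) ≠ 0 :=
        (LinearEquiv.isUnit_det' B.toLinearEquiv).ne_zero
      have := Measure.map_linearMap_addHaar_eq_smul_addHaar (volume : Measure V) hdet
      have h3 : Measure.map B (volume : Measure V) = _ := this
      rw [h3]
      exact Measure.smul_absolutelyContinuous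
    exact (measurePreserving_sub_right volume b).quasiMeasurePreserving.comp hB
  have hae : (fun x => s * ψ (B x - b)) =ᵐ[volume] (𝓕⁻ (hq2.toLp q) : Lp (α := V) ℂ 2 volume) := by
    refine Filter.EventuallyEq.trans ?_ (fourierInv_toLp_ae_eq hq1 hq2).symm
    rw [hfun]
    filter_upwards [hBq.ae hψ] with x hx
    rw [hx]
  have hg := (memLp_congr_ae hae).2 (Lp.memLp _)
  refine ⟨hg, fun f => ?_⟩
  have e1 : hg.toLp _ = (𝓕⁻ (hq2.toLp q) : Lp (α := V) ℂ 2 volume) := by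
    apply Lp.ext
    exact hg.coeFn_toLp.trans hae
  rw [e1, ← Lp.inner_fourier_eq, fourier_fourierInv_eq, L2.inner_def]
  refine integral_congr_ae ?_
  filter_upwards [hq2.coeFn_toLp] with ξ hξ
  rw [hξ, RCLike.inner_apply, mul_comm]

end Affine

/-! ### Periodization over the integer lattice, and Parseval on the cube. -/

section Periodization

open scoped ENNReal

theorem two_mul_le_sq_add_sq (a b : ℝ≥0∞) : 2 * a * b ≤ a ^ 2 + b ^ 2 := by
  wlog h : a ≤ b generalizing a b
  · rw [add_comm, mul_right_comm]
    exact this b a (le_of_not_ge h)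
  obtain ⟨c, rfl⟩ := exists_add_of_le h
  calc 2 * a * (a + c) ≤ 2 * a * (a + c) + c ^ 2 := le_self_add
    _ = _ := by ring

/-- Weighted Cauchy–Schwarz without square roots: expand the square as a double sum and apply `2xy ≤
x² + y²` termwise, the weight `a i * a j` staying symmetric. -/
theorem sq_tsum_mul_le {ι : Type*} (a b : ι → ℝ≥0∞) :
    (∑' i, a i * b i) ^ 2 ≤ (∑' i, a i) * ∑' i, a i * b i ^ 2 := by
  have h : ∀ i j, 2 * ((a i * b i) * (a j * b j)) ≤ a i * (a j * b j ^ 2) + a j * (a i * b i ^ 2) := by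
    intro i j
    calc 2 * ((a i * b i) * (a j * b j)) = (a i * a j) * (2 * b i * b j) := by ring
      _ ≤ (a i * a j) * (b i ^ 2 + b j ^ 2) := by gcongr; exact two_mul_le_sq_add_sq _ _
      _ = _ := by ring
  have h2 : 2 * (∑' i, a i * b i) ^ 2 ≤ 2 * ((∑' i, a i) * ∑' i, a i * b i ^ 2) := by
    calc 2 * (∑' i, a i * b i) ^ 2 = ∑' i, ∑' j, 2 * ((a i * b i) * (a j * b j)) := by
          simp_rw [ENNReal.tsum_mul_left, ENNReal.tsum_mul_right, sq]
      _ ≤ ∑' i, ∑' j, (a i * (a j * b j ^ 2) + a j * (a i * b i ^ 2)) :=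
          ENNReal.tsum_le_tsum fun i => ENNReal.tsum_le_tsum fun j => h i j
      _ = _ := by
          simp_rw [ENNReal.tsum_add, ENNReal.tsum_mul_left, ENNReal.tsum_mul_right,
            ENNReal.tsum_mul_left]
          ring
  exact (ENNReal.mul_le_mul_iff_right (by norm_num) (by norm_num)).1 h2

variable {d : Type*}

/-- The unit cube `(-1/2, 1/2]^d`. -/
def unitBox (d : Type*) : Set (d → ℝ) := {x | ∀ i, x i ∈ Set.Ioc (-1 / 2 : ℝ) (-1 / 2 + 1)}

/-- Integer vectors as real vectors. -/
def latt (l : d → ℤ) : d → ℝ := fun i => l i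

theorem existsUnique_sub_mem_unitBox (x : d → ℝ) : ∃! l : d → ℤ, x - latt l ∈ unitBox d := by
  have h := fun i => existsUnique_sub_zsmul_mem_Ioc (one_pos (α := ℝ)) (x i) (-1 / 2)
  choose l hl hl' using h
  refine ⟨l, fun i => by simpa [latt] using hl i, fun l' h' => ?_⟩
  ext i
  exact hl' i (l' i) (by simpa [latt] using h' i)

/-- The translate of the unit cube by `l`. -/
def latticeCell (l : d → ℤ) : Set (d → ℝ) := (fun x => x - latt l) ⁻¹' unitBox d

theorem iUnion_latticeCell : ⋃ l : d → ℤ, latticeCell l = Set.univ := by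
  ext x
  simpa [latticeCell] using (existsUnique_sub_mem_unitBox x).exists

theorem pairwise_disjoint_latticeCell :
    Pairwise (Function.onFun Disjoint fun l : d → ℤ => latticeCell l) := by
  intro l l' hne
  refine Set.disjoint_left.2 fun x h1 h2 => hne ?_
  exact (existsUnique_sub_mem_unitBox x).unique h1 h2

variable [Fintype d]

theorem measurableSet_unitBox : MeasurableSet (unitBox d) :=
  MeasurableSet.univ_pi' fun _ => measurableSet_Ioc

theorem measurableSet_latticeCell (l : d → ℤ) : MeasurableSet (latticeCell l) :=
  measurableSet_unitBox.preimage (measurable_id.sub_const _)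

theorem lintegral_eq_tsum_unitBox (g : (d → ℝ) → ℝ≥0∞) :
    ∫⁻ x, g x = ∑' l : d → ℤ, ∫⁻ x in unitBox d, g (x + latt l) := by
  rw [← setLIntegral_univ, ← iUnion_latticeCell,
    lintegral_iUnion measurableSet_latticeCell pairwise_disjoint_latticeCell]
  refine tsum_congr fun l => ?_
  have := (measurePreserving_sub_right (volume : Measure (d → ℝ))
    (latt l)).setLIntegral_comp_preimage_emb (MeasurableEquiv.subRight (latt l)).measurableEmbedding
    (fun x => g (x + latt l)) (unitBox d)
  simpa [latticeCell] using this

theorem quasiMeasurePreserving_add_latt (l : d → ℤ) :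
    Measure.QuasiMeasurePreserving (fun x => x + latt l) (volume.restrict (unitBox d)) volume :=
  (measurePreserving_add_right volume (latt l)).quasiMeasurePreserving.mono_left
    Measure.restrict_le_self.absolutelyContinuous

/-- The periodization of `U`. -/
noncomputable def periodize (U : (d → ℝ) → ℂ) (x : d → ℝ) : ℂ := ∑' l : d → ℤ, U (x + latt l)

theorem ae_summable_periodize {U : (d → ℝ) → ℂ} (hU : Integrable U) :
    ∀ᵐ x ∂(volume.restrict (unitBox d)), Summable fun l : d → ℤ => U (x + latt l) := by
  have h1 : ∫⁻ x in unitBox d, ∑' l : d → ℤ, ‖U (x + latt l)‖ₑ ≠ ∞ := by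
    rw [lintegral_tsum, ← lintegral_eq_tsum_unitBox (fun x => ‖U x‖ₑ)]
    · exact hU.2.ne
    · intro l
      exact (hU.1.comp_quasiMeasurePreserving (quasiMeasurePreserving_add_latt l)).enorm
  filter_upwards [ae_lt_top' (AEMeasurable.tsum fun l => (hU.1.comp_quasiMeasurePreserving
      (quasiMeasurePreserving_add_latt l)).enorm) h1] with x hx
  exact (tsum_enorm_ne_top_iff_summable_norm.1 hx.ne).of_norm

theorem aestronglyMeasurable_periodize {U : (d → ℝ) → ℂ} (hU : Integrable U) :
    AEStronglyMeasurable (periodize U) (volume.restrict (unitBox d)) := by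
  refine aestronglyMeasurable_of_tendsto_ae (Filter.atTop : Filter (Finset (d → ℤ)))
    (f := fun s x => ∑ l ∈ s, U (x + latt l)) (fun s => ?_) ?_
  · refine Finset.aestronglyMeasurable_fun_sum _ fun l _ => ?_
    exact (hU.1.comp_quasiMeasurePreserving (quasiMeasurePreserving_add_latt l))
  · filter_upwards [ae_summable_periodize hU] with x hx
    exact hx.hasSum

theorem integral_periodize {U : (d → ℝ) → ℂ} (hU : Integrable U) :
    ∫ x in unitBox d, periodize U x = ∫ x, U x := by
  simp only [periodize]
  rw [integral_tsum]
  · rw [← setIntegral_univ (μ := volume) (f := U), ← iUnion_latticeCell,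
      integral_iUnion measurableSet_latticeCell pairwise_disjoint_latticeCell hU.integrableOn]
    refine tsum_congr fun l => ?_
    have := (measurePreserving_sub_right (volume : Measure (d → ℝ))
      (latt l)).setIntegral_preimage_emb (MeasurableEquiv.subRight (latt l)).measurableEmbedding
      (fun x => U (x + latt l)) (unitBox d)
    simpa [latticeCell] using this.symm
  · exact fun l => hU.1.comp_quasiMeasurePreserving (quasiMeasurePreserving_add_latt l)
  · rw [← lintegral_eq_tsum_unitBox (fun x => ‖U x‖ₑ)]
    exact hU.2.ne

/-- The character `e^{2π i m · x}`. -/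
noncomputable def chr (m : d → ℤ) (x : d → ℝ) : ℂ := Real.fourierChar (∑ i, m i * x i)

theorem chr_add_latt (m l : d → ℤ) (x : d → ℝ) : chr m (x + latt l) = chr m x := by
  have h : ∑ i, (m i : ℝ) * (x + latt l) i = ∑ i, (m i : ℝ) * x i + ((∑ i, m i * l i : ℤ) : ℝ) := by
    simp [latt, mul_add, Finset.sum_add_distrib]
  rw [chr, h, AddChar.map_add_eq_mul, chr]
  have : Real.fourierChar ((∑ i, m i * l i : ℤ) : ℝ) = 1 := by
    ext
    rw [Real.fourierChar_apply]
    simpa [mul_comm, mul_assoc, mul_left_comm] using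
      Complex.exp_int_mul_two_pi_mul_I (∑ i, m i * l i)
  rw [this, mul_one]

theorem norm_chr (m : d → ℤ) (x : d → ℝ) : ‖chr m x‖ = 1 := Circle.norm_coe _


/-- The measure on `ℝ / ℤ` normalised to have total mass one. -/
noncomputable local instance : MeasureSpace UnitAddCircle := ⟨AddCircle.haarAddCircle⟩

theorem mFourier_coe (m : d → ℤ) (x : d → ℝ) :
    UnitAddTorus.mFourier m (fun i => (x i : UnitAddCircle)) = chr m x := by
  simp only [UnitAddTorus.mFourier, chr, ContinuousMap.coe_mk, fourier_coe_apply,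
    Real.fourierChar_apply, ← Complex.exp_sum]
  congr 1
  push_cast
  rw [Finset.mul_sum, Finset.sum_mul]
  refine Finset.sum_congr rfl fun i _ => ?_
  ring

/-- Parseval on the torus, transported to the cube centred at the origin. The centring matters
later, when low frequencies have to fall into the cube. -/
theorem tsum_sq_integral_unitBox {v : (d → ℝ) → ℂ} (hv : MemLp v 2 (volume.restrict (unitBox d))) :
    ∑' m : d → ℤ, ‖∫ x in unitBox d, chr m x * v x‖ₑ ^ 2 = ∫⁻ x in unitBox d, ‖v x‖ₑ ^ 2 := by
  set a : d → ℝ := fun _ => -1 / 2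
  set e := UnitAddTorus.measurableEquivPiIoc a
  have he : ∀ x ∈ unitBox d, ((e (fun i => (x i : UnitAddCircle)) : {x : d → ℝ // _}) : d → ℝ) = x := by
    intro x hx
    exact congrArg Subtype.val (e.apply_symm_apply ⟨x, hx⟩)
  set f : UnitAddTorus d → ℂ := fun t => v (e t).1 with hf
  have hfL : MemLp f 2 := by
    have h1 : MemLp (fun y : {x : d → ℝ // ∀ i, x i ∈ Set.Ioc (a i) (a i + 1)} => v y.1) 2
        (Measure.comap Subtype.val volume) := by
      refine ((MeasurableEmbedding.subtype_coe (measurableSet_unitBox (d := d))).memLp_map_measure_iff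
        (g := v)).1 ?_
      have h2 := map_comap_subtype_coe (measurableSet_unitBox (d := d)) volume
      exact h2 ▸ hv
    exact h1.comp_measurePreserving (UnitAddTorus.measurePreserving_equivPiIoc a)
  have hsum := UnitAddTorus.hasSum_sq_mFourierCoeff (hfL.toLp f)
  -- Fourier coefficients integrate against the conjugate character, hence the index `-m`; the final
  -- sum is reindexed by negation.
  have hc : ∀ m : d → ℤ, UnitAddTorus.mFourierCoeff (hfL.toLp f) (-m)
      = ∫ x in unitBox d, chr m x * v x := by
    intro m
    have h1 : UnitAddTorus.mFourierCoeff (hfL.toLp f) (-m) = UnitAddTorus.mFourierCoeff f (-m) := by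
      refine integral_congr_ae ?_
      filter_upwards [hfL.coeFn_toLp] with t ht
      rw [ht]
    rw [h1, UnitAddTorus.mFourierCoeff_eq_integral f (-m) a]
    refine setIntegral_congr_fun (measurableSet_unitBox (d := d)) fun x hx => ?_
    simp only [neg_neg, mFourier_coe, hf, he x hx, smul_eq_mul]
  have h2 : ∫⁻ t, ‖(hfL.toLp f) t‖ₑ ^ 2 = ∫⁻ x in unitBox d, ‖v x‖ₑ ^ 2 := by
    have : ∫⁻ t, ‖(hfL.toLp f) t‖ₑ ^ 2 = ∫⁻ t, ‖f t‖ₑ ^ 2 := by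
      refine lintegral_congr_ae ?_
      filter_upwards [hfL.coeFn_toLp] with t ht
      rw [ht]
    rw [this, UnitAddTorus.lintegral_preimage _ a]
    refine setLIntegral_congr_fun (measurableSet_unitBox (d := d)) fun x hx => ?_
    simp only [hf, he x hx]
  have h3 : ∫⁻ t, ‖(hfL.toLp f) t‖ₑ ^ 2 = ENNReal.ofReal (∫ t, ‖(hfL.toLp f) t‖ ^ 2) := by
    rw [ofReal_integral_eq_lintegral_ofReal]
    · refine lintegral_congr fun t => ?_
      rw [ENNReal.ofReal_pow (norm_nonneg _), ofReal_norm]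
    · exact (Lp.memLp (hfL.toLp f)).integrable_norm_pow (by norm_num)
    · exact Filter.Eventually.of_forall fun t => by positivity
  rw [← h2, h3, ← hsum.tsum_eq, ENNReal.ofReal_tsum_of_nonneg (fun _ => by positivity) hsum.summable,
    ← (Equiv.neg (d → ℤ)).tsum_eq]
  refine tsum_congr fun m => ?_
  simp only [Equiv.neg_apply]
  rw [ENNReal.ofReal_pow (norm_nonneg _), ofReal_norm, ← hc]
  simp

end Periodization

/-! ### Upper and lower estimates for one lattice of exponentials against a weight. -/

section Core

open scoped ENNReal NNReal

variable {d : Type*}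

/-- Splitting `|q||W|` with `|q|` as the weight leaves a single power of `|q|` next to `|W|²`; this
is why the later sums over scales involve `∑ |p|` rather than `∑ |p|²`. -/
theorem enorm_periodize_sq_le (q W : (d → ℝ) → ℂ) (x : d → ℝ) :
    ‖periodize (fun x => (starRingEnd ℂ) (q x) * W x) x‖ₑ ^ 2 ≤
      (∑' l : d → ℤ, ‖q (x + latt l)‖ₑ) *
        ∑' l : d → ℤ, ‖q (x + latt l)‖ₑ * ‖W (x + latt l)‖ₑ ^ 2 := by
  refine le_trans ?_ (sq_tsum_mul_le _ _)
  gcongr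
  refine enorm_tsum_le_tsum_enorm.trans (ENNReal.tsum_le_tsum fun l => ?_)
  rw [enorm_mul, RCLike.enorm_conj]

theorem enorm_le_of_tsum_le {q : (d → ℝ) → ℂ} {C : ℝ≥0}
    (hC : ∀ x ∈ unitBox d, ∑' l : d → ℤ, ‖q (x + latt l)‖ₑ ≤ C) (x : d → ℝ) : ‖q x‖ₑ ≤ C := by
  obtain ⟨l, hl, -⟩ := existsUnique_sub_mem_unitBox x
  refine le_trans ?_ (hC _ hl)
  refine le_trans ?_ (ENNReal.le_tsum l)
  simp

/-- The term `l = 0` is the periodization minus the aliases, so `(u + v)² ≤ 2u² + 2v²` applies, and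
the weighted Cauchy–Schwarz inequality puts the factor `ε` on the aliases. -/
theorem enorm_sq_le_periodize_add [DecidableEq (d → ℤ)] {q W : (d → ℝ) → ℂ} {x : d → ℝ}
    (hs : Summable fun l : d → ℤ => (starRingEnd ℂ) (q (x + latt l)) * W (x + latt l)) {ε : ℝ≥0}
    (hε : ∑' l : d → ℤ, (if l = 0 then 0 else ‖q (x + latt l)‖ₑ) ≤ ε) :
    ‖q x‖ₑ ^ 2 * ‖W x‖ₑ ^ 2 ≤
      2 * ‖periodize (fun x => (starRingEnd ℂ) (q x) * W x) x‖ₑ ^ 2 +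
      2 * (ε * ∑' l : d → ℤ, ‖q (x + latt l)‖ₑ * ‖W (x + latt l)‖ₑ ^ 2) := by
  set U : (d → ℝ) → ℂ := fun x => (starRingEnd ℂ) (q x) * W x
  have h0 : periodize U x = U x + ∑' l : d → ℤ, (if l = 0 then 0 else U (x + latt l)) := by
    have h := hs.tsum_eq_add_tsum_ite 0
    have hl : x + latt (0 : d → ℤ) = x := by ext i; simp [latt]
    rw [hl] at h
    exact h
  set T := ∑' l : d → ℤ, (if l = 0 then 0 else U (x + latt l))
  have h1 : ‖U x‖ₑ ≤ ‖periodize U x‖ₑ + ‖T‖ₑ := by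
    have : U x = periodize U x - T := by rw [h0]; ring
    rw [this]
    exact enorm_sub_le
  have h2 : ‖T‖ₑ ^ 2 ≤ ε * ∑' l : d → ℤ, ‖q (x + latt l)‖ₑ * ‖W (x + latt l)‖ₑ ^ 2 := by
    have h3 : ‖T‖ₑ ≤ ∑' l : d → ℤ, (if l = 0 then 0 else ‖q (x + latt l)‖ₑ) * ‖W (x + latt l)‖ₑ := by
      refine enorm_tsum_le_tsum_enorm.trans (ENNReal.tsum_le_tsum fun l => ?_)
      split_ifs
      · simp
      · rw [enorm_mul, RCLike.enorm_conj]
    calc ‖T‖ₑ ^ 2 ≤ _ := by gcongr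
      _ ≤ _ := sq_tsum_mul_le _ _
      _ ≤ _ := by
        gcongr
        split_ifs
        · exact zero_le
        · exact le_rfl
  have h4 : ‖U x‖ₑ = ‖q x‖ₑ * ‖W x‖ₑ := by rw [enorm_mul, RCLike.enorm_conj]
  calc ‖q x‖ₑ ^ 2 * ‖W x‖ₑ ^ 2 = ‖U x‖ₑ ^ 2 := by rw [h4, mul_pow]
    _ ≤ (‖periodize U x‖ₑ + ‖T‖ₑ) ^ 2 := by gcongr
    _ = 2 * ‖periodize U x‖ₑ * ‖T‖ₑ + (‖periodize U x‖ₑ ^ 2 + ‖T‖ₑ ^ 2) := by ring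
    _ ≤ (‖periodize U x‖ₑ ^ 2 + ‖T‖ₑ ^ 2) + (‖periodize U x‖ₑ ^ 2 + ‖T‖ₑ ^ 2) := by
      gcongr; exact two_mul_le_sq_add_sq _ _
    _ = 2 * ‖periodize U x‖ₑ ^ 2 + 2 * ‖T‖ₑ ^ 2 := by ring
    _ ≤ _ := by gcongr

variable [Fintype d]

/-- Unfolding: the characters are periodic, so integrating over the whole space is the same as
integrating the periodization over the cube, where Parseval applies. -/
theorem tsum_sq_integral_eq_periodize {U : (d → ℝ) → ℂ} (hU : Integrable U)
    (hv : MemLp (periodize U) 2 (volume.restrict (unitBox d))) :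
    ∑' m : d → ℤ, ‖∫ x, chr m x * U x‖ₑ ^ 2 = ∫⁻ x in unitBox d, ‖periodize U x‖ₑ ^ 2 := by
  rw [← tsum_sq_integral_unitBox hv]
  refine tsum_congr fun m => ?_
  have hc : Continuous (chr m) := by
    unfold chr
    exact continuous_subtype_val.comp (Real.continuous_fourierChar.comp (by fun_prop))
  have hi : Integrable (fun x => chr m x * U x) :=
    hU.congr' (hc.aestronglyMeasurable.mul hU.1)
      (Filter.Eventually.of_forall fun x => by rw [norm_mul, norm_chr, one_mul])
  rw [← integral_periodize hi]
  simp only [periodize, chr_add_latt, tsum_mul_left]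

theorem lintegral_tsum_weight {q W : (d → ℝ) → ℂ} (hq : AEStronglyMeasurable q)
    (hW : AEStronglyMeasurable W) :
    ∫⁻ x in unitBox d, ∑' l : d → ℤ, ‖q (x + latt l)‖ₑ * ‖W (x + latt l)‖ₑ ^ 2
      = ∫⁻ x, ‖q x‖ₑ * ‖W x‖ₑ ^ 2 := by
  rw [lintegral_tsum, ← lintegral_eq_tsum_unitBox (fun x => ‖q x‖ₑ * ‖W x‖ₑ ^ 2)]
  intro l
  exact (hq.comp_quasiMeasurePreserving (quasiMeasurePreserving_add_latt l)).enorm.mul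
    ((hW.comp_quasiMeasurePreserving (quasiMeasurePreserving_add_latt l)).enorm.pow_const 2)

theorem integrable_conj_mul {q W : (d → ℝ) → ℂ} (hq : MemLp q 2) (hW : MemLp W 2) :
    Integrable fun x => (starRingEnd ℂ) (q x) * W x :=
  MemLp.integrable_mul (p := 2) (q := 2) hq.star hW

theorem lintegral_periodize_sq_le {q W : (d → ℝ) → ℂ} (hq : MemLp q 2) (hW : MemLp W 2) {C : ℝ≥0}
    (hC : ∀ x ∈ unitBox d, ∑' l : d → ℤ, ‖q (x + latt l)‖ₑ ≤ C) :
    ∫⁻ x in unitBox d, ‖periodize (fun x => (starRingEnd ℂ) (q x) * W x) x‖ₑ ^ 2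
      ≤ C * ∫⁻ x, ‖q x‖ₑ * ‖W x‖ₑ ^ 2 := by
  rw [← lintegral_tsum_weight hq.1 hW.1, ← lintegral_const_mul' _ _ ENNReal.coe_ne_top]
  refine setLIntegral_mono' measurableSet_unitBox fun x hx => ?_
  exact (enorm_periodize_sq_le q W x).trans (by gcongr; exact hC x hx)

theorem memLp_periodize {q W : (d → ℝ) → ℂ} (hq : MemLp q 2) (hW : MemLp W 2) {C : ℝ≥0}
    (hC : ∀ x ∈ unitBox d, ∑' l : d → ℤ, ‖q (x + latt l)‖ₑ ≤ C) :
    MemLp (periodize fun x => (starRingEnd ℂ) (q x) * W x) 2 (volume.restrict (unitBox d)) := by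
  refine ⟨aestronglyMeasurable_periodize (integrable_conj_mul hq hW), ?_⟩
  rw [eLpNorm_lt_top_iff_lintegral_rpow_enorm_lt_top (by norm_num) (by norm_num)]
  simp only [ENNReal.toReal_ofNat, ENNReal.rpow_ofNat]
  refine (lintegral_periodize_sq_le hq hW hC).trans_lt (ENNReal.mul_lt_top ENNReal.coe_lt_top ?_)
  have h2 : ∫⁻ x, ‖W x‖ₑ ^ 2 < ∞ := by
    have := (eLpNorm_lt_top_iff_lintegral_rpow_enorm_lt_top (by norm_num) (by norm_num)).1 hW.2
    simpa only [ENNReal.toReal_ofNat, ENNReal.rpow_ofNat] using this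
  calc ∫⁻ x, ‖q x‖ₑ * ‖W x‖ₑ ^ 2 ≤ ∫⁻ x, C * ‖W x‖ₑ ^ 2 :=
        lintegral_mono fun x => by gcongr; exact enorm_le_of_tsum_le hC x
    _ = C * ∫⁻ x, ‖W x‖ₑ ^ 2 := lintegral_const_mul' _ _ ENNReal.coe_ne_top
    _ < ∞ := ENNReal.mul_lt_top ENNReal.coe_lt_top h2

/-- Bessel inequality for the exponentials against a weight. -/
theorem tsum_sq_integral_le {q W : (d → ℝ) → ℂ} (hq : MemLp q 2) (hW : MemLp W 2) {C : ℝ≥0}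
    (hC : ∀ x ∈ unitBox d, ∑' l : d → ℤ, ‖q (x + latt l)‖ₑ ≤ C) :
    ∑' m : d → ℤ, ‖∫ x, chr m x * ((starRingEnd ℂ) (q x) * W x)‖ₑ ^ 2
      ≤ C * ∫⁻ x, ‖q x‖ₑ * ‖W x‖ₑ ^ 2 := by
  rw [tsum_sq_integral_eq_periodize (integrable_conj_mul hq hW) (memLp_periodize hq hW hC)]
  exact lintegral_periodize_sq_le hq hW hC

/-- Lower bound for the exponentials against a weight that is small outside of the unit cube. -/
theorem lintegral_unitBox_le_tsum_sq [DecidableEq (d → ℤ)] {q W : (d → ℝ) → ℂ} (hq : MemLp q 2)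
    (hW : MemLp W 2) {C ε : ℝ≥0}
    (hC : ∀ x ∈ unitBox d, ∑' l : d → ℤ, ‖q (x + latt l)‖ₑ ≤ C)
    (hε : ∀ x ∈ unitBox d, ∑' l : d → ℤ, (if l = 0 then 0 else ‖q (x + latt l)‖ₑ) ≤ ε) :
    ∫⁻ x in unitBox d, ‖q x‖ₑ ^ 2 * ‖W x‖ₑ ^ 2 ≤
      2 * ∑' m : d → ℤ, ‖∫ x, chr m x * ((starRingEnd ℂ) (q x) * W x)‖ₑ ^ 2 +
        2 * (ε * ∫⁻ x, ‖q x‖ₑ * ‖W x‖ₑ ^ 2) := by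
  have hU := integrable_conj_mul hq hW
  rw [tsum_sq_integral_eq_periodize hU (memLp_periodize hq hW hC),
    ← lintegral_tsum_weight hq.1 hW.1, ← lintegral_const_mul' _ _ ENNReal.coe_ne_top,
    ← lintegral_const_mul' _ _ (by norm_num), ← lintegral_const_mul' _ _ (by norm_num),
    ← lintegral_add_left']
  · refine lintegral_mono_ae ?_
    filter_upwards [ae_summable_periodize hU, ae_restrict_mem measurableSet_unitBox] with x hs hx
    exact enorm_sq_le_periodize_add hs (hε x hx)
  · exact ((aestronglyMeasurable_periodize hU).enorm.pow_const 2).const_mul _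

end Core

/-! ### Families of affine images: summing the estimates over all matrices. -/

section Families

open scoped ENNReal NNReal

variable {X : Type*} [MeasureSpace X] {d : Type*} [Fintype d]

theorem lintegral_comp_equiv {Y : Type*} [MeasureSpace Y] {S : X ≃ᵐ Y} {D : ℝ}
    (hS : Measure.map S (volume : Measure X) = ENNReal.ofReal D • volume) (u : Y → ℝ≥0∞) :
    ∫⁻ ξ, u (S ξ) = ENNReal.ofReal D * ∫⁻ η, u η := by
  rw [← lintegral_map_equiv u S, hS, lintegral_smul_measure, smul_eq_mul]

theorem integral_comp_equiv {Y : Type*} [MeasureSpace Y] {S : X ≃ᵐ Y} {D : ℝ} (hD : 0 < D)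
    (hS : Measure.map S (volume : Measure X) = ENNReal.ofReal D • volume) (u : Y → ℂ) :
    ∫ ξ, u (S ξ) = D * ∫ η, u η := by
  rw [← integral_map_equiv S u, hS, integral_smul_measure, ENNReal.toReal_ofReal hD.le,
    Complex.real_smul]

theorem memLp_comp_equiv_iff {Y : Type*} [MeasureSpace Y] {S : X ≃ᵐ Y} {D : ℝ} (hD : 0 < D)
    (hS : Measure.map S (volume : Measure X) = ENNReal.ofReal D • volume) {u : Y → ℂ} :
    MemLp (fun ξ => u (S ξ)) 2 ↔ MemLp u 2 := by
  have h1 : MemLp u 2 (Measure.map S (volume : Measure X)) ↔ MemLp (fun ξ => u (S ξ)) 2 :=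
    S.measurableEmbedding.memLp_map_measure_iff
  rw [← h1, hS]
  refine ⟨fun h => ?_, fun h => h.smul_measure ENNReal.ofReal_ne_top⟩
  have h0 : ENNReal.ofReal D ≠ 0 := by simpa using hD
  have h2 := h.smul_measure (c := (ENNReal.ofReal D)⁻¹) (ENNReal.inv_ne_top.2 h0)
  rwa [smul_smul, ENNReal.inv_mul_cancel h0 ENNReal.ofReal_ne_top, one_smul] at h2

/-- Change of variables `x = S ξ`: each squared coefficient gains `D²`, each integral only `D`, so
one factor `D` survives on the integral side. -/
theorem tsum_sq_integral_comp [DecidableEq (d → ℤ)] {q : (d → ℝ) → ℂ} {F : X → ℂ}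
    (hq : MemLp q 2) (hF : MemLp F 2)
    {C ε : ℝ≥0} (hC : ∀ x ∈ unitBox d, ∑' l : d → ℤ, ‖q (x + latt l)‖ₑ ≤ C)
    (hε : ∀ x ∈ unitBox d, ∑' l : d → ℤ, (if l = 0 then 0 else ‖q (x + latt l)‖ₑ) ≤ ε)
    {S : X ≃ᵐ (d → ℝ)} {D : ℝ} (hD : 0 < D)
    (hS : Measure.map S (volume : Measure X) = ENNReal.ofReal D • volume) :
    ∑' m : d → ℤ, ‖∫ ξ, chr m (S ξ) * ((starRingEnd ℂ) (q (S ξ)) * F ξ)‖ₑ ^ 2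
        ≤ ENNReal.ofReal D * (C * ∫⁻ ξ, ‖q (S ξ)‖ₑ * ‖F ξ‖ₑ ^ 2) ∧
    ENNReal.ofReal D * ∫⁻ ξ in S ⁻¹' unitBox d, ‖q (S ξ)‖ₑ ^ 2 * ‖F ξ‖ₑ ^ 2 ≤
      2 * ∑' m : d → ℤ, ‖∫ ξ, chr m (S ξ) * ((starRingEnd ℂ) (q (S ξ)) * F ξ)‖ₑ ^ 2 +
        2 * (ε * (ENNReal.ofReal D * ∫⁻ ξ, ‖q (S ξ)‖ₑ * ‖F ξ‖ₑ ^ 2)) := by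
  set W : (d → ℝ) → ℂ := fun x => F (S.symm x) with hWdef
  have hWF : ∀ ξ, F ξ = W (S ξ) := fun ξ => by simp [hWdef]
  have hW : MemLp W 2 := (memLp_comp_equiv_iff hD hS).1 (by simpa [hWdef] using hF)
  set δ := ENNReal.ofReal D
  have e1 : ∑' m : d → ℤ, ‖∫ ξ, chr m (S ξ) * ((starRingEnd ℂ) (q (S ξ)) * F ξ)‖ₑ ^ 2
      = δ ^ 2 * ∑' m : d → ℤ, ‖∫ x, chr m x * ((starRingEnd ℂ) (q x) * W x)‖ₑ ^ 2 := by
    rw [← ENNReal.tsum_mul_left]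
    refine tsum_congr fun m => ?_
    simp only [hWF]
    rw [integral_comp_equiv hD hS (fun x => chr m x * ((starRingEnd ℂ) (q x) * W x)), enorm_mul,
      mul_pow]
    congr 2
    rw [← ofReal_norm, Complex.norm_real, Real.norm_of_nonneg hD.le]
  have e2 : ∫⁻ ξ, ‖q (S ξ)‖ₑ * ‖F ξ‖ₑ ^ 2 = δ * ∫⁻ x, ‖q x‖ₑ * ‖W x‖ₑ ^ 2 := by
    simp only [hWF]
    exact lintegral_comp_equiv hS (fun x => ‖q x‖ₑ * ‖W x‖ₑ ^ 2)
  have e3 : ∫⁻ ξ in S ⁻¹' unitBox d, ‖q (S ξ)‖ₑ ^ 2 * ‖F ξ‖ₑ ^ 2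
      = δ * ∫⁻ x in unitBox d, ‖q x‖ₑ ^ 2 * ‖W x‖ₑ ^ 2 := by
    simp only [hWF]
    rw [← lintegral_indicator measurableSet_unitBox,
      ← lintegral_indicator (S.measurable measurableSet_unitBox), ← lintegral_comp_equiv hS]
    rfl
  rw [e1, e2, e3]
  constructor
  · calc _ ≤ δ ^ 2 * (C * ∫⁻ x, ‖q x‖ₑ * ‖W x‖ₑ ^ 2) := by
          gcongr; exact tsum_sq_integral_le hq hW hC
      _ = _ := by ring
  · calc _ = δ ^ 2 * ∫⁻ x in unitBox d, ‖q x‖ₑ ^ 2 * ‖W x‖ₑ ^ 2 := by ring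
      _ ≤ δ ^ 2 * _ := mul_le_mul_right (lintegral_unitBox_le_tsum_sq hq hW hC hε) _
      _ = _ := by ring

/-- Coordinatewise dilation. -/
noncomputable def dilEquiv (c : d → ℝ) (hc : ∀ i, 0 < c i) : (d → ℝ) ≃ᵐ (d → ℝ) :=
  MeasurableEquiv.piCongrRight fun i => (Homeomorph.mulLeft₀ (c i) (hc i).ne').toMeasurableEquiv

theorem map_dilEquiv [DecidableEq d] (c : d → ℝ) (hc : ∀ i, 0 < c i) :
    Measure.map (dilEquiv c hc) volume = ENNReal.ofReal (∏ i, c i)⁻¹ • volume := by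
  have hp : 0 < ∏ i, c i := Finset.prod_pos fun i _ => hc i
  have hdet : (Matrix.diagonal c).det ≠ 0 := by rw [Matrix.det_diagonal]; exact hp.ne'
  have h := Real.smul_map_diagonal_volume_pi hdet
  have hfun : ⇑(Matrix.toLin' (Matrix.diagonal c)) = dilEquiv c hc := by
    ext x i
    rw [Matrix.toLin'_apply, Matrix.mulVec_diagonal]
    rfl
  rw [hfun, Matrix.det_diagonal, abs_of_pos hp] at h
  have h0 : ENNReal.ofReal (∏ i, c i) ≠ 0 := by simpa using hp
  nth_rewrite 2 [← h]
  rw [smul_smul, ENNReal.ofReal_inv_of_pos hp, ENNReal.inv_mul_cancel h0 ENNReal.ofReal_ne_top, one_smul]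

/-- The lattice point with coordinates `c i * m i`. -/
noncomputable def scaledPoint (c : d → ℝ) (m : d → ℤ) : EuclideanSpace ℝ d :=
  WithLp.toLp 2 fun i => c i * m i

/-- The point with coordinates `x i / c i`. -/
noncomputable def unscale (c : d → ℝ) (x : d → ℝ) : EuclideanSpace ℝ d :=
  WithLp.toLp 2 fun i => (c i)⁻¹ * x i

/-- The map `ξ ↦ (c i * (R ξ) i)`. -/
noncomputable def sampleEquiv (c : d → ℝ) (hc : ∀ i, 0 < c i)
    (R : EuclideanSpace ℝ d ≃L[ℝ] EuclideanSpace ℝ d) : EuclideanSpace ℝ d ≃ᵐ (d → ℝ) :=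
  (R.toHomeomorph.toMeasurableEquiv.trans (MeasurableEquiv.toLp 2 (d → ℝ)).symm).trans (dilEquiv c hc)

theorem sampleEquiv_apply (c : d → ℝ) (hc : ∀ i, 0 < c i)
    (R : EuclideanSpace ℝ d ≃L[ℝ] EuclideanSpace ℝ d) (ξ : EuclideanSpace ℝ d) :
    sampleEquiv c hc R ξ = fun i => c i * R ξ i := rfl

theorem unscale_sampleEquiv (c : d → ℝ) (hc : ∀ i, 0 < c i)
    (R : EuclideanSpace ℝ d ≃L[ℝ] EuclideanSpace ℝ d) (ξ : EuclideanSpace ℝ d) :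
    unscale c (sampleEquiv c hc R ξ) = R ξ := by
  ext i
  simp [unscale, sampleEquiv_apply, (hc i).ne']

theorem map_sampleEquiv [DecidableEq d] (c : d → ℝ) (hc : ∀ i, 0 < c i)
    {R : EuclideanSpace ℝ d ≃L[ℝ] EuclideanSpace ℝ d} {D : ℝ} (hD : 0 < D)
    (hR : Measure.map R volume = ENNReal.ofReal D • volume) :
    Measure.map (sampleEquiv c hc R) volume = ENNReal.ofReal (D * (∏ i, c i)⁻¹) • volume := by
  have h1 : Measure.map (sampleEquiv c hc R) volume = Measure.map (dilEquiv c hc)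
      (Measure.map (MeasurableEquiv.toLp 2 (d → ℝ)).symm (Measure.map R volume)) := by
    rw [Measure.map_map (MeasurableEquiv.measurable _) R.continuous.measurable,
      Measure.map_map (MeasurableEquiv.measurable _)
        ((MeasurableEquiv.measurable _).comp R.continuous.measurable)]
    rfl
  rw [h1, hR, Measure.map_smul, (EuclideanSpace.volume_preserving_symm_measurableEquiv_toLp d).map_eq,
    Measure.map_smul, map_dilEquiv, smul_smul, ← ENNReal.ofReal_mul hD.le]

theorem conj_fourierChar (t : ℝ) :
    (starRingEnd ℂ) (Real.fourierChar (-t) : ℂ) = Real.fourierChar t := by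
  rw [AddChar.map_neg_eq_inv, Circle.coe_inv_eq_conj, Complex.conj_conj]

theorem inner_scaledPoint (c : d → ℝ) (hc : ∀ i, 0 < c i)
    (R : EuclideanSpace ℝ d ≃L[ℝ] EuclideanSpace ℝ d) (m : d → ℤ) (ξ : EuclideanSpace ℝ d) :
    (Real.fourierChar (inner ℝ (R ξ) (scaledPoint c m)) : ℂ) = chr m (sampleEquiv c hc R ξ) := by
  rw [chr]
  congr 2
  simp only [PiLp.inner_apply, scaledPoint, sampleEquiv_apply]
  refine Finset.sum_congr rfl fun i _ => ?_
  simp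
  ring

theorem enorm_sq_eq_lintegral {V : Type*} [MeasureSpace V] (f : Lp (α := V) ℂ 2 volume) :
    ‖f‖ₑ ^ 2 = ∫⁻ x, ‖f x‖ₑ ^ 2 := by
  rw [Lp.enorm_def, eLpNorm_eq_lintegral_rpow_enorm_toReal (by norm_num) (by norm_num)]
  simp only [ENNReal.toReal_ofNat, ENNReal.rpow_ofNat]
  rw [← ENNReal.rpow_natCast, ← ENNReal.rpow_mul]
  norm_num

section FourierFun

variable {V : Type*} [NormedAddCommGroup V] [InnerProductSpace ℝ V] [FiniteDimensional ℝ V]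
  [MeasurableSpace V] [BorelSpace V]

/-- The `L²` Fourier transform of `f`, as a function. -/
noncomputable def fourierFun (f : Lp (α := V) ℂ 2 volume) : V → ℂ := (𝓕 f : Lp (α := V) ℂ 2 volume)

theorem memLp_fourierFun (f : Lp (α := V) ℂ 2 volume) : MemLp (fourierFun f) 2 := Lp.memLp _

theorem lintegral_enorm_fourierFun_sq (f : Lp (α := V) ℂ 2 volume) :
    ∫⁻ ξ, ‖fourierFun f ξ‖ₑ ^ 2 = ‖f‖ₑ ^ 2 := by
  rw [fourierFun, ← enorm_sq_eq_lintegral, ← ofReal_norm, Lp.norm_fourier_eq, ofReal_norm]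

/-- `inner_affine_eq` in terms of `fourierFun`. -/
theorem inner_affine_eq_fourierFun {p ψ : V → ℂ} (h1 : Integrable p) (h2 : MemLp p 2)
    (hψ : ψ =ᵐ[volume] 𝓕⁻ p) {B R : V ≃L[ℝ] V} (hBR : ∀ ξ x, inner ℝ (R ξ) (B x) = inner ℝ ξ x)
    {D : ℝ} (hD : 0 < D)
    (hR : Measure.map R (volume : Measure V) = ENNReal.ofReal D • volume) (b : V) (s : ℂ) :
    ∃ hg : MemLp (fun x => s * ψ (B x - b)) 2 (volume : Measure V),
      ∀ f : Lp (α := V) ℂ 2 volume, inner ℂ (hg.toLp _) f =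
        ∫ ξ, (starRingEnd ℂ) (s * (D : ℂ)⁻¹ * (Real.fourierChar (-inner ℝ (R ξ) b) * p (R ξ))) *
          fourierFun f ξ :=
  inner_affine_eq h1 h2 hψ hBR hD hR b s

/-- The sum of the squared frame coefficients of `f`. -/
noncomputable def frameSum {ι : Type*} {g : ι → V → ℂ} (hg : ∀ i, MemLp (g i) 2 (volume : Measure V))
    (f : Lp (α := V) ℂ 2 volume) : ℝ≥0∞ :=
  ∑' i, ‖inner ℂ ((hg i).toLp (g i)) f‖ₑ ^ 2

end FourierFun

theorem lintegral_weight_le {τ X : Type*} [Countable τ] [MeasureSpace X] {w : τ → X → ℝ≥0∞}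
    (hw : ∀ t, AEMeasurable (w t)) {F : X → ℂ} (hF : AEStronglyMeasurable F) {C : ℝ≥0∞}
    (hC : ∀ ξ, ∑' t, w t ξ ≤ C) :
    ∑' t, ∫⁻ ξ, w t ξ * ‖F ξ‖ₑ ^ 2 ≤ C * ∫⁻ ξ, ‖F ξ‖ₑ ^ 2 := by
  rw [← lintegral_tsum (f := fun t ξ => w t ξ * ‖F ξ‖ₑ ^ 2) fun t => (hw t).mul (hF.enorm.pow_const 2),
    ← lintegral_const_mul'' _ (hF.enorm.pow_const 2)]
  refine lintegral_mono fun ξ => ?_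
  simp only
  rw [ENNReal.tsum_mul_right]
  gcongr
  exact hC ξ

/-- The coefficients of `F` against the Fourier transforms of the functions `s ψ(B · - b)`. -/
noncomputable def affineCoeff (p : EuclideanSpace ℝ d → ℂ) (c : d → ℝ)
    (R : EuclideanSpace ℝ d ≃L[ℝ] EuclideanSpace ℝ d) (D : ℝ) (s : ℂ) (F : EuclideanSpace ℝ d → ℂ)
    (m : d → ℤ) : ℂ :=
  ∫ ξ, (starRingEnd ℂ) (s * (D : ℂ)⁻¹ *
    (Real.fourierChar (-inner ℝ (R ξ) (scaledPoint c m)) * p (R ξ))) * F ξ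

/-- The normalisation `‖s‖² = D` makes every matrix contribute with the same constant `(∏ c i)⁻¹`,
so the single-lattice estimates can be summed over `t`, with `C₂` bounding the total weight. -/
theorem affineCoeff_estimates {τ : Type*} [Countable τ] [DecidableEq d] [DecidableEq (d → ℤ)]
    {p : EuclideanSpace ℝ d → ℂ} (hpm : Measurable p) (h2 : MemLp p 2)
    (c : d → ℝ) (hc : ∀ i, 0 < c i)
    (R : τ → EuclideanSpace ℝ d ≃L[ℝ] EuclideanSpace ℝ d) {D : τ → ℝ} (hD : ∀ t, 0 < D t)
    (hR : ∀ t, Measure.map (R t) volume = ENNReal.ofReal (D t) • volume)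
    {s : τ → ℂ} (hs : ∀ t, ‖s t‖ ^ 2 = D t) {C ε C₂ : ℝ≥0}
    (hC : ∀ x ∈ unitBox d, ∑' l : d → ℤ, ‖p (unscale c (x + latt l))‖ₑ ≤ C)
    (hε : ∀ x ∈ unitBox d, ∑' l : d → ℤ, (if l = 0 then 0 else ‖p (unscale c (x + latt l))‖ₑ) ≤ ε)
    (hC₂ : ∀ ξ, ∑' t, ‖p (R t ξ)‖ₑ ≤ C₂) {F : EuclideanSpace ℝ d → ℂ} (hFm : MemLp F 2) :
    ∑' i : τ × (d → ℤ), ‖affineCoeff p c (R i.1) (D i.1) (s i.1) F i.2‖ₑ ^ 2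
      ≤ ENNReal.ofReal (∏ i, c i)⁻¹ * (C * (C₂ * ∫⁻ ξ, ‖F ξ‖ₑ ^ 2)) ∧
    ∀ (E : Set (EuclideanSpace ℝ d)) (_ : MeasurableSet E) (a : ℝ≥0),
      (∀ ξ ∈ E, ∃ t, sampleEquiv c hc (R t) ξ ∈ unitBox d ∧ a ≤ ‖p (R t ξ)‖ₑ) →
      ENNReal.ofReal (∏ i, c i)⁻¹ * (a ^ 2 * ∫⁻ ξ in E, ‖F ξ‖ₑ ^ 2)
        ≤ 2 * ∑' i : τ × (d → ℤ), ‖affineCoeff p c (R i.1) (D i.1) (s i.1) F i.2‖ₑ ^ 2 +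
          2 * (ε * (ENNReal.ofReal (∏ i, c i)⁻¹ * (C₂ * ∫⁻ ξ, ‖F ξ‖ₑ ^ 2))) := by
  have hprod : 0 < ∏ i, c i := Finset.prod_pos fun i _ => hc i
  set κ : ℝ≥0∞ := ENNReal.ofReal (∏ i, c i)⁻¹ with hκ
  set q : (d → ℝ) → ℂ := fun x => p (unscale c x) with hq
  have hqS : ∀ t ξ, q (sampleEquiv c hc (R t) ξ) = p (R t ξ) := fun t ξ => by
    rw [hq]; simp only [unscale_sampleEquiv]
  have hq2 : MemLp q 2 := by
    -- Taking `R` to be the identity turns membership of `p` in `L²` into that of its rescaling `q`.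
    have hid := map_sampleEquiv c hc (R := ContinuousLinearEquiv.refl ℝ _) (D := 1) one_pos
      (by simp)
    refine (memLp_comp_equiv_iff (by positivity) hid).1 ?_
    simp only [hq, unscale_sampleEquiv]
    exact h2
  set T : τ → ℝ≥0∞ := fun t => ∑' m : d → ℤ, ‖∫ ξ, chr m (sampleEquiv c hc (R t) ξ) *
    ((starRingEnd ℂ) (q (sampleEquiv c hc (R t) ξ)) * F ξ)‖ₑ ^ 2 with hT
  have hcore := fun t => tsum_sq_integral_comp hq2 hFm hC hε
    (S := sampleEquiv c hc (R t)) (mul_pos (hD t) (inv_pos.2 hprod)) (map_sampleEquiv c hc (hD t) (hR t))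
  have hδ : ∀ t, ENNReal.ofReal (D t * (∏ i, c i)⁻¹) = ENNReal.ofReal (D t) * κ := fun t =>
    ENNReal.ofReal_mul (hD t).le
  have hδ0 : ∀ t, (ENNReal.ofReal (D t))⁻¹ * ENNReal.ofReal (D t) = 1 := fun t =>
    ENNReal.inv_mul_cancel (by simpa using hD t) ENNReal.ofReal_ne_top
  -- The prefactor has `|s / D|² = 1 / D`, which will cancel the surviving Jacobian.
  have hcoef : ∀ t, ∑' m : d → ℤ, ‖affineCoeff p c (R t) (D t) (s t) F m‖ₑ ^ 2
      = (ENNReal.ofReal (D t))⁻¹ * T t := by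
    intro t
    rw [hT, ← ENNReal.tsum_mul_left]
    refine tsum_congr fun m => ?_
    unfold affineCoeff
    have e : ∀ ξ, (starRingEnd ℂ) (s t * (D t : ℂ)⁻¹ *
        (Real.fourierChar (-inner ℝ (R t ξ) (scaledPoint c m)) * p (R t ξ))) * F ξ
        = (starRingEnd ℂ) (s t * (D t : ℂ)⁻¹) * (chr m (sampleEquiv c hc (R t) ξ) *
          ((starRingEnd ℂ) (q (sampleEquiv c hc (R t) ξ)) * F ξ)) := by
      intro ξ
      rw [map_mul, map_mul (starRingEnd ℂ) (Real.fourierChar _ : ℂ), conj_fourierChar,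
        inner_scaledPoint c hc, hqS]
      ring
    simp only [e]
    rw [integral_const_mul, enorm_mul, mul_pow, RCLike.enorm_conj]
    congr 1
    rw [← ofReal_norm, ← ENNReal.ofReal_pow (norm_nonneg _), norm_mul, mul_pow, hs, norm_inv,
      Complex.norm_real, Real.norm_of_nonneg (hD t).le, ← ENNReal.ofReal_inv_of_pos (hD t)]
    congr 1
    have := (hD t).ne'
    field_simp
  have hsum : ∑' i : τ × (d → ℤ), ‖affineCoeff p c (R i.1) (D i.1) (s i.1) F i.2‖ₑ ^ 2 = ∑' t, (ENNReal.ofReal (D t))⁻¹ * T t := by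
    rw [ENNReal.tsum_prod']
    exact tsum_congr hcoef
  have hwm : ∀ t, Measurable fun ξ => ‖p (R t ξ)‖ₑ := fun t =>
    (hpm.comp (R t).continuous.measurable).enorm
  have hw : ∑' t, ∫⁻ ξ, ‖p (R t ξ)‖ₑ * ‖F ξ‖ₑ ^ 2 ≤ C₂ * ∫⁻ ξ, ‖F ξ‖ₑ ^ 2 :=
    lintegral_weight_le (fun t => (hwm t).aemeasurable) hFm.1 hC₂
  rw [hsum]
  simp only [hqS, hδ] at hcore
  constructor
  · calc ∑' t, (ENNReal.ofReal (D t))⁻¹ * T t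
        ≤ ∑' t, κ * (C * ∫⁻ ξ, ‖p (R t ξ)‖ₑ * ‖F ξ‖ₑ ^ 2) := by
          refine ENNReal.tsum_le_tsum fun t => ?_
          calc (ENNReal.ofReal (D t))⁻¹ * T t ≤ (ENNReal.ofReal (D t))⁻¹ * (ENNReal.ofReal (D t) * κ *
                (C * ∫⁻ ξ, ‖p (R t ξ)‖ₑ * ‖F ξ‖ₑ ^ 2)) := by
                gcongr
                simpa only [hT, hqS] using (hcore t).1
            _ = ((ENNReal.ofReal (D t))⁻¹ * ENNReal.ofReal (D t)) *
                (κ * (C * ∫⁻ ξ, ‖p (R t ξ)‖ₑ * ‖F ξ‖ₑ ^ 2)) := by ring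
            _ = _ := by rw [hδ0, one_mul]
      _ = κ * (C * ∑' t, ∫⁻ ξ, ‖p (R t ξ)‖ₑ * ‖F ξ‖ₑ ^ 2) := by
          rw [ENNReal.tsum_mul_left, ENNReal.tsum_mul_left]
      _ ≤ _ := by gcongr
  · intro E hEm a hE
    set Q : τ → Set (EuclideanSpace ℝ d) := fun t => sampleEquiv c hc (R t) ⁻¹' unitBox d
    have hQ : ∀ t, MeasurableSet (Q t) := fun t => (MeasurableEquiv.measurable _) measurableSet_unitBox
    -- The sets `Q t` may overlap: for each `ξ` only one good `t` is kept from a sum of nonnegative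
    -- terms.
    have hlow : a ^ 2 * ∫⁻ ξ in E, ‖F ξ‖ₑ ^ 2
        ≤ ∑' t, ∫⁻ ξ in Q t, ‖p (R t ξ)‖ₑ ^ 2 * ‖F ξ‖ₑ ^ 2 := by
      have hind : ∀ t, ∫⁻ ξ in Q t, ‖p (R t ξ)‖ₑ ^ 2 * ‖F ξ‖ₑ ^ 2
          = ∫⁻ ξ, (Q t).indicator (fun ξ => ‖p (R t ξ)‖ₑ ^ 2 * ‖F ξ‖ₑ ^ 2) ξ := fun t =>
        (lintegral_indicator (hQ t) _).symm
      simp only [hind]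
      have hm : ∀ t, AEMeasurable
          (fun ξ => (Q t).indicator (fun ξ => ‖p (R t ξ)‖ₑ ^ 2 * ‖F ξ‖ₑ ^ 2) ξ) := fun t =>
        (((hwm t).aemeasurable.pow_const 2).mul (hFm.1.enorm.pow_const 2)).indicator (hQ t)
      rw [← lintegral_tsum hm, ← lintegral_const_mul' _ _ (by finiteness)]
      refine le_trans (setLIntegral_mono' hEm fun ξ hξ => ?_) (setLIntegral_le_lintegral E _)
      obtain ⟨t, ht, hat⟩ := hE ξ hξ
      refine le_trans ?_ (ENNReal.le_tsum t)
      rw [Set.indicator_of_mem (show ξ ∈ Q t from ht)]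
      gcongr
    have hstep : ∀ t, κ * ∫⁻ ξ in Q t, ‖p (R t ξ)‖ₑ ^ 2 * ‖F ξ‖ₑ ^ 2 ≤
        2 * ((ENNReal.ofReal (D t))⁻¹ * T t) +
          2 * (ε * (κ * ∫⁻ ξ, ‖p (R t ξ)‖ₑ * ‖F ξ‖ₑ ^ 2)) := by
      intro t
      calc κ * ∫⁻ ξ in Q t, ‖p (R t ξ)‖ₑ ^ 2 * ‖F ξ‖ₑ ^ 2
          = ((ENNReal.ofReal (D t))⁻¹ * ENNReal.ofReal (D t)) *
            (κ * ∫⁻ ξ in Q t, ‖p (R t ξ)‖ₑ ^ 2 * ‖F ξ‖ₑ ^ 2) := by rw [hδ0, one_mul]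
        _ = (ENNReal.ofReal (D t))⁻¹ * (ENNReal.ofReal (D t) * κ *
            ∫⁻ ξ in Q t, ‖p (R t ξ)‖ₑ ^ 2 * ‖F ξ‖ₑ ^ 2) := by ring
        _ ≤ (ENNReal.ofReal (D t))⁻¹ * (2 * T t + 2 * (ε * (ENNReal.ofReal (D t) * κ *
            ∫⁻ ξ, ‖p (R t ξ)‖ₑ * ‖F ξ‖ₑ ^ 2))) := by
          gcongr
          simpa only [hT, hqS] using (hcore t).2
        _ = 2 * ((ENNReal.ofReal (D t))⁻¹ * T t) + ((ENNReal.ofReal (D t))⁻¹ * ENNReal.ofReal (D t)) *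
            (2 * (ε * (κ * ∫⁻ ξ, ‖p (R t ξ)‖ₑ * ‖F ξ‖ₑ ^ 2))) := by ring
        _ = _ := by rw [hδ0, one_mul]
    calc κ * (a ^ 2 * ∫⁻ ξ in E, ‖F ξ‖ₑ ^ 2)
        ≤ κ * ∑' t, ∫⁻ ξ in Q t, ‖p (R t ξ)‖ₑ ^ 2 * ‖F ξ‖ₑ ^ 2 := by gcongr
      _ ≤ ∑' t, (2 * ((ENNReal.ofReal (D t))⁻¹ * T t) +
          2 * (ε * (κ * ∫⁻ ξ, ‖p (R t ξ)‖ₑ * ‖F ξ‖ₑ ^ 2))) := by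
        rw [← ENNReal.tsum_mul_left]
        exact ENNReal.tsum_le_tsum hstep
      _ = 2 * ∑' t, (ENNReal.ofReal (D t))⁻¹ * T t +
          2 * (ε * (κ * ∑' t, ∫⁻ ξ, ‖p (R t ξ)‖ₑ * ‖F ξ‖ₑ ^ 2)) := by
        simp only [ENNReal.tsum_add, ENNReal.tsum_mul_left]
      _ ≤ _ := by gcongr

/-- Frame estimates for families of affine images of a function whose Fourier transform decays. -/
theorem affine_family_estimates {τ : Type*} [Countable τ] [DecidableEq d] [DecidableEq (d → ℤ)]
    {p ψ : EuclideanSpace ℝ d → ℂ} (hpm : Measurable p) (h1 : Integrable p) (h2 : MemLp p 2)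
    (hψ : ψ =ᵐ[volume] 𝓕⁻ p) (c : d → ℝ) (hc : ∀ i, 0 < c i)
    (B R : τ → EuclideanSpace ℝ d ≃L[ℝ] EuclideanSpace ℝ d)
    (hBR : ∀ t ξ x, inner ℝ (R t ξ) (B t x) = inner ℝ ξ x) {D : τ → ℝ} (hD : ∀ t, 0 < D t)
    (hR : ∀ t, Measure.map (R t) volume = ENNReal.ofReal (D t) • volume)
    {s : τ → ℂ} (hs : ∀ t, ‖s t‖ ^ 2 = D t) {C ε C₂ : ℝ≥0}
    (hC : ∀ x ∈ unitBox d, ∑' l : d → ℤ, ‖p (unscale c (x + latt l))‖ₑ ≤ C)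
    (hε : ∀ x ∈ unitBox d, ∑' l : d → ℤ, (if l = 0 then 0 else ‖p (unscale c (x + latt l))‖ₑ) ≤ ε)
    (hC₂ : ∀ ξ, ∑' t, ‖p (R t ξ)‖ₑ ≤ C₂) :
    ∃ hg : ∀ i : τ × (d → ℤ), MemLp (fun x => s i.1 * ψ (B i.1 x - scaledPoint c i.2)) 2 volume,
      ∀ f : Lp (α := EuclideanSpace ℝ d) ℂ 2 volume,
        frameSum (V := EuclideanSpace ℝ d) hg f ≤ ENNReal.ofReal (∏ i, c i)⁻¹ * (C * (C₂ * ∫⁻ ξ, ‖fourierFun (V := EuclideanSpace ℝ d) f ξ‖ₑ ^ 2)) ∧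
        ∀ (E : Set (EuclideanSpace ℝ d)) (_ : MeasurableSet E) (a : ℝ≥0),
          (∀ ξ ∈ E, ∃ t, sampleEquiv c hc (R t) ξ ∈ unitBox d ∧ a ≤ ‖p (R t ξ)‖ₑ) →
          ENNReal.ofReal (∏ i, c i)⁻¹ * (a ^ 2 * ∫⁻ ξ in E, ‖fourierFun (V := EuclideanSpace ℝ d) f ξ‖ₑ ^ 2)
            ≤ 2 * frameSum (V := EuclideanSpace ℝ d) hg f +
              2 * (ε * (ENNReal.ofReal (∏ i, c i)⁻¹ * (C₂ * ∫⁻ ξ, ‖fourierFun (V := EuclideanSpace ℝ d) f ξ‖ₑ ^ 2))) := by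
  choose hg hinner using fun i : τ × (d → ℤ) =>
    inner_affine_eq_fourierFun h1 h2 hψ (hBR i.1) (hD i.1) (hR i.1) (scaledPoint c i.2) (s i.1)
  refine ⟨hg, fun f => ?_⟩
  have h := affineCoeff_estimates hpm h2 c hc R hD hR hs hC hε hC₂ (memLp_fourierFun (V := EuclideanSpace ℝ d) f)
  have hsum : frameSum (V := EuclideanSpace ℝ d) hg f = ∑' i : τ × (d → ℤ),
      ‖affineCoeff p c (R i.1) (D i.1) (s i.1) (fourierFun (V := EuclideanSpace ℝ d) f) i.2‖ₑ ^ 2 :=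
    tsum_congr fun i => by rw [hinner]; rfl
  rw [hsum]
  exact h

end Families

/-! ### Size of the filters and of the scaling function. -/

section Filters

/-- Put `y = 1` and use the hockey-stick identity: the sum is a single binomial coefficient. -/
theorem sum_choose_mul_pow_le_two_pow {K L : ℕ} (hK : 1 ≤ K) {y : ℝ} (h0 : 0 ≤ y) (h1 : y ≤ 1) :
    ∑ n ∈ Finset.range L, ((K - 1 + n).choose n : ℝ) * y ^ n ≤ 2 ^ (K + L - 1) := by
  rcases L with _ | L
  · simp
  calc ∑ n ∈ Finset.range (L + 1), ((K - 1 + n).choose n : ℝ) * y ^ n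
      ≤ ∑ n ∈ Finset.range (L + 1), ((n + (K - 1)).choose (K - 1) : ℝ) := by
        refine Finset.sum_le_sum fun n _ => ?_
        rw [add_comm n, Nat.choose_symm_add]
        exact mul_le_of_le_one_right (by positivity) (pow_le_one₀ h0 h1)
    _ = ((L + (K - 1) + 1).choose (K - 1 + 1) : ℝ) := by
        exact_mod_cast Nat.sum_range_add_choose L (K - 1)
    _ ≤ 2 ^ (L + (K - 1) + 1) := by exact_mod_cast Nat.choose_le_two_pow _ _
    _ = 2 ^ (K + (L + 1) - 1) := by congr 1; omega

/-- For `y < 1` the sum is a partial sum of the negative binomial series of `(1 - y)^(-K)`. This is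
what gives `|m₀| ≤ 1`. -/
theorem pow_mul_sum_choose_le_one {K L : ℕ} (hK : 1 ≤ K) {y : ℝ} (h0 : 0 ≤ y) (h1 : y ≤ 1) :
    (1 - y) ^ K * ∑ n ∈ Finset.range L, ((K - 1 + n).choose n : ℝ) * y ^ n ≤ 1 := by
  rcases h1.lt_or_eq with h1 | rfl
  · have hs := hasSum_choose_mul_geometric_of_norm_lt_one (K - 1) (r := y)
      (by rwa [Real.norm_of_nonneg h0])
    have hle := sum_le_hasSum (Finset.range L) (fun n _ => by positivity) hs
    have e : ∑ n ∈ Finset.range L, ((K - 1 + n).choose n : ℝ) * y ^ n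
        = ∑ n ∈ Finset.range L, ((n + (K - 1)).choose (K - 1) : ℝ) * y ^ n :=
      Finset.sum_congr rfl fun n _ => by rw [add_comm n, Nat.choose_symm_add]
    have hp : 0 < (1 - y) ^ K := by have := sub_pos.2 h1; positivity
    rw [Nat.sub_add_cancel hK] at hle
    rw [e]
    calc _ ≤ (1 - y) ^ K * (1 / (1 - y) ^ K) := by gcongr
      _ = 1 := by field_simp
  · simp [show K ≠ 0 by omega]

theorem one_le_sum_choose {K L : ℕ} (hL : 1 ≤ L) {y : ℝ} (h0 : 0 ≤ y) :
    1 ≤ ∑ n ∈ Finset.range L, ((K - 1 + n).choose n : ℝ) * y ^ n := by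
  have := Finset.single_le_sum (f := fun n => ((K - 1 + n).choose n : ℝ) * y ^ n)
    (fun n _ => by positivity) (Finset.mem_range.2 hL)
  simpa using this

variable {K L : ℕ} {m₀ m₁ : ℝ → ℂ}

theorem IsLowPass.normSq' (h : IsLowPass K L m₀) (ξ : ℝ) :
    ‖m₀ ξ‖ ^ 2 = (Real.cos (Real.pi * ξ) ^ 2) ^ K *
      ∑ n ∈ Finset.range L, ((K - 1 + n).choose n : ℝ) * (Real.sin (Real.pi * ξ) ^ 2) ^ n := by
  simp only [h.normSq ξ, pow_mul]

theorem IsLowPass.norm_le_one (h : IsLowPass K L m₀) (hK : 1 ≤ K) (ξ : ℝ) : ‖m₀ ξ‖ ≤ 1 := by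
  have := h.normSq' ξ
  rw [Real.cos_sq'] at this
  have h1 := pow_mul_sum_choose_le_one (L := L) hK (sq_nonneg (Real.sin (Real.pi * ξ)))
    (Real.sin_sq_le_one _)
  rw [← this] at h1
  exact (sq_le_one_iff₀ (norm_nonneg _)).1 h1

theorem IsLowPass.normSq_le (h : IsLowPass K L m₀) (hK : 1 ≤ K) (ξ : ℝ) :
    ‖m₀ ξ‖ ^ 2 ≤ |Real.cos (Real.pi * ξ)| ^ (2 * K) * 2 ^ (K + L - 1) := by
  rw [h.normSq' ξ, pow_mul, sq_abs]
  gcongr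
  exact sum_choose_mul_pow_le_two_pow hK (sq_nonneg _) (Real.sin_sq_le_one _)

theorem IsLowPass.le_norm (h : IsLowPass K L m₀) (hL : 1 ≤ L) (ξ : ℝ) :
    |Real.cos (Real.pi * ξ)| ^ K ≤ ‖m₀ ξ‖ := by
  refine (abs_le_of_sq_le_sq' ?_ (norm_nonneg _)).2
  rw [h.normSq' ξ, ← pow_mul, mul_comm K 2, pow_mul, sq_abs]
  exact le_mul_of_one_le_right (by positivity) (one_le_sum_choose hL (sq_nonneg _))

theorem IsRealTrigPoly.isTrigPoly (h : IsRealTrigPoly m₀) : IsTrigPoly m₀ := by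
  obtain ⟨c, hc⟩ := h
  refine ⟨c.mapRange (fun x : ℝ => (x : ℂ)) (by simp), fun ξ => ?_⟩
  rw [hc]
  refine (Finset.sum_subset_zero_on_sdiff Finsupp.support_mapRange ?_ ?_).symm
  · intro n hn
    simp only [Finset.mem_sdiff, Finsupp.mem_support_iff, not_not] at hn
    have := hn.2
    simp only [Finsupp.mapRange_apply] at this
    simp [this]
  · intro n _
    simp

theorem IsTrigPoly.continuous (h : IsTrigPoly m₀) : Continuous m₀ := by
  obtain ⟨c, hc⟩ := h
  rw [funext hc]
  fun_prop

theorem IsTrigPoly.exists_norm_sub_le (h : IsTrigPoly m₀) :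
    ∃ C : ℝ, ∀ ξ : ℝ, ‖m₀ ξ - m₀ 0‖ ≤ C * |ξ| := by
  obtain ⟨c, hc⟩ := h
  refine ⟨∑ n ∈ c.support, ‖c n‖ * |2 * Real.pi * n|, fun ξ => ?_⟩
  rw [hc, hc, ← Finset.sum_sub_distrib, Finset.sum_mul]
  refine (norm_sum_le _ _).trans (Finset.sum_le_sum fun n _ => ?_)
  rw [← mul_sub, norm_mul, mul_assoc ‖c n‖]
  refine mul_le_mul_of_nonneg_left ?_ (norm_nonneg (c n))
  have := Real.norm_exp_I_mul_ofReal_sub_one_le (x := 2 * Real.pi * n * ξ)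
  rw [Real.norm_eq_abs, abs_mul] at this
  refine le_trans (le_of_eq ?_) this
  congr 2
  · congr 1
    push_cast
    ring
  · simp

/-- A trigonometric polynomial is Lipschitz at the origin and `m₀ 0 = 1`, so the factors differ from
`1` by `O(2⁻ʲ)`. -/
theorem IsLowPass.multipliable (h : IsLowPass K L m₀) (ξ : ℝ) :
    Multipliable (scalingFactor m₀ ξ) := by
  obtain ⟨C, hC⟩ := h.trig.isTrigPoly.exists_norm_sub_le
  have e : scalingFactor m₀ ξ = fun j => 1 + (m₀ (((2 : ℝ) ^ j)⁻¹ * ξ) - 1) := by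
    ext j; simp [scalingFactor]
  rw [e]
  refine Complex.multipliable_one_add_of_summable ?_
  refine Summable.of_norm_bounded (g := fun j : ℕ => C * |ξ| * (1 / 2 : ℝ) ^ j)
    (summable_geometric_two.mul_left _) fun j => ?_
  have := hC (((2 : ℝ) ^ j)⁻¹ * ξ)
  rw [h.zero, abs_mul, abs_of_pos (by positivity)] at this
  refine this.trans (le_of_eq ?_)
  rw [one_div, inv_pow]
  ring

/-- The partial products of the scaling function. -/
noncomputable def partialHat (m₀ : ℝ → ℂ) (N : ℕ) (ξ : ℝ) : ℂ :=
  ∏ j ∈ Finset.range N, scalingFactor m₀ ξ j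

theorem IsLowPass.tendsto_partialHat (h : IsLowPass K L m₀) (ξ : ℝ) :
    Filter.Tendsto (fun N => partialHat m₀ N ξ) Filter.atTop (nhds (scalingHat m₀ ξ)) :=
  (h.multipliable ξ).hasProd.tendsto_prod_nat

theorem IsLowPass.continuous_partialHat (h : IsLowPass K L m₀) (N : ℕ) :
    Continuous (partialHat m₀ N) := by
  have := h.trig.isTrigPoly.continuous
  unfold partialHat scalingFactor
  fun_prop

theorem IsLowPass.measurable_scalingHat (h : IsLowPass K L m₀) : Measurable (scalingHat m₀) :=
  measurable_of_tendsto_metrizable (fun N => (h.continuous_partialHat N).measurable)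
    (tendsto_pi_nhds.2 h.tendsto_partialHat)

theorem IsLowPass.norm_partialHat_le_one (h : IsLowPass K L m₀) (hK : 1 ≤ K) (N : ℕ) (ξ : ℝ) :
    ‖partialHat m₀ N ξ‖ ≤ 1 := by
  rw [partialHat, norm_prod]
  exact Finset.prod_le_one (fun _ _ => norm_nonneg _) fun _ _ => h.norm_le_one hK _

/-- Since `|m₀| ≤ 1`, the partial products decrease in modulus. -/
theorem IsLowPass.norm_scalingHat_le (h : IsLowPass K L m₀) (hK : 1 ≤ K) (N : ℕ) (ξ : ℝ) :
    ‖scalingHat m₀ ξ‖ ≤ ‖partialHat m₀ N ξ‖ := by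
  refine le_of_tendsto (h.tendsto_partialHat ξ).norm ?_
  filter_upwards [Filter.eventually_ge_atTop N] with n hn
  have hanti : Antitone fun n => ‖partialHat m₀ n ξ‖ := by
    refine antitone_nat_of_succ_le fun n => ?_
    rw [partialHat, partialHat, Finset.prod_range_succ, norm_mul]
    exact mul_le_of_le_one_right (norm_nonneg _) (h.norm_le_one hK _)
  exact hanti hn

theorem IsLowPass.norm_scalingHat_le_one (h : IsLowPass K L m₀) (hK : 1 ≤ K) (ξ : ℝ) :
    ‖scalingHat m₀ ξ‖ ≤ 1 :=
  (h.norm_scalingHat_le hK 0 ξ).trans (h.norm_partialHat_le_one hK 0 ξ)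

/-- Viète's product. -/
theorem prod_cos_mul_sin (x : ℝ) (N : ℕ) :
    (∏ j ∈ Finset.range N, Real.cos (((2 : ℝ) ^ j)⁻¹ * x)) *
      (2 ^ N * Real.sin (2 * (((2 : ℝ) ^ N)⁻¹ * x))) = Real.sin (2 * x) := by
  induction N with
  | zero => simp
  | succ N ih =>
    rw [Finset.prod_range_succ, ← ih, Real.sin_two_mul (((2 : ℝ) ^ N)⁻¹ * x)]
    have : 2 * (((2 : ℝ) ^ (N + 1))⁻¹ * x) = ((2 : ℝ) ^ N)⁻¹ * x := by
      rw [pow_succ]; field_simp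
    rw [this]
    ring

/-- With these bounds on `2⁻ᴺ|ξ|` the last angle in Viète's product lies in `[π/4, π/2]` up to sign,
where Jordan's inequality bounds the sine below by `1/2`. -/
theorem prod_abs_cos_le {ξ : ℝ} {N : ℕ} (h1 : 1 / 8 ≤ ((2 : ℝ) ^ N)⁻¹ * |ξ|)
    (h2 : ((2 : ℝ) ^ N)⁻¹ * |ξ| ≤ 1 / 4) :
    ∏ j ∈ Finset.range N, |Real.cos (Real.pi * (((2 : ℝ) ^ j)⁻¹ * ξ))| ≤ 2 * ((2 : ℝ) ^ N)⁻¹ := by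
  have h := prod_cos_mul_sin (Real.pi * ξ) N
  set y := 2 * (((2 : ℝ) ^ N)⁻¹ * (Real.pi * ξ)) with hy
  have hyabs : |y| = 2 * Real.pi * (((2 : ℝ) ^ N)⁻¹ * |ξ|) := by
    rw [hy, abs_mul, abs_mul, abs_mul, abs_of_pos Real.pi_pos, abs_of_pos (by positivity : (0:ℝ) < (2 ^ N)⁻¹),
      abs_two]
    ring
  have hpi := Real.pi_pos
  have hs : 1 / 2 ≤ |Real.sin y| := by
    refine le_trans ?_ (Real.mul_abs_le_abs_sin (x := y) ?_)
    · rw [hyabs]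
      have : 2 / Real.pi * (2 * Real.pi * (((2 : ℝ) ^ N)⁻¹ * |ξ|)) = 4 * (((2 : ℝ) ^ N)⁻¹ * |ξ|) := by
        field_simp; ring
      rw [this]; linarith
    · rw [hyabs]; nlinarith
  have e : ∏ j ∈ Finset.range N, |Real.cos (Real.pi * (((2 : ℝ) ^ j)⁻¹ * ξ))|
      = |∏ j ∈ Finset.range N, Real.cos (((2 : ℝ) ^ j)⁻¹ * (Real.pi * ξ))| := by
    rw [Finset.abs_prod]
    exact Finset.prod_congr rfl fun j _ => by rw [mul_left_comm]
  rw [e]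
  set P := ∏ j ∈ Finset.range N, Real.cos (((2 : ℝ) ^ j)⁻¹ * (Real.pi * ξ))
  have hle : |P| * (2 ^ N * |Real.sin y|) ≤ 1 := by
    have := congrArg abs h
    rw [abs_mul, abs_mul, abs_of_pos (by positivity : (0:ℝ) < 2 ^ N)] at this
    rw [this]
    exact Real.abs_sin_le_one _
  have hN : (0 : ℝ) < 2 ^ N := by positivity
  rw [← div_eq_mul_inv, le_div_iff₀ hN]
  nlinarith [abs_nonneg P, mul_nonneg (abs_nonneg P) hN.le]

/-- Viète's product again: Jordan's inequality gives `|sin 2πξ| ≥ 4|ξ|`, while `2ᴺ |sin(2π 2⁻ᴺ ξ)| ≤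
2π|ξ|`, so the product is at least `2/π`, uniformly in `N`. -/
theorem le_prod_abs_cos {ξ : ℝ} (h : |ξ| ≤ 1 / 4) (N : ℕ) :
    1 / 2 ≤ ∏ j ∈ Finset.range N, |Real.cos (Real.pi * (((2 : ℝ) ^ j)⁻¹ * ξ))| := by
  rcases eq_or_ne ξ 0 with rfl | hξ
  · simp; norm_num
  have hV := prod_cos_mul_sin (Real.pi * ξ) N
  have e : ∏ j ∈ Finset.range N, |Real.cos (Real.pi * (((2 : ℝ) ^ j)⁻¹ * ξ))|
      = |∏ j ∈ Finset.range N, Real.cos (((2 : ℝ) ^ j)⁻¹ * (Real.pi * ξ))| := by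
    rw [Finset.abs_prod]
    exact Finset.prod_congr rfl fun j _ => by rw [mul_left_comm]
  rw [e]
  set P := ∏ j ∈ Finset.range N, Real.cos (((2 : ℝ) ^ j)⁻¹ * (Real.pi * ξ))
  have hpi := Real.pi_pos
  have hξ' : 0 < |ξ| := abs_pos.2 hξ
  have h1 : 4 * |ξ| ≤ |Real.sin (2 * (Real.pi * ξ))| := by
    have hx : |2 * (Real.pi * ξ)| = 2 * Real.pi * |ξ| := by
      rw [abs_mul, abs_mul, abs_two, abs_of_pos hpi]; ring
    have := Real.mul_abs_le_abs_sin (x := 2 * (Real.pi * ξ)) (by rw [hx]; nlinarith)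
    rw [hx] at this
    refine le_trans (le_of_eq ?_) this
    field_simp; ring
  have h2 : 2 ^ N * |Real.sin (2 * (((2 : ℝ) ^ N)⁻¹ * (Real.pi * ξ)))| ≤ 2 * Real.pi * |ξ| := by
    have := Real.abs_sin_le_abs (x := 2 * (((2 : ℝ) ^ N)⁻¹ * (Real.pi * ξ)))
    rw [abs_mul, abs_mul, abs_mul, abs_two, abs_of_pos hpi,
      abs_of_pos (by positivity : (0:ℝ) < (2 ^ N)⁻¹)] at this
    calc _ ≤ 2 ^ N * (2 * (((2 : ℝ) ^ N)⁻¹ * (Real.pi * |ξ|))) := by gcongr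
      _ = _ := by field_simp
  have h3 := congrArg abs hV
  rw [abs_mul, abs_mul, abs_of_pos (by positivity : (0:ℝ) < 2 ^ N)] at h3
  have h4 : 4 * |ξ| ≤ |P| * (2 * Real.pi * |ξ|) := by
    calc _ ≤ _ := h1
      _ = _ := h3.symm
      _ ≤ _ := by gcongr
  have h5 : 4 ≤ |P| * (2 * Real.pi) := by
    have : 4 * |ξ| ≤ (|P| * (2 * Real.pi)) * |ξ| := by linarith
    exact le_of_mul_le_mul_right this hξ'
  nlinarith [Real.pi_le_four, abs_nonneg P]

/-- Stop the product at `N` with `2ᴺ` comparable to `|ξ|`. The cosines give about `2^(-2KN)` for the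
square and the binomial sums cost `2^((K+L-1)N)`; the hypothesis `L + 5 ≤ K` leaves at least
`2^(-6N)`, that is cubic decay. -/
theorem IsLowPass.norm_scalingHat_decay (h : IsLowPass K L m₀) (hL : 1 ≤ L) (hK : L + 5 ≤ K) (ξ : ℝ) :
    ‖scalingHat m₀ ξ‖ ≤ 8 * 2 ^ K * ((1 + |ξ|) ^ 3)⁻¹ := by
  have hK1 : 1 ≤ K := by omega
  have hpos : 0 < (1 + |ξ|) ^ 3 := by positivity
  have h2K : (1 : ℝ) ≤ 2 ^ K := one_le_pow₀ (by norm_num)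
  rcases le_total |ξ| (1 / 4) with hξ | hξ
  · refine (h.norm_scalingHat_le_one hK1 ξ).trans ?_
    rw [← div_eq_mul_inv, le_div_iff₀ hpos]
    have : (1 + |ξ|) ^ 3 ≤ 2 ^ 3 := by gcongr; linarith
    nlinarith
  -- With `2ⁿ ≤ 4|ξ| < 2ⁿ⁺¹` and `N = n + 1`, the quotient `|ξ| / 2ᴺ` lies in `[1/8, 1/4]`.
  obtain ⟨n, hn1, hn2⟩ := exists_nat_pow_near (x := 4 * |ξ|) (y := (2 : ℝ)) (by linarith) (by norm_num)
  set N := n + 1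
  have hN : (0 : ℝ) < 2 ^ N := by positivity
  have hN2 : (2 : ℝ) ^ N = 2 * 2 ^ n := by rw [pow_succ]; ring
  have a1 : 1 / 8 ≤ ((2 : ℝ) ^ N)⁻¹ * |ξ| := by
    rw [inv_mul_eq_div, le_div_iff₀ hN, hN2]; linarith
  have a2 : ((2 : ℝ) ^ N)⁻¹ * |ξ| ≤ 1 / 4 := by
    rw [inv_mul_eq_div, div_le_iff₀ hN]; linarith
  have hcos := prod_abs_cos_le a1 a2
  have hsq : ‖partialHat m₀ N ξ‖ ^ 2 ≤ (2 ^ K * ((4 * |ξ|) ^ 3)⁻¹) ^ 2 := by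
    calc ‖partialHat m₀ N ξ‖ ^ 2
        = ∏ j ∈ Finset.range N, ‖m₀ (((2 : ℝ) ^ j)⁻¹ * ξ)‖ ^ 2 := by
          rw [partialHat, norm_prod, Finset.prod_pow]; rfl
      _ ≤ ∏ j ∈ Finset.range N, (|Real.cos (Real.pi * (((2 : ℝ) ^ j)⁻¹ * ξ))| ^ (2 * K) *
            2 ^ (K + L - 1)) :=
          Finset.prod_le_prod (fun _ _ => by positivity) fun _ _ => h.normSq_le hK1 _
      _ = (∏ j ∈ Finset.range N, |Real.cos (Real.pi * (((2 : ℝ) ^ j)⁻¹ * ξ))|) ^ (2 * K) *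
            (2 ^ (K + L - 1)) ^ N := by
          rw [Finset.prod_mul_distrib, Finset.prod_pow, Finset.prod_const, Finset.card_range]
      _ ≤ (2 * ((2 : ℝ) ^ N)⁻¹) ^ (2 * K) * (2 ^ (2 * K - 6)) ^ N := by
          gcongr ?_ ^ _ * ?_ ^ _
          exact pow_le_pow_right₀ (by norm_num) (by omega)
      _ = (2 ^ K) ^ 2 * (((2 : ℝ) ^ N)⁻¹) ^ 6 := by
          have h6 : 2 * K = (2 * K - 6) + 6 := by omega
          have : ((2 : ℝ) ^ (2 * K - 6)) ^ N = ((2 : ℝ) ^ N) ^ (2 * K - 6) := by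
            rw [← pow_mul, ← pow_mul, mul_comm]
          rw [this, mul_pow, ← pow_mul 2 K 2, mul_comm K 2]
          nth_rewrite 2 [h6]
          rw [pow_add (((2 : ℝ) ^ N)⁻¹), inv_pow _ (2 * K - 6)]
          field_simp
      _ ≤ (2 ^ K) ^ 2 * ((4 * |ξ|)⁻¹) ^ 6 := by gcongr
      _ = _ := by rw [mul_pow, ← inv_pow, ← pow_mul (4 * |ξ|)⁻¹]
  have hx : 0 < |ξ| := by linarith
  have := abs_le_of_sq_le_sq' hsq (by positivity)
  refine (h.norm_scalingHat_le hK1 N ξ).trans (this.2.trans ?_)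
  rw [mul_comm (8 : ℝ), mul_assoc]
  gcongr
  rw [← div_eq_mul_inv, le_div_iff₀ hpos, inv_mul_le_iff₀ (by positivity)]
  have : (1 + |ξ|) ^ 3 ≤ (5 * |ξ|) ^ 3 := by gcongr; linarith
  refine this.trans ?_
  have h3 : 0 < |ξ| ^ 3 := by positivity
  rw [mul_pow, mul_pow]
  nlinarith

theorem IsLowPass.le_norm_scalingHat (h : IsLowPass K L m₀) (hL : 1 ≤ L) {ξ : ℝ} (hξ : |ξ| ≤ 1 / 4) :
    (1 / 2) ^ K ≤ ‖scalingHat m₀ ξ‖ := by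
  refine ge_of_tendsto (h.tendsto_partialHat ξ).norm (Filter.Eventually.of_forall fun N => ?_)
  calc (1 / 2 : ℝ) ^ K ≤ (∏ j ∈ Finset.range N, |Real.cos (Real.pi * (((2 : ℝ) ^ j)⁻¹ * ξ))|) ^ K := by
        gcongr; exact le_prod_abs_cos hξ N
    _ = ∏ j ∈ Finset.range N, |Real.cos (Real.pi * (((2 : ℝ) ^ j)⁻¹ * ξ))| ^ K :=
        (Finset.prod_pow _ _ _).symm
    _ ≤ ∏ j ∈ Finset.range N, ‖m₀ (((2 : ℝ) ^ j)⁻¹ * ξ)‖ :=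
        Finset.prod_le_prod (fun _ _ => by positivity) fun _ _ => h.le_norm hL _
    _ = _ := by rw [partialHat, norm_prod]; rfl

theorem IsBandPass.norm_eq (h : IsBandPass m₀ m₁) (ξ : ℝ) : ‖m₁ ξ‖ = ‖m₀ (ξ + 1 / 2)‖ :=
  (pow_left_inj₀ (norm_nonneg _) (norm_nonneg _) two_ne_zero).1 (h.normSq ξ)

theorem abs_cos_pi_mul_add_half (ξ : ℝ) :
    |Real.cos (Real.pi * (ξ + 1 / 2))| = |Real.sin (Real.pi * ξ)| := by
  rw [show Real.pi * (ξ + 1 / 2) = Real.pi * ξ + Real.pi / 2 by ring, Real.cos_add_pi_div_two, abs_neg]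

/-- The half shift turns the cosine into a sine; six of the `2K` powers of `|sin 4πξ| ≤ 16|ξ|` are
kept. This zero of order three compensates the sum over shears. -/
theorem IsBandPass.norm_le_pow (h : IsBandPass m₀ m₁) (h0 : IsLowPass K L m₀) (hK : 3 ≤ K) (ξ : ℝ) :
    ‖m₁ (4 * ξ)‖ ≤ 2 ^ (K + L) * (16 * |ξ|) ^ 3 := by
  have h1 := h0.normSq_le (by omega) (4 * ξ + 1 / 2)
  rw [abs_cos_pi_mul_add_half, ← h.norm_eq] at h1
  refine (abs_le_of_sq_le_sq' (h1.trans ?_) (by positivity)).2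
  have hsin : |Real.sin (Real.pi * (4 * ξ))| ≤ 16 * |ξ| := by
    refine Real.abs_sin_le_abs.trans ?_
    rw [abs_mul, abs_mul, abs_of_pos Real.pi_pos, abs_of_pos (by norm_num : (0 : ℝ) < 4)]
    nlinarith [Real.pi_le_four, abs_nonneg ξ]
  calc |Real.sin (Real.pi * (4 * ξ))| ^ (2 * K) * 2 ^ (K + L - 1)
      ≤ |Real.sin (Real.pi * (4 * ξ))| ^ 6 * 2 ^ (2 * (K + L)) := by
        gcongr ?_ * ?_
        · exact pow_le_pow_of_le_one (abs_nonneg _) (Real.abs_sin_le_one _) (by omega)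
        · exact pow_le_pow_right₀ (by norm_num) (by omega)
    _ ≤ (16 * |ξ|) ^ 6 * 2 ^ (2 * (K + L)) := by gcongr
    _ = _ := by ring

theorem IsBandPass.norm_le_one (h : IsBandPass m₀ m₁) (h0 : IsLowPass K L m₀) (hK : 1 ≤ K) (ξ : ℝ) :
    ‖m₁ ξ‖ ≤ 1 := by
  rw [h.norm_eq]; exact h0.norm_le_one hK _

/-- On this range `4π|ξ|` lies in `[π/4, π/2]`, so Jordan's inequality gives `|sin 4πξ| ≥ 8|ξ| ≥
1/2`. -/
theorem IsBandPass.le_norm (h : IsBandPass m₀ m₁) (h0 : IsLowPass K L m₀) (hL : 1 ≤ L) {ξ : ℝ}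
    (h1 : 1 / 16 ≤ |ξ|) (h2 : |ξ| ≤ 1 / 8) : (1 / 2) ^ K ≤ ‖m₁ (4 * ξ)‖ := by
  rw [h.norm_eq]
  refine le_trans ?_ (h0.le_norm hL _)
  rw [abs_cos_pi_mul_add_half]
  gcongr
  have hpi := Real.pi_pos
  have hx : |Real.pi * (4 * ξ)| = 4 * Real.pi * |ξ| := by
    rw [abs_mul, abs_mul, abs_of_pos hpi, abs_of_pos (by norm_num : (0 : ℝ) < 4)]; ring
  refine le_trans ?_ (Real.mul_abs_le_abs_sin (x := Real.pi * (4 * ξ)) (by rw [hx]; nlinarith))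
  rw [hx]
  have : 2 / Real.pi * (4 * Real.pi * |ξ|) = 8 * |ξ| := by field_simp; ring
  rw [this]; linarith

end Filters

/-! ### Frequency supports of the partial products. -/

section ExponentialSums

variable {V : Type*} [NormedAddCommGroup V] [InnerProductSpace ℝ V]

theorem expSums_mono {r s : ℝ} (h : r ≤ s) : expSums V r ≤ expSums V s :=
  Submodule.span_mono (Set.image_mono (Metric.closedBall_subset_closedBall h))

theorem mul_mem_expSums {r s : ℝ} {p q : V → ℂ} (hp : p ∈ expSums V r) (hq : q ∈ expSums V s) :
    p * q ∈ expSums V (r + s) := by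
  have h := Submodule.mul_mem_mul hp hq
  rw [expSums, expSums, Submodule.span_mul_span] at h
  refine Submodule.span_mono ?_ h
  rintro _ ⟨_, ⟨a, ha, rfl⟩, _, ⟨b, hb, rfl⟩, rfl⟩
  refine ⟨a + b, ?_, ?_⟩
  · simp only [Metric.mem_closedBall, dist_zero_right] at *
    exact (norm_add_le a b).trans (add_le_add ha hb)
  · ext ξ
    simp only [Pi.mul_apply, inner_add_right, neg_add, AddChar.map_add_eq_mul, Circle.coe_mul]

/-- The radius is linear in `‖w‖`, so that the dyadic dilates in the infinite product have
geometrically decreasing radii. The sum of the `|n|` is a convenient bound for the degree. -/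
theorem IsTrigPoly.exists_mem_expSums {m : ℝ → ℂ} (h : IsTrigPoly m) :
    ∃ r : ℝ, 0 ≤ r ∧ ∀ w : V, (fun ξ => m (inner ℝ ξ w)) ∈ expSums V (r * ‖w‖) := by
  obtain ⟨c, hc⟩ := h
  refine ⟨∑ n ∈ c.support, |(n : ℝ)|, Finset.sum_nonneg fun _ _ => abs_nonneg _, fun w => ?_⟩
  have e : (fun ξ => m (inner ℝ ξ w)) = ∑ n ∈ c.support,
      c n • fun ξ : V => (Real.fourierChar (-inner ℝ ξ (-(n : ℝ) • w)) : ℂ) := by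
    ext ξ
    simp only [hc, Finset.sum_apply, Pi.smul_apply, smul_eq_mul]
    refine Finset.sum_congr rfl fun n _ => ?_
    rw [Real.fourierChar_apply, inner_smul_right]
    congr 2
    push_cast
    ring
  rw [e]
  refine Submodule.sum_mem _ fun n hn => Submodule.smul_mem _ _ (Submodule.subset_span ⟨_, ?_, rfl⟩)
  rw [mem_closedBall_zero_iff, norm_smul, norm_neg, Real.norm_eq_abs]
  gcongr
  exact Finset.single_le_sum (f := fun n : ℤ => |(n : ℝ)|) (fun _ _ => abs_nonneg _) hn

/-- Multiplication adds radii; the factor `2 - 2 · 2⁻ᴺ` is the exact geometric sum, which lets the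
induction close. -/
theorem partialHat_mem_expSums {m : ℝ → ℂ} {r : ℝ}
    (hr : ∀ w : V, (fun ξ => m (inner ℝ ξ w)) ∈ expSums V (r * ‖w‖)) (N : ℕ) (w : V) :
    (fun ξ => partialHat m N (inner ℝ ξ w)) ∈ expSums V (r * ‖w‖ * (2 - 2 * ((2 : ℝ) ^ N)⁻¹)) := by
  induction N with
  | zero =>
    refine Submodule.subset_span ⟨0, by simp, ?_⟩
    ext ξ
    simp [partialHat]
  | succ N ih =>
    have h2 := hr (((2 : ℝ) ^ N)⁻¹ • w)
    have h := mul_mem_expSums ih h2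
    have e : (fun ξ : V => partialHat m (N + 1) (inner ℝ ξ w)) =
        (fun ξ => partialHat m N (inner ℝ ξ w)) *
          fun ξ => m (inner ℝ ξ (((2 : ℝ) ^ N)⁻¹ • w)) := by
      ext ξ
      simp only [Pi.mul_apply, inner_smul_right]
      rw [partialHat, Finset.prod_range_succ]
      rfl
    rw [e]
    refine expSums_mono (le_of_eq ?_) h
    rw [norm_smul, norm_inv, norm_pow, Real.norm_two, pow_succ]
    field_simp
    ring

theorem partialHat_mem_expSums' {m : ℝ → ℂ} {r : ℝ} (hr0 : 0 ≤ r)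
    (hr : ∀ w : V, (fun ξ => m (inner ℝ ξ w)) ∈ expSums V (r * ‖w‖)) (N : ℕ) (w : V) :
    (fun ξ => partialHat m N (inner ℝ ξ w)) ∈ expSums V (r * ‖w‖ * 2) := by
  refine expSums_mono ?_ (partialHat_mem_expSums hr N w)
  have : (0 : ℝ) ≤ 2 * ((2 : ℝ) ^ N)⁻¹ := by positivity
  gcongr
  linarith

end ExponentialSums

/-! ### Compact support of the generators. -/

section CompactSupport

variable {K L : ℕ} {m₀ m₁ : ℝ → ℂ}

theorem IsLowPass.exists_ae_eq_zero (h : IsLowPass K L m₀) (hK : 1 ≤ K) {F : L2Line}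
    (hF : F =ᵐ[volume] scalingHat m₀) :
    ∃ r : ℝ, ∀ᵐ x : ℝ, x ∉ Metric.closedBall (0 : ℝ) r → (𝓕⁻ F : L2Line) x = 0 := by
  obtain ⟨r, hr0, hr⟩ := h.trig.isTrigPoly.exists_mem_expSums (V := ℝ)
  refine ⟨r * ‖(1 : ℝ)‖ * 2, ae_eq_zero_of_tendsto_expSums (p := partialHat m₀) (C := 1)
    (fun n => ?_) (fun n ξ => h.norm_partialHat_le_one hK n ξ) h.tendsto_partialHat hF⟩
  simpa using partialHat_mem_expSums' hr0 hr n 1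

theorem exists_ae_eq_zero_shearlet (h : IsLowPass K L m₀) (h1 : IsBandPass m₀ m₁) (hK : 1 ≤ K)
    {F : L2Plane} (hF : F =ᵐ[volume] shearletHat m₀ m₁) :
    ∃ r : ℝ, ∀ᵐ x : Plane, x ∉ Metric.closedBall (0 : Plane) r → (𝓕⁻ F : L2Plane) x = 0 := by
  obtain ⟨r, hr0, hr⟩ := h.trig.isTrigPoly.exists_mem_expSums (V := Plane)
  obtain ⟨r₁, -, hr₁⟩ := h1.trig.exists_mem_expSums (V := Plane)
  have e0 : ∀ (i : Fin 2) (a : ℝ) (ξ : Plane), inner ℝ ξ (EuclideanSpace.single i a) = a * ξ i := by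
    intro i a ξ
    simp [EuclideanSpace.inner_single_right]
  set P : ℕ → Plane → ℂ := fun N => ((fun ξ : Plane => m₁ (inner ℝ ξ (EuclideanSpace.single 0 4))) *
      fun ξ => partialHat m₀ N (inner ℝ ξ (EuclideanSpace.single 0 1))) *
        fun ξ => partialHat m₀ N (inner ℝ ξ (EuclideanSpace.single 1 2)) with hP
  obtain ⟨R, hR⟩ : ∃ R : ℝ, ∀ N, P N ∈ expSums Plane R :=
    ⟨_, fun N => mul_mem_expSums (mul_mem_expSums (hr₁ _) (partialHat_mem_expSums' hr0 hr N _))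
      (partialHat_mem_expSums' hr0 hr N _)⟩
  have hb : ∀ N ξ, ‖P N ξ‖ ≤ 1 := by
    intro N ξ
    simp only [hP, Pi.mul_apply, norm_mul]
    exact mul_le_one₀ (mul_le_one₀ (h1.norm_le_one h hK _) (norm_nonneg _)
      (h.norm_partialHat_le_one hK _ _)) (norm_nonneg _) (h.norm_partialHat_le_one hK _ _)
  have hlim : ∀ ξ, Filter.Tendsto (fun N => P N ξ) Filter.atTop (nhds (shearletHat m₀ m₁ ξ)) := by
    intro ξ
    simp only [hP, Pi.mul_apply, e0, one_mul]
    exact ((h.tendsto_partialHat _).const_mul _).mul (h.tendsto_partialHat _)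
  exact ⟨R, ae_eq_zero_of_tendsto_expSums hR hb hlim hF⟩

end CompactSupport

/-! ### Decay and integrability of the transformed generators. -/

section Weights

open scoped ENNReal NNReal

/-- The decay profile `(1 + |t|)⁻³`. -/
noncomputable def decay (t : ℝ) : ℝ := ((1 + |t|) ^ 3)⁻¹

theorem decay_nonneg (t : ℝ) : 0 ≤ decay t := by unfold decay; positivity

theorem decay_le_one (t : ℝ) : decay t ≤ 1 :=
  inv_le_one_of_one_le₀ (one_le_pow₀ (by linarith [abs_nonneg t]))

theorem decay_anti {s t : ℝ} (h : |s| ≤ |t|) : decay t ≤ decay s := by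
  unfold decay; gcongr

variable {K L : ℕ} {m₀ m₁ : ℝ → ℂ}

/-- The function `φ̂ ⊗ φ̂`. -/
noncomputable def tensorHat (m₀ : ℝ → ℂ) (ξ : Plane) : ℂ := scalingHat m₀ (ξ 0) * scalingHat m₀ (ξ 1)

theorem IsLowPass.norm_tensorHat_le (h : IsLowPass K L m₀) (hL : 1 ≤ L) (hK : L + 5 ≤ K) (ξ : Plane) :
    ‖tensorHat m₀ ξ‖ ≤ (8 * 2 ^ K) ^ 2 * (decay (ξ 0) * decay (ξ 1)) := by
  have h1 := h.norm_scalingHat_decay hL hK (ξ 0)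
  have h2 := h.norm_scalingHat_decay hL hK (ξ 1)
  rw [tensorHat, norm_mul]
  refine (mul_le_mul h1 h2 (norm_nonneg _) (by positivity)).trans (le_of_eq ?_)
  unfold decay; ring

/-- The constant in the decay estimate of the shearlet. -/
noncomputable def shearletConst (K L : ℕ) : ℝ := 2 ^ (K + L) * 16 ^ 3 * (8 * 2 ^ K) ^ 2

theorem shearletConst_pos (K L : ℕ) : 0 < shearletConst K L := by unfold shearletConst; positivity

theorem norm_shearletHat_le (h : IsLowPass K L m₀) (h1 : IsBandPass m₀ m₁) (hL : 1 ≤ L)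
    (hK : L + 5 ≤ K) (ξ : Plane) :
    ‖shearletHat m₀ m₁ ξ‖ ≤ shearletConst K L * (min 1 (|ξ 0| ^ 3) * (decay (ξ 0) * decay (ξ 1))) := by
  have e1 := h.norm_scalingHat_decay hL hK (ξ 0)
  have e2 := h.norm_scalingHat_decay hL hK (2 * ξ 1)
  have e3 : ‖m₁ (4 * ξ 0)‖ ≤ 2 ^ (K + L) * 16 ^ 3 * min 1 (|ξ 0| ^ 3) := by
    rw [mul_min_of_nonneg _ _ (by positivity)]
    refine le_min ((h1.norm_le_one h (by omega) _).trans ?_) ?_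
    · have : (1 : ℝ) ≤ 2 ^ (K + L) := one_le_pow₀ (by norm_num)
      nlinarith
    · refine (h1.norm_le_pow h (by omega) (ξ 0)).trans (le_of_eq ?_)
      ring
  have e4 : decay (2 * ξ 1) ≤ decay (ξ 1) := decay_anti (by
    rw [abs_mul, abs_two]; linarith [abs_nonneg (ξ 1)])
  rw [shearletHat, norm_mul, norm_mul]
  calc _ ≤ (2 ^ (K + L) * 16 ^ 3 * min 1 (|ξ 0| ^ 3)) * (8 * 2 ^ K * decay (ξ 0)) *
        (8 * 2 ^ K * decay (2 * ξ 1)) := by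
        have := decay_nonneg (ξ 0)
        gcongr
        · exact e1
        · exact e2
    _ ≤ (2 ^ (K + L) * 16 ^ 3 * min 1 (|ξ 0| ^ 3)) * (8 * 2 ^ K * decay (ξ 0)) *
        (8 * 2 ^ K * decay (ξ 1)) := by
        have := decay_nonneg (ξ 0)
        gcongr
    _ = _ := by unfold shearletConst; ring

theorem norm_shearletHat_le' (h : IsLowPass K L m₀) (h1 : IsBandPass m₀ m₁) (hL : 1 ≤ L)
    (hK : L + 5 ≤ K) (ξ : Plane) :
    ‖shearletHat m₀ m₁ ξ‖ ≤ shearletConst K L * (decay (ξ 0) * decay (ξ 1)) := by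
  refine (norm_shearletHat_le h h1 hL hK ξ).trans ?_
  have := shearletConst_pos K L
  have := mul_nonneg (decay_nonneg (ξ 0)) (decay_nonneg (ξ 1))
  refine mul_le_mul_of_nonneg_left ?_ (by positivity)
  exact mul_le_of_le_one_left this (min_le_left _ _)

theorem IsLowPass.measurable_tensorHat (h : IsLowPass K L m₀) : Measurable (tensorHat m₀) := by
  have := h.measurable_scalingHat
  unfold tensorHat
  fun_prop

theorem measurable_shearletHat (h : IsLowPass K L m₀) (h1 : IsBandPass m₀ m₁) :
    Measurable (shearletHat m₀ m₁) := by
  have := h.measurable_scalingHat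
  have := h1.trig.continuous.measurable
  unfold shearletHat
  fun_prop

theorem integrable_and_memLp_of_decay {V : Type*} [NormedAddCommGroup V] [MeasurableSpace V]
    [BorelSpace V] {μ : Measure V} {p : V → ℂ} (hp : Measurable p) {g : V → ℝ} (hg : Integrable g μ)
    (hb : ∃ C, ∀ ξ, ‖p ξ‖ ≤ C) (h : ∀ ξ, ‖p ξ‖ ≤ g ξ) : Integrable p μ ∧ MemLp p 2 μ := by
  have h1 : Integrable p μ := hg.mono' hp.aestronglyMeasurable (Filter.Eventually.of_forall h)
  refine ⟨h1, ?_⟩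
  obtain ⟨C, hC⟩ := hb
  rw [memLp_two_iff_integrable_sq_norm hp.aestronglyMeasurable]
  simp only [sq]
  refine h1.norm.bdd_mul (c := C) hp.norm.aestronglyMeasurable (Filter.Eventually.of_forall fun ξ => ?_)
  simpa using hC ξ

theorem norm_le_abs_add_abs (ξ : Plane) : ‖ξ‖ ≤ |ξ 0| + |ξ 1| := by
  rw [EuclideanSpace.norm_eq, Fin.sum_univ_two]
  refine Real.sqrt_le_iff.2 ⟨by positivity, ?_⟩
  simp only [Real.norm_eq_abs]
  nlinarith [abs_nonneg (ξ 0), abs_nonneg (ξ 1)]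

/-- Because `(1 + |ξ₁|)(1 + |ξ₂|) ≥ 1 + ‖ξ‖`. The exponent exceeds the dimension two, which gives
integrability. -/
theorem decay_mul_decay_le (ξ : Plane) : decay (ξ 0) * decay (ξ 1) ≤ (1 + ‖ξ‖) ^ (-3 : ℝ) := by
  have h := norm_le_abs_add_abs ξ
  rw [Real.rpow_neg (by positivity), show (3 : ℝ) = ((3 : ℕ) : ℝ) by norm_num, Real.rpow_natCast,
    decay, decay, ← mul_inv, ← mul_pow]
  gcongr
  nlinarith [abs_nonneg (ξ 0), abs_nonneg (ξ 1)]

theorem integrable_and_memLp_plane {p : Plane → ℂ} (hp : Measurable p) {A : ℝ} (hA : 0 ≤ A)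
    (h : ∀ ξ, ‖p ξ‖ ≤ A * (decay (ξ 0) * decay (ξ 1))) : Integrable p ∧ MemLp p 2 volume := by
  refine integrable_and_memLp_of_decay hp (g := fun ξ => A * (1 + ‖ξ‖) ^ (-3 : ℝ))
    ((integrable_one_add_norm (by simp; norm_num)).const_mul A) ⟨A, fun ξ => ?_⟩ fun ξ => ?_
  · refine (h ξ).trans (mul_le_of_le_one_right hA ?_)
    exact mul_le_one₀ (decay_le_one _) (decay_nonneg _) (decay_le_one _)
  · exact (h ξ).trans (mul_le_mul_of_nonneg_left (decay_mul_decay_le ξ) hA)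

theorem IsLowPass.integrable_and_memLp_scalingHat (h : IsLowPass K L m₀) (hL : 1 ≤ L)
    (hK : L + 5 ≤ K) : Integrable (scalingHat m₀) ∧ MemLp (scalingHat m₀) 2 volume := by
  refine integrable_and_memLp_of_decay h.measurable_scalingHat
    (g := fun ξ => 8 * 2 ^ K * (1 + ‖ξ‖) ^ (-3 : ℝ))
    ((integrable_one_add_norm (by simp)).const_mul _) ⟨1, h.norm_scalingHat_le_one (by omega)⟩
    fun ξ => ?_
  refine (h.norm_scalingHat_decay hL hK ξ).trans (le_of_eq ?_)
  rw [Real.rpow_neg (by positivity), show (3 : ℝ) = ((3 : ℕ) : ℝ) by norm_num, Real.rpow_natCast]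
  rfl

end Weights

/-! ### Lattice sums: aliasing error, shears and dyadic scales. -/

section Sums

open scoped ENNReal NNReal

/-- A summable weight on the integers. -/
noncomputable def intWeight (n : ℤ) : ℝ := ((1 + |(n : ℝ)| / 2) ^ 2)⁻¹

theorem intWeight_nonneg (n : ℤ) : 0 ≤ intWeight n := by unfold intWeight; positivity

theorem summable_intWeight : Summable intWeight := by
  have h : Summable fun n : ℕ => 4 * (((n + 2 : ℕ) : ℝ) ^ 2)⁻¹ :=
    ((summable_nat_add_iff 2).2 (Real.summable_nat_pow_inv.2 one_lt_two)).mul_left 4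
  have e : ∀ n : ℕ, intWeight n = 4 * (((n + 2 : ℕ) : ℝ) ^ 2)⁻¹ := by
    intro n
    simp only [intWeight, Int.cast_natCast, Nat.abs_cast]
    push_cast
    field_simp
    ring
  refine Summable.of_nat_of_neg (h.congr fun n => (e n).symm) (h.congr fun n => ?_)
  rw [← e n]
  simp [intWeight]

/-- The total mass of `intWeight`. -/
noncomputable def intMass : ℝ≥0∞ := ∑' n : ℤ, ENNReal.ofReal (intWeight n)

theorem intMass_ne_top : intMass ≠ ∞ := by
  rw [intMass, ← ENNReal.ofReal_tsum_of_nonneg intWeight_nonneg summable_intWeight]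
  exact ENNReal.ofReal_ne_top

theorem half_abs_le_abs_add {x : ℝ} (hx : x ∈ Set.Ioc (-1 / 2 : ℝ) (-1 / 2 + 1)) (l : ℤ) :
    |(l : ℝ)| / 2 ≤ |x + l| := by
  rcases eq_or_ne l 0 with rfl | hl
  · simp
  have h1 : (1 : ℝ) ≤ |(l : ℝ)| := by
    have := Int.one_le_abs hl
    exact_mod_cast this
  have h2 : |x| ≤ 1 / 2 := abs_le.2 ⟨by linarith [hx.1], by linarith [hx.2]⟩
  have h3 : |(l : ℝ)| ≤ |x + l| + |x| := by
    have := abs_sub (x + l) x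
    simpa using this
  linarith

theorem decay_le_intWeight {t : ℝ} {l : ℤ} (h : |(l : ℝ)| / 2 ≤ |t|) : decay t ≤ intWeight l := by
  unfold decay intWeight
  gcongr
  calc (1 + |(l : ℝ)| / 2) ^ 2 ≤ (1 + |t|) ^ 2 := by gcongr
    _ ≤ (1 + |t|) ^ 3 := pow_le_pow_right₀ (by linarith [abs_nonneg t]) (by norm_num)

theorem le_abs_inv_mul {c x : ℝ} {l : ℤ} (hc : 0 < c) (hc1 : c ≤ 1)
    (hx : x ∈ Set.Ioc (-1 / 2 : ℝ) (-1 / 2 + 1)) : |(l : ℝ)| / 2 ≤ |c⁻¹ * (x + l)| := by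
  refine (half_abs_le_abs_add hx l).trans ?_
  rw [abs_mul, abs_of_pos (inv_pos.2 hc)]
  exact le_mul_of_one_le_left (abs_nonneg _) ((one_le_inv₀ hc).2 hc1)

/-- For `l ≠ 0` the sampled point has modulus at least `1/(2c)`. One of the three powers of decay
buys the small factor `2c`, the other two keep the sum over `l` convergent. -/
theorem decay_le_mul_intWeight {c x : ℝ} {l : ℤ} (hl : l ≠ 0) (hc : 0 < c) (hc1 : c ≤ 1)
    (hx : x ∈ Set.Ioc (-1 / 2 : ℝ) (-1 / 2 + 1)) :
    decay (c⁻¹ * (x + l)) ≤ 2 * c * intWeight l := by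
  set t := c⁻¹ * (x + l)
  have h1 : |(l : ℝ)| / 2 ≤ |t| := le_abs_inv_mul hc hc1 hx
  have h2 : (2 * c)⁻¹ ≤ 1 + |t| := by
    have h3 := half_abs_le_abs_add hx l
    have h4 : (1 : ℝ) ≤ |(l : ℝ)| := by
      have := Int.one_le_abs hl
      exact_mod_cast this
    have : |t| = c⁻¹ * |x + l| := by rw [abs_mul, abs_of_pos (inv_pos.2 hc)]
    rw [this, mul_inv]
    have : c⁻¹ * (1 / 2) ≤ c⁻¹ * |x + l| := by gcongr; linarith
    linarith
  have h5 : (1 + |t|)⁻¹ ≤ 2 * c := inv_le_of_inv_le₀ (by positivity) h2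
  have h6 : decay t = (1 + |t|)⁻¹ * ((1 + |t|) ^ 2)⁻¹ := by
    rw [decay, ← mul_inv]; ring
  rw [h6]
  unfold intWeight
  gcongr

/-- Some coordinate of `l ≠ 0` is nonzero, and that coordinate supplies the factor `2δ`. This makes
aliasing negligible for fine sampling. -/
theorem tsum_tail_le [DecidableEq (Fin 2 → ℤ)] {p : Plane → ℂ} {A δ : ℝ} (hA : 0 ≤ A)
    (h : ∀ ξ, ‖p ξ‖ ≤ A * (decay (ξ 0) * decay (ξ 1))) {c : Fin 2 → ℝ} (hc : ∀ i, 0 < c i)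
    (hcδ : ∀ i, c i ≤ δ) (hδ : δ ≤ 1) {x : Fin 2 → ℝ} (hx : x ∈ unitBox (Fin 2)) :
    ∑' l : Fin 2 → ℤ, (if l = 0 then 0 else ‖p (unscale c (x + latt l))‖ₑ)
      ≤ ENNReal.ofReal (A * (2 * δ)) * intMass ^ 2 := by
  have hδ0 : 0 < δ := (hc 0).trans_le (hcδ 0)
  have hterm : ∀ l : Fin 2 → ℤ, (if l = 0 then 0 else ‖p (unscale c (x + latt l))‖ₑ) ≤
      ENNReal.ofReal (A * (2 * δ)) *
        (ENNReal.ofReal (intWeight (l 0)) * ENNReal.ofReal (intWeight (l 1))) := by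
    intro l
    split_ifs with hl
    · exact zero_le
    rw [← ENNReal.ofReal_mul (intWeight_nonneg _), ← ENNReal.ofReal_mul (by positivity), ← ofReal_norm]
    refine ENNReal.ofReal_le_ofReal ((h _).trans ?_)
    rw [mul_assoc]
    refine mul_le_mul_of_nonneg_left ?_ hA
    have e : ∀ i, (unscale c (x + latt l)) i = (c i)⁻¹ * (x i + l i) := fun i => rfl
    rw [e, e]
    have hb : ∀ i, decay ((c i)⁻¹ * (x i + l i)) ≤ intWeight (l i) := fun i =>
      decay_le_intWeight (le_abs_inv_mul (hc i) ((hcδ i).trans hδ) (hx i))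
    have hs : ∀ i, l i ≠ 0 → decay ((c i)⁻¹ * (x i + l i)) ≤ 2 * δ * intWeight (l i) := fun i hi =>
      (decay_le_mul_intWeight hi (hc i) ((hcδ i).trans hδ) (hx i)).trans
        (mul_le_mul_of_nonneg_right (by linarith [hcδ i]) (intWeight_nonneg _))
    by_cases h0 : l 0 = 0
    · have h1 : l 1 ≠ 0 := by
        intro h1
        apply hl
        ext i
        fin_cases i <;> simp [h0, h1]
      refine (mul_le_mul (hb 0) (hs 1 h1) (decay_nonneg _) (intWeight_nonneg _)).trans (le_of_eq ?_)
      ring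
    · refine (mul_le_mul (hs 0 h0) (hb 1) (decay_nonneg _)
        (mul_nonneg (by positivity) (intWeight_nonneg _))).trans (le_of_eq ?_)
      ring
  refine (ENNReal.tsum_le_tsum hterm).trans (le_of_eq ?_)
  rw [ENNReal.tsum_mul_left, ← (finTwoArrowEquiv ℤ).symm.tsum_eq, ENNReal.tsum_prod']
  simp only [finTwoArrowEquiv_symm_apply, Matrix.cons_val_zero, Matrix.cons_val_one]
  simp_rw [ENNReal.tsum_mul_left, ENNReal.tsum_mul_right]
  rw [intMass, sq]

theorem tsum_full_le [DecidableEq (Fin 2 → ℤ)] {p : Plane → ℂ} {A δ : ℝ} (hA : 0 ≤ A)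
    (h : ∀ ξ, ‖p ξ‖ ≤ A * (decay (ξ 0) * decay (ξ 1))) {c : Fin 2 → ℝ} (hc : ∀ i, 0 < c i)
    (hcδ : ∀ i, c i ≤ δ) (hδ : δ ≤ 1) {x : Fin 2 → ℝ} (hx : x ∈ unitBox (Fin 2)) :
    ∑' l : Fin 2 → ℤ, ‖p (unscale c (x + latt l))‖ₑ
      ≤ ENNReal.ofReal A + ENNReal.ofReal (A * 2) * intMass ^ 2 := by
  rw [ENNReal.tsum_eq_add_tsum_ite (0 : Fin 2 → ℤ)]
  have htail := tsum_tail_le hA h hc hcδ hδ hx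
  have h0 : ‖p (unscale c (x + latt 0))‖ₑ ≤ ENNReal.ofReal A := by
    rw [← ofReal_norm]
    refine ENNReal.ofReal_le_ofReal ((h _).trans (mul_le_of_le_one_right hA ?_))
    exact mul_le_one₀ (decay_le_one _) (decay_nonneg _) (decay_le_one _)
  have h1 : ENNReal.ofReal (A * (2 * δ)) * intMass ^ 2 ≤ ENNReal.ofReal (A * 2) * intMass ^ 2 :=
    mul_le_mul_left (ENNReal.ofReal_le_ofReal (mul_le_mul_of_nonneg_left (by linarith) hA)) _
  refine add_le_add h0 (le_trans (le_of_eq (tsum_congr fun l => ?_)) (htail.trans h1))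
  congr

/-- Recentre the progression at its term nearest zero; the `n`-th neighbour then has modulus at
least `|n||t|/2`, so the bound does not depend on `s`. -/
theorem tsum_decay_arith_le (t s : ℝ) (ht : t ≠ 0) :
    ∑' k : ℤ, ENNReal.ofReal (decay (k * t + s)) ≤
      ENNReal.ofReal ((min 1 |t| ^ 2)⁻¹) * intMass := by
  set k₀ := round (-s / t)
  have ht' : 0 < |t| := abs_pos.2 ht
  have hs : |k₀ * t + s| ≤ |t| / 2 := by
    have h := abs_sub_round (-s / t)
    have e : k₀ * t + s = -((-s / t - k₀) * t) := by field_simp; ring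
    rw [e, abs_neg, abs_mul]
    nlinarith
  rw [← (Equiv.addRight k₀).tsum_eq, intMass, ← ENNReal.tsum_mul_left]
  refine ENNReal.tsum_le_tsum fun n => ?_
  rw [← ENNReal.ofReal_mul (by positivity)]
  refine ENNReal.ofReal_le_ofReal ?_
  have hle : |(n : ℝ)| * |t| / 2 ≤ |((Equiv.addRight k₀ n : ℤ) : ℝ) * t + s| := by
    rcases eq_or_ne n 0 with rfl | hn
    · simp
    have h1 : (1 : ℝ) ≤ |(n : ℝ)| := by
      have := Int.one_le_abs hn
      exact_mod_cast this
    have e : ((Equiv.addRight k₀ n : ℤ) : ℝ) * t + s = n * t + (k₀ * t + s) := by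
      simp; ring
    rw [e]
    have h2 := abs_sub (n * t + (k₀ * t + s)) (k₀ * t + s)
    rw [add_sub_cancel_right, abs_mul] at h2
    nlinarith
  have hm : 0 < min 1 |t| := lt_min one_pos ht'
  have hm1 : min 1 |t| ≤ 1 := min_le_left _ _
  have hkey : min 1 |t| * (1 + |(n : ℝ)| / 2) ≤ 1 + |((Equiv.addRight k₀ n : ℤ) : ℝ) * t + s| := by
    have : min 1 |t| * |(n : ℝ)| ≤ |t| * |(n : ℝ)| := by gcongr; exact min_le_right _ _
    linarith
  unfold decay intWeight
  rw [← mul_inv, ← mul_pow]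
  gcongr
  calc _ ≤ (1 + |((Equiv.addRight k₀ n : ℤ) : ℝ) * t + s|) ^ 2 := by gcongr
    _ ≤ _ := pow_le_pow_right₀ (by linarith [abs_nonneg (((Equiv.addRight k₀ n : ℤ) : ℝ) * t + s)])
      (by norm_num)

/-- The loss `|t|⁻²` from the shears is paid by the cubic zero for small `t`, and decay handles
large `t`. What remains is summable over dyadic `t`. -/
theorem min_pow_mul_decay_le {t : ℝ} (ht : t ≠ 0) :
    min 1 (|t| ^ 3) * decay t * (min 1 |t| ^ 2)⁻¹ ≤ min |t| |t|⁻¹ := by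
  have ht' : 0 < |t| := abs_pos.2 ht
  rcases le_total |t| 1 with h | h
  · rw [min_eq_right h, min_eq_right (pow_le_one₀ ht'.le h),
      min_eq_left (h.trans ((one_le_inv₀ ht').2 h))]
    have := decay_le_one t
    have h0 := decay_nonneg t
    have e : |t| ^ 3 * decay t * (|t| ^ 2)⁻¹ = |t| * decay t := by field_simp
    rw [e]
    exact mul_le_of_le_one_right ht'.le this
  · rw [min_eq_left h, min_eq_left (one_le_pow₀ h), min_eq_right ((inv_le_one_of_one_le₀ h).trans h)]
    simp only [one_pow, inv_one, mul_one, one_mul]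
    unfold decay
    gcongr
    calc |t| ≤ 1 + |t| := by linarith
      _ ≤ (1 + |t|) ^ 3 := le_self_pow₀ (by linarith) (by norm_num)

/-- The total mass of the weight `2 * 2⁻¹ ^ |i|` on the integers. -/
noncomputable def dyadicMass : ℝ≥0∞ := ∑' i : ℤ, ENNReal.ofReal (2 * (2⁻¹ : ℝ) ^ i.natAbs)

theorem dyadicMass_ne_top : dyadicMass ≠ ∞ := by
  have h : Summable fun n : ℕ => 2 * (2⁻¹ : ℝ) ^ n :=
    (summable_geometric_of_lt_one (by norm_num) (by norm_num)).mul_left 2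
  have h2 : Summable fun i : ℤ => 2 * (2⁻¹ : ℝ) ^ i.natAbs :=
    Summable.of_nat_of_neg (by simpa using h) (by simpa using h)
  rw [dyadicMass, ← ENNReal.ofReal_tsum_of_nonneg (fun i => by positivity) h2]
  exact ENNReal.ofReal_ne_top

/-- If `2ⁿ ≤ x < 2ⁿ⁺¹`, the `j`-th term is at most `2 · 2^(-|n-j|)`; extending the sum to all
integers makes the bound independent of `x`. -/
theorem tsum_min_dyadic_le {x : ℝ} (hx : 0 < x) :
    ∑' j : ℕ, ENNReal.ofReal (min (((2 : ℝ) ^ j)⁻¹ * x) (((2 : ℝ) ^ j)⁻¹ * x)⁻¹) ≤ dyadicMass := by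
  obtain ⟨n, hn1, hn2⟩ := exists_mem_Ico_zpow hx (y := (2 : ℝ)) (by norm_num)
  have hinj : Function.Injective fun j : ℕ => (n - j : ℤ) := fun a b h => by
    simp only at h; omega
  refine le_trans (ENNReal.tsum_le_tsum fun j => ?_) (ENNReal.tsum_comp_le_tsum_of_injective hinj
    fun i : ℤ => ENNReal.ofReal (2 * (2⁻¹ : ℝ) ^ i.natAbs))
  refine ENNReal.ofReal_le_ofReal ?_
  have e : ((2 : ℝ) ^ j)⁻¹ = (2 : ℝ) ^ (-(j : ℤ)) := by rw [zpow_neg, zpow_natCast]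
  have e1 : (2 : ℝ) ^ (n - j) ≤ ((2 : ℝ) ^ j)⁻¹ * x := by
    rw [e, sub_eq_neg_add, zpow_add₀ two_ne_zero]; gcongr
  have e2 : ((2 : ℝ) ^ j)⁻¹ * x ≤ 2 * (2 : ℝ) ^ (n - j) := by
    rw [zpow_add_one₀ two_ne_zero] at hn2
    rw [e, sub_eq_neg_add, zpow_add₀ two_ne_zero]
    have : (0 : ℝ) < 2 ^ (-(j : ℤ)) := by positivity
    nlinarith
  rcases le_total 0 (n - (j : ℤ)) with h | h
  · refine (min_le_right _ _).trans ?_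
    have : (2⁻¹ : ℝ) ^ (n - (j : ℤ)).natAbs = ((2 : ℝ) ^ (n - (j : ℤ)))⁻¹ := by
      rw [inv_pow, ← zpow_natCast, Int.natAbs_of_nonneg h]
    rw [this]
    have h3 : (((2 : ℝ) ^ j)⁻¹ * x)⁻¹ ≤ ((2 : ℝ) ^ (n - (j : ℤ)))⁻¹ := by gcongr
    have h4 : 0 < ((2 : ℝ) ^ (n - (j : ℤ)))⁻¹ := by positivity
    linarith
  · refine (min_le_left _ _).trans (e2.trans (le_of_eq ?_))
    congr 1
    rw [inv_pow, ← zpow_natCast, Int.ofNat_natAbs_of_nonpos h, zpow_neg, inv_inv]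

end Sums

/-! ### Frame estimates in real form, and energies of frequency regions. -/

section RealEstimates

open scoped ENNReal NNReal

section

variable {V : Type*} [NormedAddCommGroup V] [InnerProductSpace ℝ V] [FiniteDimensional ℝ V]
  [MeasurableSpace V] [BorelSpace V]

/-- The energy of `f` in the frequency region `E`. -/
noncomputable def energy (E : Set V) (f : Lp (α := V) ℂ 2 volume) : ℝ :=
  (∫⁻ ξ in E, ‖fourierFun f ξ‖ₑ ^ 2).toReal

theorem energy_nonneg (E : Set V) (f : Lp (α := V) ℂ 2 volume) : 0 ≤ energy E f :=
  ENNReal.toReal_nonneg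

theorem lintegral_fourierFun_ne_top (f : Lp (α := V) ℂ 2 volume) :
    ∫⁻ ξ, ‖fourierFun f ξ‖ₑ ^ 2 ≠ ∞ := by
  rw [lintegral_enorm_fourierFun_sq]
  exact ENNReal.pow_ne_top enorm_ne_top

theorem setLIntegral_fourierFun_ne_top (E : Set V) (f : Lp (α := V) ℂ 2 volume) :
    ∫⁻ ξ in E, ‖fourierFun f ξ‖ₑ ^ 2 ≠ ∞ :=
  ((setLIntegral_le_lintegral E _).trans_lt (lintegral_fourierFun_ne_top f).lt_top).ne

theorem energy_univ (f : Lp (α := V) ℂ 2 volume) : energy Set.univ f = ‖f‖ ^ 2 := by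
  rw [energy, setLIntegral_univ, lintegral_enorm_fourierFun_sq, ENNReal.toReal_pow, toReal_enorm]

theorem energy_union_le (E G : Set V) (f : Lp (α := V) ℂ 2 volume) :
    energy (E ∪ G) f ≤ energy E f + energy G f := by
  rw [energy, energy, energy, ← ENNReal.toReal_add (setLIntegral_fourierFun_ne_top _ _)
    (setLIntegral_fourierFun_ne_top _ _)]
  exact ENNReal.toReal_mono (ENNReal.add_ne_top.2 ⟨setLIntegral_fourierFun_ne_top _ _,
    setLIntegral_fourierFun_ne_top _ _⟩) (lintegral_union_le _ _ _)

theorem energy_eq_norm_sq {E : Set V} (hE : MeasurableSet E) {f : Lp (α := V) ℂ 2 volume}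
    (h : ∀ᵐ ξ, ξ ∉ E → fourierFun f ξ = 0) : energy E f = ‖f‖ ^ 2 := by
  rw [← energy_univ, energy, energy, setLIntegral_univ, ← lintegral_indicator hE]
  congr 1
  refine lintegral_congr_ae ?_
  filter_upwards [h] with ξ hξ
  by_cases hm : ξ ∈ E
  · rw [Set.indicator_of_mem hm]
  · rw [Set.indicator_of_notMem hm, hξ hm]; simp

/-- Real form of the frame estimates: `g` is a family whose frame sum is at most `κ B ‖f‖²`, and at
least `κ (a E(f) - e ‖f‖²) / 2`, where `E(f)` is the energy of `f` in a region contained in `G`. -/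
structure HasFrameBounds {ι : Type*} (g : ι → V → ℂ) (G : Set V) (κ B a e : ℝ) : Prop where
  memLp : ∀ i, MemLp (g i) 2 (volume : Measure V)
  ne_top : ∀ f, frameSum memLp f ≠ ∞
  upper : ∀ f, (frameSum memLp f).toReal ≤ κ * (B * ‖f‖ ^ 2)
  lower : ∀ f E, MeasurableSet E → E ⊆ G →
    κ * (a * energy E f) ≤ 2 * (frameSum memLp f).toReal + κ * (e * ‖f‖ ^ 2)

theorem HasFrameBounds.congr_equiv {ι ι' : Type*} {g : ι → V → ℂ} {g' : ι' → V → ℂ} {G : Set V}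
    {κ B a e : ℝ} (h : HasFrameBounds g G κ B a e) (φ : ι' ≃ ι) (hg : ∀ i, g' i = g (φ i)) :
    HasFrameBounds g' G κ B a e := by
  obtain rfl : g' = fun i => g (φ i) := funext hg
  have hm : ∀ i, MemLp (g (φ i)) 2 (volume : Measure V) := fun i => h.memLp _
  have hs : ∀ f, frameSum hm f = frameSum h.memLp f := fun f =>
    φ.tsum_eq fun i => ‖inner ℂ ((h.memLp i).toLp (g i)) f‖ₑ ^ 2
  exact ⟨hm, fun f => by rw [hs]; exact h.ne_top f, fun f => by rw [hs]; exact h.upper f,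
    fun f => by rw [hs]; exact h.lower f⟩

end

theorem hasFrameBounds_affine {d τ : Type*} [Fintype d] [Countable τ] [DecidableEq d]
    [DecidableEq (d → ℤ)]
    {p ψ : EuclideanSpace ℝ d → ℂ} (hpm : Measurable p) (h1 : Integrable p) (h2 : MemLp p 2)
    (hψ : ψ =ᵐ[volume] 𝓕⁻ p) (c : d → ℝ) (hc : ∀ i, 0 < c i)
    (B R : τ → EuclideanSpace ℝ d ≃L[ℝ] EuclideanSpace ℝ d)
    (hBR : ∀ t ξ x, inner ℝ (R t ξ) (B t x) = inner ℝ ξ x) {D : τ → ℝ} (hD : ∀ t, 0 < D t)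
    (hR : ∀ t, Measure.map (R t) volume = ENNReal.ofReal (D t) • volume)
    {s : τ → ℂ} (hs : ∀ t, ‖s t‖ ^ 2 = D t) {C ε C₂ : ℝ≥0∞} (hCt : C ≠ ∞) (hεt : ε ≠ ∞)
    (hC₂t : C₂ ≠ ∞)
    (hC : ∀ x ∈ unitBox d, ∑' l : d → ℤ, ‖p (unscale c (x + latt l))‖ₑ ≤ C)
    (hε : ∀ x ∈ unitBox d, ∑' l : d → ℤ, (if l = 0 then 0 else ‖p (unscale c (x + latt l))‖ₑ) ≤ ε)
    (hC₂ : ∀ ξ, ∑' t, ‖p (R t ξ)‖ₑ ≤ C₂) {G : Set (EuclideanSpace ℝ d)} {a : ℝ} (ha : 0 ≤ a)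
    (hG : ∀ ξ ∈ G, ∃ t, sampleEquiv c hc (R t) ξ ∈ unitBox d ∧ a ≤ ‖p (R t ξ)‖) :
    HasFrameBounds (fun (i : τ × (d → ℤ)) x => s i.1 * ψ (B i.1 x - scaledPoint c i.2)) G
      (∏ i, c i)⁻¹ (C.toReal * C₂.toReal) (a ^ 2) (2 * (ε.toReal * C₂.toReal)) := by
  lift C to ℝ≥0 using hCt
  lift ε to ℝ≥0 using hεt
  lift C₂ to ℝ≥0 using hC₂t
  obtain ⟨hg, h⟩ := affine_family_estimates hpm h1 h2 hψ c hc B R hBR hD hR hs hC hε hC₂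
  have hκ : 0 ≤ (∏ i, c i)⁻¹ := inv_nonneg.2 (Finset.prod_nonneg fun i _ => (hc i).le)
  have hfin : ∀ f : Lp (α := EuclideanSpace ℝ d) ℂ 2 volume,
      frameSum (V := EuclideanSpace ℝ d) hg f ≠ ∞ := fun f =>
    ((h f).1.trans_lt (ENNReal.mul_lt_top ENNReal.ofReal_lt_top (ENNReal.mul_lt_top ENNReal.coe_lt_top
      (ENNReal.mul_lt_top ENNReal.coe_lt_top (lintegral_fourierFun_ne_top f).lt_top)))).ne
  have hN : ∀ f : Lp (α := EuclideanSpace ℝ d) ℂ 2 volume,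
      (∫⁻ ξ, ‖fourierFun (V := EuclideanSpace ℝ d) f ξ‖ₑ ^ 2).toReal = ‖f‖ ^ 2 := fun f => by
    rw [← energy_univ, energy, setLIntegral_univ]
  refine ⟨hg, hfin, fun f => ?_, fun f E hE hEG => ?_⟩
  · have h3 := ENNReal.toReal_mono (by
      have := lintegral_fourierFun_ne_top (V := EuclideanSpace ℝ d) f
      finiteness) (h f).1
    simp only [ENNReal.toReal_mul, ENNReal.toReal_ofReal hκ, ENNReal.coe_toReal, hN] at h3
    simpa only [ENNReal.coe_toReal, mul_assoc] using h3
  · have h3 := (h f).2 E hE a.toNNReal (fun ξ hξ => by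
      obtain ⟨t, ht, hat⟩ := hG ξ (hEG hξ)
      refine ⟨t, ht, ?_⟩
      rw [← ofReal_norm]
      exact ENNReal.ofReal_le_ofReal hat)
    have hI := lintegral_fourierFun_ne_top (V := EuclideanSpace ℝ d) f
    have hF := hfin f
    have h4 := ENNReal.toReal_mono (by finiteness) h3
    rw [ENNReal.toReal_add (by finiteness) (by finiteness)] at h4
    simp only [ENNReal.toReal_mul, ENNReal.toReal_ofReal hκ, ENNReal.coe_toReal, hN,
      ENNReal.toReal_pow, Real.coe_toNNReal a ha, ENNReal.toReal_ofNat] at h4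
    refine le_trans h4 (le_of_eq ?_)
    simp only [ENNReal.coe_toReal]
    ring

end RealEstimates

/-! ### The shear and scaling matrices and their inverse transposes. -/

section Matrices

theorem act_apply (M : Matrix (Fin 2) (Fin 2) ℝ) (x : Plane) (i : Fin 2) :
    act M x i = M i 0 * x 0 + M i 1 * x 1 := by
  fin_cases i <;> simp [act, Matrix.toLpLin_apply]

theorem toEuclideanLin_eq_toLin (M : Matrix (Fin 2) (Fin 2) ℝ) : Matrix.toEuclideanLin M =
    Matrix.toLin (PiLp.basisFun 2 ℝ (Fin 2)) (PiLp.basisFun 2 ℝ (Fin 2)) M := by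
  rw [← Matrix.toLpLin_eq_toLin]

/-- An invertible matrix as a continuous linear equivalence of the plane. -/
noncomputable def matEquiv (M : Matrix (Fin 2) (Fin 2) ℝ) (hM : M.det ≠ 0) : Plane ≃L[ℝ] Plane :=
  (LinearEquiv.ofIsUnitDet (f := Matrix.toEuclideanLin M) (v := PiLp.basisFun 2 ℝ (Fin 2))
    (v' := PiLp.basisFun 2 ℝ (Fin 2)) (by
      rw [toEuclideanLin_eq_toLin, LinearMap.toMatrix_toLin]
      exact isUnit_iff_ne_zero.2 hM)).toContinuousLinearEquiv

theorem matEquiv_apply (M : Matrix (Fin 2) (Fin 2) ℝ) (hM : M.det ≠ 0) (x : Plane) :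
    matEquiv M hM x = act M x := rfl

theorem map_matEquiv (M : Matrix (Fin 2) (Fin 2) ℝ) (hM : M.det ≠ 0) :
    Measure.map (matEquiv M hM) volume = ENNReal.ofReal |M.det|⁻¹ • (volume : Measure Plane) := by
  have hdet : LinearMap.det (Matrix.toEuclideanLin M) = M.det := by
    rw [toEuclideanLin_eq_toLin, LinearMap.det_toLin]
  have := Measure.map_linearMap_addHaar_eq_smul_addHaar (volume : Measure Plane)
    (f := Matrix.toEuclideanLin M) (by rwa [hdet])
  rw [hdet, abs_inv] at this
  exact this

theorem inner_matEquiv {M N : Matrix (Fin 2) (Fin 2) ℝ} (hM : M.det ≠ 0) (hN : N.det ≠ 0)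
    (h : M.transpose * N = 1) (ξ x : Plane) :
    inner ℝ (matEquiv M hM ξ) (matEquiv N hN x) = inner ℝ ξ x := by
  have h00 := congrFun (congrFun h 0) 0
  have h01 := congrFun (congrFun h 0) 1
  have h10 := congrFun (congrFun h 1) 0
  have h11 := congrFun (congrFun h 1) 1
  simp [Matrix.mul_apply, Fin.sum_univ_two] at h00 h01 h10 h11
  simp only [matEquiv_apply, PiLp.inner_apply, Fin.sum_univ_two, act_apply, RCLike.inner_apply,
    conj_trivial]
  linear_combination (ξ 0 * x 0) * h00 + (ξ 0 * x 1) * h01 + (ξ 1 * x 0) * h10 + (ξ 1 * x 1) * h11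

/-- The matrix of the coordinate swap. -/
def swapMat : Matrix (Fin 2) (Fin 2) ℝ := !![0, 1; 1, 0]

/-- The matrix `S_{-k} A_{2^j}`. -/
noncomputable def coneMat (j : ℕ) (k : ℤ) : Matrix (Fin 2) (Fin 2) ℝ :=
  shearMat (-(k : ℝ)) * scaleMat ((2 : ℝ) ^ j)

/-- The transposed inverse of `coneMat`. -/
noncomputable def dualMat (j : ℕ) (k : ℤ) : Matrix (Fin 2) (Fin 2) ℝ :=
  !![((2 : ℝ) ^ j)⁻¹, 0; k * ((2 : ℝ) ^ j)⁻¹, (√((2 : ℝ) ^ j))⁻¹]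

theorem det_coneMat (j : ℕ) (k : ℤ) : (coneMat j k).det = 2 ^ j * √((2 : ℝ) ^ j) := by
  rw [coneMat, Matrix.det_mul, shearMat, scaleMat]
  simp [Matrix.det_fin_two_of]

theorem det_dualMat (j : ℕ) (k : ℤ) : (dualMat j k).det = (2 ^ j * √((2 : ℝ) ^ j))⁻¹ := by
  rw [dualMat, Matrix.det_fin_two_of, mul_inv]; ring

theorem dualMat_transpose_mul_coneMat (j : ℕ) (k : ℤ) :
    (dualMat j k).transpose * coneMat j k = 1 := by
  have h1 : √((2 : ℝ) ^ j) ≠ 0 := by positivity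
  have h2 : (2 : ℝ) ^ j ≠ 0 := by positivity
  ext i l
  fin_cases i <;> fin_cases l <;>
    simp [dualMat, coneMat, shearMat, scaleMat, Matrix.mul_apply, Fin.sum_univ_two, h1, h2]
  field_simp
  ring

end Matrices

/-! ### Covering of the cone and bounds for the shearlet family. -/

section ShearletFamily

open scoped ENNReal NNReal

theorem act_mul (M N : Matrix (Fin 2) (Fin 2) ℝ) (x : Plane) : act (M * N) x = act M (act N x) := by
  ext i
  simp only [act_apply, Matrix.mul_apply, Fin.sum_univ_two]
  ring

theorem act_dualMat_zero (j : ℕ) (k : ℤ) (ξ : Plane) :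
    act (dualMat j k) ξ 0 = ((2 : ℝ) ^ j)⁻¹ * ξ 0 := by
  simp [act_apply, dualMat]

theorem act_dualMat_one (j : ℕ) (k : ℤ) (ξ : Plane) :
    act (dualMat j k) ξ 1 = k * (((2 : ℝ) ^ j)⁻¹ * ξ 0) + (√((2 : ℝ) ^ j))⁻¹ * ξ 1 := by
  simp [act_apply, dualMat, mul_assoc]

/-- The pairs `(j, k)` with `|k| ≤ ⌈2^{j/2}⌉`. -/
abbrev ScaleIndex : Type := {p : ℕ × ℤ // |p.2| ≤ ⌈(2 : ℝ) ^ ((p.1 : ℝ) / 2)⌉}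

theorem sqrt_two_pow (j : ℕ) : √((2 : ℝ) ^ j) = (2 : ℝ) ^ ((j : ℝ) / 2) := by
  rw [Real.sqrt_eq_rpow, ← Real.rpow_natCast, ← Real.rpow_mul two_pos.le]
  congr 1; ring

/-- The scale `j` normalises the first coordinate and rounding the rescaled slope gives the shear.
The slope is at most one, so the rounded value respects the bound on `k`. -/
theorem exists_scaleIndex {ξ : Plane} (h0 : 1 / 16 ≤ |ξ 0|) (h1 : |ξ 1| ≤ |ξ 0|) :
    ∃ t : ScaleIndex, 1 / 16 ≤ |act (dualMat t.1.1 t.1.2) ξ 0| ∧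
      |act (dualMat t.1.1 t.1.2) ξ 0| ≤ 1 / 8 ∧ |act (dualMat t.1.1 t.1.2) ξ 1| ≤ 1 / 16 := by
  obtain ⟨j, hj1, hj2⟩ := exists_nat_pow_near (x := 16 * |ξ 0|) (y := (2 : ℝ)) (by linarith)
    (by norm_num)
  have hpos : (0 : ℝ) < |ξ 0| := by linarith
  have hne : ξ 0 ≠ 0 := abs_pos.1 hpos
  have hp : (0 : ℝ) < 2 ^ j := by positivity
  have hs : 0 < √((2 : ℝ) ^ j) := Real.sqrt_pos.2 hp
  have hss : √((2 : ℝ) ^ j) * √((2 : ℝ) ^ j) = 2 ^ j := Real.mul_self_sqrt hp.le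
  set q : ℝ := √((2 : ℝ) ^ j) * ξ 1 / ξ 0 with hq
  have hqle : |q| ≤ √((2 : ℝ) ^ j) := by
    rw [hq, abs_div, abs_mul, abs_of_pos hs, div_le_iff₀ hpos]
    gcongr
  have hr := abs_sub_round q
  have hk : |-round q| ≤ ⌈(2 : ℝ) ^ ((j : ℝ) / 2)⌉ := by
    rw [← sqrt_two_pow, abs_neg]
    have h2 := Int.le_ceil (√((2 : ℝ) ^ j))
    obtain ⟨h3, h4⟩ := abs_le.1 hr
    obtain ⟨h5, h6⟩ := abs_le.1 hqle
    refine abs_le.2 ⟨?_, ?_⟩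
    · have : -((⌈√((2 : ℝ) ^ j)⌉ : ℤ) : ℝ) - 1 < round q := by linarith
      have : -⌈√((2 : ℝ) ^ j)⌉ - 1 < round q := by exact_mod_cast this
      omega
    · have : (round q : ℝ) < (⌈√((2 : ℝ) ^ j)⌉ : ℤ) + 1 := by linarith
      have : round q < ⌈√((2 : ℝ) ^ j)⌉ + 1 := by exact_mod_cast this
      omega
  have e0 : |((2 : ℝ) ^ j)⁻¹ * ξ 0| = |ξ 0| / 2 ^ j := by
    rw [abs_mul, abs_of_pos (inv_pos.2 hp), inv_mul_eq_div]
  have h8 : |ξ 0| / 2 ^ j ≤ 1 / 8 := by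
    rw [div_le_iff₀ hp]
    rw [pow_succ] at hj2
    linarith
  refine ⟨⟨(j, -round q), hk⟩, ?_, ?_, ?_⟩
  · rw [act_dualMat_zero, e0, le_div_iff₀ hp]
    linarith
  · rwa [act_dualMat_zero, e0]
  · rw [act_dualMat_one]
    -- The sheared second coordinate is the first one, at most `1/8`, times a rounding error of at
    -- most `1/2`.
    have e1 : ((-round q : ℤ) : ℝ) * (((2 : ℝ) ^ j)⁻¹ * ξ 0) + (√((2 : ℝ) ^ j))⁻¹ * ξ 1 =
        (((2 : ℝ) ^ j)⁻¹ * ξ 0) * (q - round q) := by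
      have : (√((2 : ℝ) ^ j))⁻¹ * ξ 1 = (((2 : ℝ) ^ j)⁻¹ * ξ 0) * q := by
        have h9 : (√((2 : ℝ) ^ j))⁻¹ = ((2 : ℝ) ^ j)⁻¹ * √((2 : ℝ) ^ j) := by
          rw [eq_inv_mul_iff_mul_eq₀ hp.ne', ← div_eq_mul_inv, div_eq_iff hs.ne', hss]
        rw [hq, h9]; field_simp
      rw [this]; push_cast; ring
    rw [e1, abs_mul, e0]
    calc _ ≤ 1 / 8 * (1 / 2 : ℝ) := by gcongr
      _ = 1 / 16 := by norm_num

variable {K L : ℕ} {m₀ m₁ : ℝ → ℂ}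

/-- At fixed `j` the second coordinates form an arithmetic progression in `k` of step `t = 2⁻ʲ ξ₁`;
sum over `k` first, then over the dyadic `t`. On the line `ξ₁ = 0` every term vanishes because of
`m₁`. -/
theorem tsum_enorm_shearletHat_le (h : IsLowPass K L m₀) (h1 : IsBandPass m₀ m₁) (hL : 1 ≤ L)
    (hK : L + 5 ≤ K) (ξ : Plane) :
    ∑' t : ScaleIndex, ‖shearletHat m₀ m₁ (act (dualMat t.1.1 t.1.2) ξ)‖ₑ ≤
      ENNReal.ofReal (shearletConst K L) * (intMass * dyadicMass) := by
  have hA := shearletConst_pos K L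
  refine (ENNReal.tsum_comp_le_tsum_of_injective Subtype.val_injective
    fun p : ℕ × ℤ => ‖shearletHat m₀ m₁ (act (dualMat p.1 p.2) ξ)‖ₑ).trans ?_
  rw [ENNReal.tsum_prod']
  have hb : ∀ (j : ℕ) (k : ℤ), ‖shearletHat m₀ m₁ (act (dualMat j k) ξ)‖ₑ ≤
      ENNReal.ofReal (shearletConst K L * (min 1 (|((2 : ℝ) ^ j)⁻¹ * ξ 0| ^ 3) *
        decay (((2 : ℝ) ^ j)⁻¹ * ξ 0))) * ENNReal.ofReal (decay
          (k * (((2 : ℝ) ^ j)⁻¹ * ξ 0) + (√((2 : ℝ) ^ j))⁻¹ * ξ 1)) := by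
    intro j k
    have := decay_nonneg (((2 : ℝ) ^ j)⁻¹ * ξ 0)
    rw [← ENNReal.ofReal_mul (by positivity), ← ofReal_norm]
    refine ENNReal.ofReal_le_ofReal ((norm_shearletHat_le h h1 hL hK _).trans (le_of_eq ?_))
    rw [act_dualMat_zero, act_dualMat_one]
    ring
  rcases eq_or_ne (ξ 0) 0 with h0 | h0
  · refine (ENNReal.tsum_le_tsum fun j => ENNReal.tsum_le_tsum fun k => hb j k).trans ?_
    simp [h0]
  have hterm : ∀ j : ℕ, ∑' k : ℤ, ‖shearletHat m₀ m₁ (act (dualMat j k) ξ)‖ₑ ≤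
      ENNReal.ofReal (shearletConst K L) * (intMass *
        ENNReal.ofReal (min (((2 : ℝ) ^ j)⁻¹ * |ξ 0|) (((2 : ℝ) ^ j)⁻¹ * |ξ 0|)⁻¹)) := by
    intro j
    have ht : ((2 : ℝ) ^ j)⁻¹ * ξ 0 ≠ 0 := by positivity
    refine (ENNReal.tsum_le_tsum (hb j)).trans ?_
    rw [ENNReal.tsum_mul_left]
    refine (mul_le_mul_right (tsum_decay_arith_le _ _ ht) _).trans ?_
    have e : |((2 : ℝ) ^ j)⁻¹ * ξ 0| = ((2 : ℝ) ^ j)⁻¹ * |ξ 0| := by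
      rw [abs_mul, abs_of_pos (by positivity)]
    have := min_pow_mul_decay_le ht
    have hd := decay_nonneg (((2 : ℝ) ^ j)⁻¹ * ξ 0)
    rw [← mul_assoc, mul_comm intMass, ← mul_assoc, ← ENNReal.ofReal_mul (by positivity),
      ← mul_assoc (ENNReal.ofReal _), ← ENNReal.ofReal_mul hA.le, ← e,
      mul_assoc (shearletConst K L), mul_assoc (shearletConst K L)]
    exact mul_le_mul_left (ENNReal.ofReal_le_ofReal (mul_le_mul_of_nonneg_left this hA.le)) _
  refine (ENNReal.tsum_le_tsum hterm).trans ?_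
  rw [ENNReal.tsum_mul_left, ENNReal.tsum_mul_left]
  gcongr
  exact tsum_min_dyadic_le (abs_pos.2 h0)

theorem norm_sq_scale (j : ℕ) :
    ‖(((2 : ℝ) ^ (3 * (j : ℝ) / 4) : ℝ) : ℂ)‖ ^ 2 = 2 ^ j * √((2 : ℝ) ^ j) := by
  rw [Complex.norm_real, Real.norm_of_nonneg (by positivity), ← Real.rpow_natCast, ← Real.rpow_mul
    two_pos.le, sqrt_two_pow, ← Real.rpow_natCast, ← Real.rpow_add two_pos]
  congr 1; push_cast; ring

theorem hasFrameBounds_of_decay {τ : Type*} [Countable τ] {p ψ : Plane → ℂ} (hpm : Measurable p)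
    {A : ℝ} (hA : 0 ≤ A) (hp : ∀ ξ, ‖p ξ‖ ≤ A * (decay (ξ 0) * decay (ξ 1)))
    (hψ : ψ =ᵐ[volume] 𝓕⁻ p) {c : Fin 2 → ℝ} (hc : ∀ i, 0 < c i) {δ : ℝ} (hcδ : ∀ i, c i ≤ δ)
    (hδ : δ ≤ 1) (B R : τ → Plane ≃L[ℝ] Plane)
    (hBR : ∀ t ξ x, inner ℝ (R t ξ) (B t x) = inner ℝ ξ x) {D : τ → ℝ} (hD : ∀ t, 0 < D t)
    (hR : ∀ t, Measure.map (R t) volume = ENNReal.ofReal (D t) • volume)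
    {s : τ → ℂ} (hs : ∀ t, ‖s t‖ ^ 2 = D t) {C₂ : ℝ≥0∞} (hC₂t : C₂ ≠ ∞)
    (hC₂ : ∀ ξ, ∑' t, ‖p (R t ξ)‖ₑ ≤ C₂) {G : Set Plane} {a : ℝ} (ha : 0 ≤ a)
    (hG : ∀ ξ ∈ G, ∃ t, (∀ i, |R t ξ i| ≤ 1 / 4) ∧ a ≤ ‖p (R t ξ)‖) :
    HasFrameBounds (fun (i : τ × (Fin 2 → ℤ)) x => s i.1 * ψ (B i.1 x - scaledPoint c i.2)) G
      (∏ i, c i)⁻¹ ((A + A * 2 * intMass.toReal ^ 2) * C₂.toReal) (a ^ 2)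
      (4 * A * intMass.toReal ^ 2 * C₂.toReal * δ) := by
  have hδ0 : 0 < δ := (hc 0).trans_le (hcδ 0)
  have hI := intMass_ne_top
  obtain ⟨h1, h2⟩ := integrable_and_memLp_plane hpm hA hp
  have key := hasFrameBounds_affine hpm h1 h2 hψ c hc B R hBR hD hR hs
    (C := ENNReal.ofReal A + ENNReal.ofReal (A * 2) * intMass ^ 2)
    (ε := ENNReal.ofReal (A * (2 * δ)) * intMass ^ 2) (by finiteness) (by finiteness) hC₂t
    (fun x hx => tsum_full_le hA hp hc hcδ hδ hx) (fun x hx => tsum_tail_le hA hp hc hcδ hδ hx)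
    hC₂ ha (G := G) (fun ξ hξ => by
      obtain ⟨t, ht, hat⟩ := hG ξ hξ
      refine ⟨t, fun i => ?_, hat⟩
      rw [sampleEquiv_apply]
      have h3 : |c i * R t ξ i| ≤ 1 / 4 := by
        rw [abs_mul, abs_of_pos (hc i)]
        exact (mul_le_of_le_one_left (abs_nonneg _) ((hcδ i).trans hδ)).trans (ht i)
      obtain ⟨h4, h5⟩ := abs_le.1 h3
      exact ⟨by linarith, by linarith⟩)
  have e1 : (ENNReal.ofReal A + ENNReal.ofReal (A * 2) * intMass ^ 2).toReal =
      A + A * 2 * intMass.toReal ^ 2 := by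
    rw [ENNReal.toReal_add (by finiteness) (by finiteness), ENNReal.toReal_mul, ENNReal.toReal_pow,
      ENNReal.toReal_ofReal hA, ENNReal.toReal_ofReal (by positivity)]
  have e2 : 2 * ((ENNReal.ofReal (A * (2 * δ)) * intMass ^ 2).toReal * C₂.toReal) =
      4 * A * intMass.toReal ^ 2 * C₂.toReal * δ := by
    rw [ENNReal.toReal_mul, ENNReal.toReal_pow, ENNReal.toReal_ofReal (by positivity)]
    ring
  rwa [e1, e2] at key

/-- The cone of frequencies resolved by the horizontal shearlets. -/
def wideCone : Set Plane := {ξ | 1 / 16 ≤ |ξ 0| ∧ |ξ 1| ≤ |ξ 0|}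

/-- The orthogonal matrix `N` treats both cones at once: the identity gives the horizontal
shearlets, the coordinate swap the vertical ones. `B` and `e` are chosen before `c₁` and `c₂`, which
allows `c₁` to be made small afterwards. The lower constant has exponent `3K`, a factor `2^(-K)`
from each of `m₁` and the two values of the scaling function. -/
theorem exists_hasFrameBounds_shearlet (h : IsLowPass K L m₀) (h1 : IsBandPass m₀ m₁) (hL : 1 ≤ L)
    (hK : L + 5 ≤ K) {ψ : Plane → ℂ} (hψ : ψ =ᵐ[volume] 𝓕⁻ (shearletHat m₀ m₁))
    {N : Matrix (Fin 2) (Fin 2) ℝ} (hN : N.transpose * N = 1) :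
    ∃ B e : ℝ, 0 ≤ B ∧ 0 ≤ e ∧ ∀ c₁ c₂ : ℝ, 0 < c₂ → c₂ ≤ c₁ → c₁ ≤ 1 →
      HasFrameBounds (fun (i : ScaleIndex × (Fin 2 → ℤ)) x =>
        (((2 : ℝ) ^ (3 * (i.1.1.1 : ℝ) / 4) : ℝ) : ℂ) *
          ψ (act (coneMat i.1.1.1 i.1.1.2 * N) x - scaledPoint ![c₁, c₂] i.2))
        (act N ⁻¹' wideCone) (c₁ * c₂)⁻¹ B ((((1 : ℝ) / 2) ^ (3 * K)) ^ 2) (e * c₁) := by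
  have hA := (shearletConst_pos K L).le
  have hdet : N.det ^ 2 = 1 := by
    have := congrArg Matrix.det hN
    rwa [Matrix.det_mul, Matrix.det_transpose, Matrix.det_one, ← sq] at this
  have habs : |N.det| = 1 := by
    rcases sq_eq_one_iff.1 hdet with h2 | h2 <;> simp [h2]
  have hN0 : N.det ≠ 0 := fun h0 => by simp [h0] at habs
  have hD : ∀ j : ℕ, 0 < 2 ^ j * √((2 : ℝ) ^ j) := fun j => by positivity
  have hB0 : ∀ t : ScaleIndex, (coneMat t.1.1 t.1.2 * N).det ≠ 0 := fun t => by
    rw [Matrix.det_mul, det_coneMat]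
    exact mul_ne_zero (hD _).ne' hN0
  have hR0 : ∀ t : ScaleIndex, (dualMat t.1.1 t.1.2 * N).det ≠ 0 := fun t => by
    rw [Matrix.det_mul, det_dualMat]
    exact mul_ne_zero (inv_ne_zero (hD _).ne') hN0
  have hI := intMass_ne_top
  have hJ := dyadicMass_ne_top
  set C₂ := ENNReal.ofReal (shearletConst K L) * (intMass * dyadicMass) with hC₂
  refine ⟨(shearletConst K L + shearletConst K L * 2 * intMass.toReal ^ 2) * C₂.toReal,
    4 * shearletConst K L * intMass.toReal ^ 2 * C₂.toReal, by positivity, by positivity,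
    fun c₁ c₂ h2 h12 hc1 => ?_⟩
  have hprod : (∏ i, (![c₁, c₂] : Fin 2 → ℝ) i) = c₁ * c₂ := by simp [Fin.prod_univ_two]
  rw [← hprod]
  refine hasFrameBounds_of_decay (τ := ScaleIndex) (measurable_shearletHat h h1) hA
    (norm_shearletHat_le' h h1 hL hK) hψ (c := ![c₁, c₂])
    (Fin.forall_fin_two.2 ⟨h2.trans_le h12, h2⟩) (δ := c₁) (Fin.forall_fin_two.2 ⟨le_rfl, h12⟩) hc1
    (fun t => matEquiv _ (hB0 t)) (fun t => matEquiv _ (hR0 t))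
    (fun t => inner_matEquiv _ _ ?_) (D := fun t => 2 ^ t.1.1 * √((2 : ℝ) ^ t.1.1))
    (fun t => hD _) (fun t => ?_) (fun t => norm_sq_scale _)
    (C₂ := C₂) (by finiteness)
    (fun ξ => ?_) (by positivity) (fun ξ hξ => ?_)
  · rw [Matrix.transpose_mul, Matrix.mul_assoc, ← Matrix.mul_assoc _ (coneMat _ _),
      dualMat_transpose_mul_coneMat, Matrix.one_mul, hN]
  · rw [map_matEquiv, Matrix.det_mul, abs_mul, habs, mul_one, det_dualMat, abs_inv, inv_inv,
      abs_of_pos (hD _)]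
  · simp only [matEquiv_apply, act_mul]
    exact tsum_enorm_shearletHat_le h h1 hL hK _
  · obtain ⟨t, ht1, ht2, ht3⟩ := exists_scaleIndex hξ.1 hξ.2
    refine ⟨t, ?_, ?_⟩
    · simp only [matEquiv_apply, act_mul]
      exact Fin.forall_fin_two.2 ⟨ht2.trans (by norm_num), ht3.trans (by norm_num)⟩
    · simp only [matEquiv_apply, act_mul]
      set η := act (dualMat t.1.1 t.1.2) (act N ξ)
      have g1 := h1.le_norm h hL ht1 ht2
      have g2 := h.le_norm_scalingHat hL (ξ := η 0) (by linarith)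
      have g3 := h.le_norm_scalingHat hL (ξ := 2 * η 1) (by rw [abs_mul, abs_two]; linarith)
      rw [shearletHat, norm_mul, norm_mul, show 3 * K = K + K + K by ring, pow_add, pow_add]
      gcongr

end ShearletFamily

/-! ### The three parts of the system as affine families. -/

section SystemParts

open scoped ENNReal NNReal

variable {K L : ℕ} {m₀ m₁ : ℝ → ℂ}

theorem swap_eq (ψ : Plane → ℂ) (x : Plane) : swap ψ x = ψ (act swapMat x) := by
  unfold swap
  congr 1
  ext i
  fin_cases i <;> simp [act_apply, swapMat]

theorem swapMat_transpose_mul : swapMat.transpose * swapMat = 1 := by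
  ext i l
  fin_cases i <;> fin_cases l <;> simp [swapMat, Matrix.mul_apply, Fin.sum_univ_two]

/-- The indices of the horizontal shearlets as pairs of a scale index and a translation. -/
def coneEquiv : ConeIndex ≃ ScaleIndex × (Fin 2 → ℤ) where
  toFun i := (⟨(i.1.1, i.1.2.1), i.2⟩, ![i.1.2.2.1, i.1.2.2.2])
  invFun t := ⟨(t.1.1.1, t.1.1.2, (t.2 0, t.2 1)), t.1.2⟩
  left_inv i := by rfl
  right_inv t := by
    refine Prod.ext rfl (funext fun i => ?_)
    fin_cases i <;> rfl

/-- The indices of the vertical shearlets as pairs of a scale index and a swapped translation. -/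
def coneEquiv' : ConeIndex ≃ ScaleIndex × (Fin 2 → ℤ) where
  toFun i := (⟨(i.1.1, i.1.2.1), i.2⟩, ![i.1.2.2.2, i.1.2.2.1])
  invFun t := ⟨(t.1.1.1, t.1.1.2, (t.2 1, t.2 0)), t.1.2⟩
  left_inv i := by rfl
  right_inv t := by
    refine Prod.ext rfl (funext fun i => ?_)
    fin_cases i <;> rfl

theorem horizPart_eq (c₁ c₂ : ℝ) (ψ : Plane → ℂ) (i : ConeIndex) :
    horizPart c₁ c₂ ψ i = fun x =>
      (((2 : ℝ) ^ (3 * ((coneEquiv i).1.1.1 : ℝ) / 4) : ℝ) : ℂ) *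
        ψ (act (coneMat (coneEquiv i).1.1.1 (coneEquiv i).1.1.2 * 1) x -
          scaledPoint ![c₁, c₂] (coneEquiv i).2) := by
  obtain ⟨⟨j, k, m₁, m₂⟩, hi⟩ := i
  have e : coneEquiv ⟨(j, k, m₁, m₂), hi⟩ = (⟨(j, k), hi⟩, ![m₁, m₂]) := rfl
  funext x
  simp only [e, horizPart, coneMat, Matrix.mul_one]
  congr 2
  ext l
  fin_cases l <;> simp [act_apply, scaledPoint, sampMat, intVec]

theorem vertPart_swap_eq (c₁ c₂ : ℝ) (ψ : Plane → ℂ) (i : ConeIndex) :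
    vertPart c₁ c₂ (swap ψ) i = fun x =>
      (((2 : ℝ) ^ (3 * ((coneEquiv' i).1.1.1 : ℝ) / 4) : ℝ) : ℂ) *
        ψ (act (coneMat (coneEquiv' i).1.1.1 (coneEquiv' i).1.1.2 * swapMat) x -
          scaledPoint ![c₁, c₂] (coneEquiv' i).2) := by
  obtain ⟨⟨j, k, m₁, m₂⟩, hi⟩ := i
  have e : coneEquiv' ⟨(j, k, m₁, m₂), hi⟩ = (⟨(j, k), hi⟩, ![m₂, m₁]) := rfl
  funext x
  simp only [e, vertPart, coneMat, swap_eq]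
  congr 2
  ext l
  fin_cases l <;> simp [act_apply, scaledPoint, sampMat', intVec, swapMat, shearMat, scaleMat,
    scaleMat', Matrix.mul_apply, Fin.sum_univ_two]

theorem lowPart_eq (c₁ : ℝ) (φ : Plane → ℂ) (m : ℤ × ℤ) :
    lowPart c₁ φ m = fun x => 1 * φ (x - scaledPoint ![c₁, c₁] ((finTwoArrowEquiv ℤ).symm m)) := by
  funext x
  rw [lowPart, one_mul]
  congr 2
  ext l
  fin_cases l <;> simp [scaledPoint, intVec]

/-- The coordinates of the plane as a measurable equivalence. -/
noncomputable def coordEquiv : Plane ≃ᵐ ℝ × ℝ :=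
  (MeasurableEquiv.toLp 2 (Fin 2 → ℝ)).symm.trans MeasurableEquiv.finTwoArrow

theorem measurePreserving_coordEquiv : MeasurePreserving coordEquiv :=
  (volume_preserving_finTwoArrow ℝ).comp
    (EuclideanSpace.volume_preserving_symm_measurableEquiv_toLp (Fin 2))

theorem quasiMeasurePreserving_coord (i : Fin 2) :
    Measure.QuasiMeasurePreserving (fun x : Plane => x i) := by
  fin_cases i
  · exact Measure.quasiMeasurePreserving_fst.comp
      measurePreserving_coordEquiv.quasiMeasurePreserving
  · exact Measure.quasiMeasurePreserving_snd.comp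
      measurePreserving_coordEquiv.quasiMeasurePreserving

theorem fourierInv_tensor (u v : ℝ → ℂ) (x : Plane) :
    𝓕⁻ (fun ξ : Plane => u (ξ 0) * v (ξ 1)) x = 𝓕⁻ u (x 0) * 𝓕⁻ v (x 1) := by
  have hprod : ∀ g₁ g₂ : ℝ → ℂ, (∫ a, g₁ a) * ∫ b, g₂ b = ∫ z : ℝ × ℝ, g₁ z.1 * g₂ z.2 :=
    fun g₁ g₂ => (integral_prod_mul g₁ g₂).symm
  rw [Real.fourierInv_eq', Real.fourierInv_eq', Real.fourierInv_eq', hprod,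
    ← measurePreserving_coordEquiv.integral_comp coordEquiv.measurableEmbedding]
  refine integral_congr_ae (Filter.Eventually.of_forall fun ξ => ?_)
  have e0 : (coordEquiv ξ).1 = ξ 0 := rfl
  have e1 : (coordEquiv ξ).2 = ξ 1 := rfl
  simp only [e0, e1, smul_eq_mul, PiLp.inner_apply, Fin.sum_univ_two, RCLike.inner_apply,
    conj_trivial]
  rw [mul_mul_mul_comm, ← Complex.exp_add]
  congr 2
  push_cast
  ring

theorem tensor_ae_eq {φ : ℝ → ℂ} (hφ : φ =ᵐ[volume] 𝓕⁻ (scalingHat m₀)) :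
    tensor φ =ᵐ[volume] 𝓕⁻ (tensorHat m₀) := by
  filter_upwards [(quasiMeasurePreserving_coord 0).ae hφ, (quasiMeasurePreserving_coord 1).ae hφ]
    with x h0 h1
  unfold tensor tensorHat
  rw [fourierInv_tensor, h0, h1]

/-- The square of frequencies resolved by the translates of the scaling function. -/
def lowBox : Set Plane := {ξ | |ξ 0| ≤ 1 / 4 ∧ |ξ 1| ≤ 1 / 4}

theorem exists_hasFrameBounds_lowPart (h : IsLowPass K L m₀) (hL : 1 ≤ L) (hK : L + 5 ≤ K)
    {φ : ℝ → ℂ} (hφ : φ =ᵐ[volume] 𝓕⁻ (scalingHat m₀)) :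
    ∃ B e : ℝ, 0 ≤ B ∧ 0 ≤ e ∧ ∀ c₁ : ℝ, 0 < c₁ → c₁ ≤ 1 →
      HasFrameBounds (lowPart c₁ (tensor φ)) lowBox (c₁ * c₁)⁻¹ B ((((1 : ℝ) / 2) ^ (2 * K)) ^ 2)
        (e * c₁) := by
  set A : ℝ := (8 * 2 ^ K) ^ 2
  have hA : 0 ≤ A := by positivity
  have hb := h.norm_tensorHat_le hL hK
  set C₂ := ENNReal.ofReal A
  refine ⟨(A + A * 2 * intMass.toReal ^ 2) * C₂.toReal,
    4 * A * intMass.toReal ^ 2 * C₂.toReal, by positivity, by positivity, fun c₁ hc hc1 => ?_⟩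
  have hprod : (∏ i, (![c₁, c₁] : Fin 2 → ℝ) i) = c₁ * c₁ := by simp [Fin.prod_univ_two]
  have key := hasFrameBounds_of_decay (τ := Unit) h.measurable_tensorHat hA hb (tensor_ae_eq hφ)
    (c := ![c₁, c₁]) (Fin.forall_fin_two.2 ⟨hc, hc⟩) (δ := c₁) (Fin.forall_fin_two.2 ⟨le_rfl, le_rfl⟩)
    hc1 (fun _ => ContinuousLinearEquiv.refl ℝ Plane) (fun _ => ContinuousLinearEquiv.refl ℝ Plane)
    (fun _ _ _ => rfl) (D := fun _ => 1) (fun _ => one_pos)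
    (fun _ => by
      rw [ENNReal.ofReal_one, one_smul]
      exact Measure.map_id) (s := fun _ => 1) (fun _ => by simp)
    (C₂ := C₂) (by finiteness)
    (fun ξ => by
      rw [tsum_fintype, Finset.univ_unique, Finset.sum_singleton, ← ofReal_norm]
      refine ENNReal.ofReal_le_ofReal ((hb _).trans (mul_le_of_le_one_right hA ?_))
      exact mul_le_one₀ (decay_le_one _) (decay_nonneg _) (decay_le_one _))
    (G := lowBox) (a := (1 / 2) ^ (2 * K)) (by positivity)
    (fun ξ hξ => by
      refine ⟨(), Fin.forall_fin_two.2 hξ, ?_⟩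
      have g1 := h.le_norm_scalingHat hL hξ.1
      have g2 := h.le_norm_scalingHat hL hξ.2
      rw [ContinuousLinearEquiv.refl_apply, tensorHat, norm_mul, show 2 * K = K + K by ring, pow_add]
      gcongr)
  rw [← hprod]
  exact key.congr_equiv ((finTwoArrowEquiv ℤ).symm.trans (Equiv.punitProd _).symm)
    (fun m => lowPart_eq c₁ _ m)

theorem exists_hasFrameBounds_horizPart (h : IsLowPass K L m₀) (h1 : IsBandPass m₀ m₁) (hL : 1 ≤ L)
    (hK : L + 5 ≤ K) {ψ : Plane → ℂ} (hψ : ψ =ᵐ[volume] 𝓕⁻ (shearletHat m₀ m₁)) :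
    ∃ B e : ℝ, 0 ≤ B ∧ 0 ≤ e ∧ ∀ c₁ c₂ : ℝ, 0 < c₂ → c₂ ≤ c₁ → c₁ ≤ 1 →
      HasFrameBounds (horizPart c₁ c₂ ψ) wideCone (c₁ * c₂)⁻¹ B ((((1 : ℝ) / 2) ^ (3 * K)) ^ 2)
        (e * c₁) := by
  obtain ⟨B, e, hB, he, H⟩ := exists_hasFrameBounds_shearlet h h1 hL hK hψ (N := 1) (by simp)
  refine ⟨B, e, hB, he, fun c₁ c₂ h2 h12 hc => ?_⟩
  have hact : act (1 : Matrix (Fin 2) (Fin 2) ℝ) ⁻¹' wideCone = wideCone := by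
    ext ξ
    simp [wideCone, act_apply]
  have := (H c₁ c₂ h2 h12 hc).congr_equiv coneEquiv (horizPart_eq c₁ c₂ ψ)
  rwa [hact] at this

/-- The cone of frequencies resolved by the vertical shearlets. -/
def wideCone' : Set Plane := {ξ | 1 / 16 ≤ |ξ 1| ∧ |ξ 0| ≤ |ξ 1|}

theorem exists_hasFrameBounds_vertPart (h : IsLowPass K L m₀) (h1 : IsBandPass m₀ m₁) (hL : 1 ≤ L)
    (hK : L + 5 ≤ K) {ψ : Plane → ℂ} (hψ : ψ =ᵐ[volume] 𝓕⁻ (shearletHat m₀ m₁)) :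
    ∃ B e : ℝ, 0 ≤ B ∧ 0 ≤ e ∧ ∀ c₁ c₂ : ℝ, 0 < c₂ → c₂ ≤ c₁ → c₁ ≤ 1 →
      HasFrameBounds (vertPart c₁ c₂ (swap ψ)) wideCone' (c₁ * c₂)⁻¹ B
        ((((1 : ℝ) / 2) ^ (3 * K)) ^ 2) (e * c₁) := by
  obtain ⟨B, e, hB, he, H⟩ := exists_hasFrameBounds_shearlet h h1 hL hK hψ swapMat_transpose_mul
  refine ⟨B, e, hB, he, fun c₁ c₂ h2 h12 hc => ?_⟩
  have hact : act swapMat ⁻¹' wideCone = wideCone' := by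
    ext ξ
    simp [wideCone, wideCone', act_apply, swapMat]
  have := (H c₁ c₂ h2 h12 hc).congr_equiv coneEquiv' (vertPart_swap_eq c₁ c₂ ψ)
  rwa [hact] at this

end SystemParts

/-! ### From frame bounds to frames, and supports of the system. -/

section Frames

open scoped ENNReal NNReal

variable {K L : ℕ} {m₀ m₁ : ℝ → ℂ}

theorem isFrameFor_of_frameSum {ι : Type} {V : Set L2Plane} {g : ι → Plane → ℂ}
    (hg : ∀ i, MemLp (g i) 2 (volume : Measure Plane)) {A B : ℝ} (hA : 0 < A)
    (hfin : ∀ f, frameSum (V := Plane) hg f ≠ ∞)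
    (hlo : ∀ f ∈ V, A * ‖f‖ ^ 2 ≤ (frameSum (V := Plane) hg f).toReal)
    (hup : ∀ f ∈ V, (frameSum (V := Plane) hg f).toReal ≤ B * ‖f‖ ^ 2) : IsFrameFor V g := by
  -- The maximum ensures `A ≤ B` even when `V` contains no nonzero function.
  refine ⟨hg, A, max A B, hA, le_max_left _ _, fun f hf => ?_⟩
  have e : ∀ i, (‖inner ℂ ((hg i).toLp (g i)) f‖ₑ ^ 2).toReal =
      ‖inner ℂ ((hg i).toLp (g i)) f‖ ^ 2 := fun i => by
    rw [ENNReal.toReal_pow, toReal_enorm]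
  have hs : (frameSum (V := Plane) hg f).toReal = ∑' i, ‖inner ℂ ((hg i).toLp (g i)) f‖ ^ 2 := by
    rw [frameSum, ENNReal.tsum_toReal_eq fun i => ENNReal.pow_ne_top enorm_ne_top]
    exact tsum_congr e
  refine ⟨(ENNReal.summable_toReal (hfin f)).congr fun i => (e i).symm, ?_, ?_⟩
  · rw [← hs]; exact hlo f hf
  · rw [← hs]
    exact (hup f hf).trans (mul_le_mul_of_nonneg_right (le_max_right _ _) (by positivity))

theorem measurableSet_wideCone : MeasurableSet wideCone := by
  have e : wideCone = {ξ | 1 / 16 ≤ |ξ 0|} ∩ {ξ | |ξ 1| ≤ |ξ 0|} := rfl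
  rw [e]
  exact (measurableSet_le (by fun_prop) (by fun_prop)).inter
    (measurableSet_le (by fun_prop) (by fun_prop))

theorem measurableSet_wideCone' : MeasurableSet wideCone' := by
  have e : wideCone' = {ξ | 1 / 16 ≤ |ξ 1|} ∩ {ξ | |ξ 0| ≤ |ξ 1|} := rfl
  rw [e]
  exact (measurableSet_le (by fun_prop) (by fun_prop)).inter
    (measurableSet_le (by fun_prop) (by fun_prop))

theorem measurableSet_lowBox : MeasurableSet lowBox := by
  have e : lowBox = {ξ | |ξ 0| ≤ 1 / 4} ∩ {ξ | |ξ 1| ≤ 1 / 4} := rfl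
  rw [e]
  exact (measurableSet_le (by fun_prop) (by fun_prop)).inter
    (measurableSet_le (by fun_prop) (by fun_prop))

theorem union_cones_eq_univ : wideCone ∪ (wideCone' ∪ lowBox) = Set.univ := by
  refine Set.eq_univ_of_forall fun ξ => ?_
  by_cases h0 : |ξ 0| ≤ 1 / 16 ∧ |ξ 1| ≤ 1 / 16
  · exact Or.inr (Or.inr ⟨by linarith [h0.1], by linarith [h0.2]⟩)
  rcases le_total |ξ 1| |ξ 0| with h | h
  · exact Or.inl ⟨by by_contra hc; exact h0 ⟨by linarith, by linarith⟩, h⟩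
  · exact Or.inr (Or.inl ⟨by by_contra hc; exact h0 ⟨by linarith, by linarith⟩, h⟩)

theorem horizCone_subset_wideCone : horizCone ⊆ wideCone := by
  rintro ξ ⟨h0, h1⟩
  refine ⟨by linarith, ?_⟩
  rwa [abs_div, div_le_one (by linarith)] at h1

/-- For such `f` all the energy lies in `wideCone`, so an error of at most half the main term can be
absorbed. -/
theorem isFrameFor_L2Cone {g : ConeIndex → Plane → ℂ} {κ B a e : ℝ} (hκ : 0 < κ) (ha : 0 < a)
    (hea : e ≤ a / 2) (h : HasFrameBounds g wideCone κ B a e) : IsFrameFor L2Cone g := by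
  refine isFrameFor_of_frameSum h.memLp (A := κ * a / 4) (B := κ * B) (by positivity) h.ne_top
    (fun f hf => ?_) (fun f _ => (h.upper f).trans (le_of_eq (by ring)))
  have hE : energy (V := Plane) wideCone f = ‖f‖ ^ 2 := energy_eq_norm_sq measurableSet_wideCone (by
    filter_upwards [hf] with ξ hξ hn using hξ fun hm => hn (horizCone_subset_wideCone hm))
  have h1 := h.lower f wideCone measurableSet_wideCone subset_rfl
  rw [hE] at h1
  have h2 : κ * (e * ‖f‖ ^ 2) ≤ κ * (a / 2 * ‖f‖ ^ 2) := by gcongr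
  linarith

/-- The three regions cover the plane, so their energies add up to at least `‖f‖²`, and the sum of
the three errors is absorbed. -/
theorem isFrameFor_univ_sum {ι₁ ι₂ ι₃ : Type} {g : ι₁ ⊕ ι₂ ⊕ ι₃ → Plane → ℂ} {κ κ₁ B₁ B₂ B₃ a a₁ e₁ e₂ e₃ : ℝ}
    (hκ : 0 < κ) (hκ₁ : 0 < κ₁) (hκκ : κ₁ ≤ κ) (ha : 0 < a) (haa : a ≤ a₁)
    (he : e₁ + e₂ + e₃ ≤ a / 2)
    (h₁ : HasFrameBounds (fun i => g (Sum.inl i)) lowBox κ₁ B₁ a₁ e₁)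
    (h₂ : HasFrameBounds (fun i => g (Sum.inr (Sum.inl i))) wideCone κ B₂ a e₂)
    (h₃ : HasFrameBounds (fun i => g (Sum.inr (Sum.inr i))) wideCone' κ B₃ a e₃) :
    IsFrameFor Set.univ g := by
  have hg : ∀ i, MemLp (g i) 2 (volume : Measure Plane) := by
    rintro (i | i | i)
    exacts [h₁.memLp i, h₂.memLp i, h₃.memLp i]
  have hS : ∀ f : Lp (α := Plane) ℂ 2 volume, frameSum (V := Plane) hg f =
      frameSum (V := Plane) h₁.memLp f + (frameSum (V := Plane) h₂.memLp f +
        frameSum (V := Plane) h₃.memLp f) := fun f => by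
    unfold frameSum
    rw [Summable.tsum_sum ENNReal.summable ENNReal.summable,
      Summable.tsum_sum ENNReal.summable ENNReal.summable]
  have hR : ∀ f : Lp (α := Plane) ℂ 2 volume, (frameSum (V := Plane) hg f).toReal =
      (frameSum (V := Plane) h₁.memLp f).toReal + ((frameSum (V := Plane) h₂.memLp f).toReal +
        (frameSum (V := Plane) h₃.memLp f).toReal) := fun f => by
    rw [hS, ENNReal.toReal_add (h₁.ne_top f) (ENNReal.add_ne_top.2 ⟨h₂.ne_top f, h₃.ne_top f⟩),
      ENNReal.toReal_add (h₂.ne_top f) (h₃.ne_top f)]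
  refine isFrameFor_of_frameSum hg (A := κ₁ * a / 4) (B := κ₁ * B₁ + (κ * B₂ + κ * B₃)) (by positivity)
    (fun f => ?_) (fun f _ => ?_) (fun f _ => ?_)
  · rw [hS]
    exact ENNReal.add_ne_top.2 ⟨h₁.ne_top f, ENNReal.add_ne_top.2 ⟨h₂.ne_top f, h₃.ne_top f⟩⟩
  · have l₁ := h₁.lower f _ measurableSet_lowBox subset_rfl
    have l₂ := h₂.lower f _ measurableSet_wideCone subset_rfl
    have l₃ := h₃.lower f _ measurableSet_wideCone' subset_rfl
    have hN := (energy_union_le wideCone (wideCone' ∪ lowBox) f).trans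
      (add_le_add_right (energy_union_le wideCone' lowBox f) _)
    rw [union_cones_eq_univ, energy_univ] at hN
    rw [hR]
    set S₁ := (frameSum (V := Plane) h₁.memLp f).toReal
    set S₂ := (frameSum (V := Plane) h₂.memLp f).toReal
    set S₃ := (frameSum (V := Plane) h₃.memLp f).toReal
    have s₂ : 0 ≤ S₂ := ENNReal.toReal_nonneg
    have s₃ : 0 ≤ S₃ := ENNReal.toReal_nonneg
    have n₁ := energy_nonneg lowBox f
    have hr : 0 < κ₁ / κ := by positivity
    have hr1 : κ₁ / κ ≤ 1 := (div_le_one hκ).2 hκκ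
    -- Multiplying by `κ₁ / κ ≤ 1` brings the shearlet estimates to the density `κ₁` of the low
    -- frequency part.
    have scale : ∀ {x y S : ℝ}, 0 ≤ S → κ * x ≤ 2 * S + κ * y → κ₁ * x ≤ 2 * S + κ₁ * y := by
      intro x y S hs hx
      have h3 := mul_le_mul_of_nonneg_left hx hr.le
      have h4 : ∀ z, κ₁ / κ * (κ * z) = κ₁ * z := fun z => by field_simp
      rw [mul_add, h4, h4] at h3
      have h5 : κ₁ / κ * (2 * S) ≤ 2 * S := mul_le_of_le_one_left (by positivity) hr1
      linarith
    have k₂ := scale s₂ l₂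
    have k₃ := scale s₃ l₃
    have k₁ : κ₁ * (a * energy lowBox f) ≤ κ₁ * (a₁ * energy lowBox f) := by gcongr
    have k₄ : κ₁ * (a * ‖f‖ ^ 2) ≤
        κ₁ * (a * (energy wideCone f + (energy wideCone' f + energy lowBox f))) := by gcongr
    have k₅ : κ₁ * ((e₁ + e₂ + e₃) * ‖f‖ ^ 2) ≤ κ₁ * (a / 2 * ‖f‖ ^ 2) := by gcongr
    nlinarith
  · rw [hR]
    have u₁ := h₁.upper f
    have u₂ := h₂.upper f
    have u₃ := h₃.upper f
    linarith

theorem HasCompactSupp.comp_act {ψ : Plane → ℂ} (h : HasCompactSupp ψ)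
    {M : Matrix (Fin 2) (Fin 2) ℝ} (hM : M.det ≠ 0) (s : ℂ) (b : Plane) :
    HasCompactSupp fun x => s * ψ (act M x - b) := by
  obtain ⟨Q, hQ, h0⟩ := h
  set T : Plane ≃ₜ Plane := (matEquiv M hM).toHomeomorph.trans (Homeomorph.subRight b)
  have hT : ∀ x, T x = act M x - b := fun x => rfl
  have hq : Measure.QuasiMeasurePreserving T := by
    refine (measurePreserving_sub_right volume b).quasiMeasurePreserving.comp
      (g := fun x : Plane => x - b) (f := matEquiv M hM) ⟨(matEquiv M hM).continuous.measurable, ?_⟩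
    rw [map_matEquiv]
    exact Measure.smul_absolutelyContinuous
  refine ⟨T ⁻¹' Q, T.isCompact_preimage.2 hQ, ?_⟩
  filter_upwards [hq.ae h0] with x hx hn
  rw [← hT, hx hn, mul_zero]

theorem hasCompactSupp_tensor {φ : ℝ → ℂ} {r : ℝ}
    (h : ∀ᵐ x : ℝ, x ∉ Metric.closedBall (0 : ℝ) r → φ x = 0) : HasCompactSupp (tensor φ) := by
  refine ⟨Metric.closedBall 0 (r + r), isCompact_closedBall _ _, ?_⟩
  filter_upwards [(quasiMeasurePreserving_coord 0).ae h, (quasiMeasurePreserving_coord 1).ae h]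
    with x h0 h1 hx
  simp only [mem_closedBall_zero_iff, Real.norm_eq_abs, not_le] at h0 h1 hx
  rcases lt_or_ge r |x 0| with h2 | h2
  · rw [tensor, h0 h2, zero_mul]
  · rw [tensor, h1 (by linarith [norm_le_abs_add_abs x]), mul_zero]

theorem hasCompactSupp_system {φ : ℝ → ℂ} {ψ : Plane → ℂ} (hφ : HasCompactSupp (tensor φ))
    (hψ : HasCompactSupp ψ) (c₁ c₂ : ℝ) (i : (ℤ × ℤ) ⊕ ConeIndex ⊕ ConeIndex) :
    HasCompactSupp (system c₁ c₂ (tensor φ) ψ (swap ψ) i) := by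
  have hdet : ∀ j k, (coneMat j k).det ≠ 0 := fun j k => by rw [det_coneMat]; positivity
  rcases i with m | i | i
  · have h := hφ.comp_act (M := 1) (by simp) 1 (scaledPoint ![c₁, c₁] ((finTwoArrowEquiv ℤ).symm m))
    have e : ∀ x, act (1 : Matrix (Fin 2) (Fin 2) ℝ) x = x := fun x => by ext i; fin_cases i <;> simp [act_apply]
    simp only [e] at h
    simpa only [system, lowPart_eq] using h
  · rw [system, horizPart_eq]
    exact hψ.comp_act (by rw [Matrix.mul_one]; exact hdet _ _) _ _
  · rw [system, vertPart_swap_eq]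
    refine hψ.comp_act ?_ _ _
    rw [Matrix.det_mul]
    exact mul_ne_zero (hdet _ _) (by simp [swapMat])

end Frames

end Shearlet

/-! ### The main theorem. -/

theorem theorem4p8 (K L : ℕ) (hL : 10 ≤ L) (hLK : 3 * L ≤ 2 * K) (hKL : K + 2 ≤ 3 * L)
    (m₀ m₁ : ℝ → ℂ) (hm₀ : Shearlet.IsLowPass K L m₀) (hm₁ : Shearlet.IsBandPass m₀ m₁) :
    (∀ ξ : ℝ, Multipliable (Shearlet.scalingFactor m₀ ξ)) ∧
    ∃ (φ : Shearlet.L2Line) (ψ : Shearlet.L2Plane),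
      (𝓕 φ : Shearlet.L2Line) =ᵐ[volume] Shearlet.scalingHat m₀ ∧
      (𝓕 ψ : Shearlet.L2Plane) =ᵐ[volume] Shearlet.shearletHat m₀ m₁ ∧
      ∃ chat : ℝ, 0 < chat ∧ ∀ c₁ c₂ : ℝ, 0 < c₂ → c₂ ≤ c₁ → c₁ ≤ chat →
        Shearlet.IsFrameFor Shearlet.L2Cone (Shearlet.horizPart c₁ c₂ ψ) ∧
        Shearlet.IsFrameFor Set.univ
          (Shearlet.system c₁ c₂ (Shearlet.tensor φ) ψ (Shearlet.swap ψ)) ∧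
        ∀ i, Shearlet.HasCompactSupp
          (Shearlet.system c₁ c₂ (Shearlet.tensor φ) ψ (Shearlet.swap ψ) i) := by
  open Shearlet in
  have hL1 : 1 ≤ L := by omega
  -- From `2K ≥ 3L` and `L ≥ 10`: `K - L ≥ L/2 ≥ 5`, exactly what cubic decay needs.
  have hK : L + 5 ≤ K := by omega
  obtain ⟨i₀, l₀⟩ := hm₀.integrable_and_memLp_scalingHat hL1 hK
  obtain ⟨i₁, l₁⟩ := integrable_and_memLp_plane (measurable_shearletHat hm₀ hm₁)
    (shearletConst_pos K L).le (norm_shearletHat_le' hm₀ hm₁ hL1 hK)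
  have hφ := fourierInv_toLp_ae_eq i₀ l₀
  have hψ := fourierInv_toLp_ae_eq i₁ l₁
  obtain ⟨r₀, hr₀⟩ := hm₀.exists_ae_eq_zero (by omega) l₀.coeFn_toLp
  obtain ⟨r₁, hr₁⟩ := exists_ae_eq_zero_shearlet hm₀ hm₁ (by omega) l₁.coeFn_toLp
  refine ⟨hm₀.multipliable, 𝓕⁻ (l₀.toLp _), 𝓕⁻ (l₁.toLp _), ?_, ?_, ?_⟩
  · rw [FourierTransform.fourier_fourierInv_eq]; exact l₀.coeFn_toLp
  · rw [FourierTransform.fourier_fourierInv_eq]; exact l₁.coeFn_toLp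
  obtain ⟨B₁, e₁, -, he₁, H₁⟩ := exists_hasFrameBounds_lowPart hm₀ hL1 hK hφ
  obtain ⟨B₂, e₂, -, he₂, H₂⟩ := exists_hasFrameBounds_horizPart hm₀ hm₁ hL1 hK hψ
  obtain ⟨B₃, e₃, -, he₃, H₃⟩ := exists_hasFrameBounds_vertPart hm₀ hm₁ hL1 hK hψ
  set a : ℝ := ((1 / 2) ^ (3 * K)) ^ 2
  have ha : 0 < a := by positivity
  -- This makes the total aliasing error `(e₁ + e₂ + e₃) c₁` at most `a / 2`; the summand `1` keeps
  -- the denominator positive.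
  refine ⟨min 1 (a / 2 / (e₁ + e₂ + e₃ + 1)), by positivity, fun c₁ c₂ h2 h12 hc => ?_⟩
  have h1 : 0 < c₁ := h2.trans_le h12
  have hc1 : c₁ ≤ 1 := hc.trans (min_le_left _ _)
  have hc2 : (e₁ + e₂ + e₃ + 1) * c₁ ≤ a / 2 := by
    rw [mul_comm, ← le_div_iff₀ (by positivity)]
    exact hc.trans (min_le_right _ _)
  have n₁ : 0 ≤ e₁ * c₁ := by positivity
  have n₂ : 0 ≤ e₂ * c₁ := by positivity
  have n₃ : 0 ≤ e₃ * c₁ := by positivity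
  refine ⟨isFrameFor_L2Cone (by positivity) ha (by linarith) (H₂ c₁ c₂ h2 h12 hc1),
    isFrameFor_univ_sum (κ := (c₁ * c₂)⁻¹) (κ₁ := (c₁ * c₁)⁻¹) (by positivity) (by positivity)
      (by gcongr) ha ?_ (by linarith) (H₁ c₁ h1 hc1) (H₂ c₁ c₂ h2 h12 hc1) (H₃ c₁ c₂ h2 h12 hc1),
    hasCompactSupp_system (hasCompactSupp_tensor hr₀) ⟨_, isCompact_closedBall _ _, hr₁⟩ c₁ c₂⟩
  exact pow_le_pow_left₀ (by positivity)
    (pow_le_pow_of_le_one (by norm_num) (by norm_num) (by omega)) 2
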